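/- **Proposition.** Let $N\ge 1$, let $0<\theta_1<\dots<\theta_{2N}<\pi$, $\eta_j=e^{i\theta_j}$, and fix $\ell\in\{1,\dots,N\}$. For $\phi\in(\theta_{2\ell-1},\pi)$ put $\alpha=\alpha_\ell=e^{i\phi}$. The bands are the open arcs $\gamma_j$ of the unit circle from $\eta_{2j-1}$ to $\eta_{2j}$ ($1\le j\le \ell-1$) and $\gamma_\ell$ from $\eta_{2\ell-1}$ to $\alpha$; the gaps are the closed arcs $\gamma^{\rm gap}_j$ from $\eta_{2j}$ to $\eta_{2j+1}$ ($1\le j\le\ell-1$) and $\gamma_\ell^{\rm gap}$ from $\alpha$ to $-1$, all in the closed upper half plane; a bar denotes complex conjugation. Let $\mathfrak B=\{e^{is}:\theta_1\le s\le 2\pi-\theta_1\}$ be the closed arc formed by all bands, gaps and their conjugates. Let $$R_\ell(z)^2=(z-\alpha)(z-\alpha^{-1})\prod_{j=1}^{2\ell-1}(z-\eta_j)(z-\eta_j^{-1}),$$ with branch cuts along the bands and their conjugates, $R_\ell(z)\sim z^{2\ell}$ as $z\to\infty$ (so $R_\ell(0)=1$). Let $$P_\ell(z)=z^{-2}\Big(\sum_{j=0}^{\ell}B_j(z^{2\ell+2-j}+z^j)+B_{\ell+1}z^{\ell+1}\Big),\qquad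 Q_\ell(z)=z^{-3}\Big(\sum_{j=0}^{\ell+1}C_j(z^{2\ell+4-j}+z^j)+C_{\ell+2}z^{\ell+2}\Big)$$ with real coefficients such that $B_0=C_0=1$, $B_1=C_1=-\sum_{j=1}^{2\ell-1}\cos\theta_j-\cos\phi$, $$C_2=\tfrac18\Big[\Big(\sum_{j=1}^{2\ell-1}2\cos\theta_j\Big)^2-2\sum_{j=1}^{2\ell-1}2\cos2\theta_j+2+4\cos\phi\sum_{j=1}^{2\ell-1}2\cos\theta_j-2\cos2\phi\Big],$$ and the integrals of $P_\ell\,dz/R_\ell$ and $Q_\ell\,dz/R_\ell$ over every $\gamma_j^{\rm gap}$ and $\overline{\gamma_j^{\rm gap}}$, $1\le j\le\ell$, vanish. These conditions determine the coefficients uniquely (as functions of $\phi$). In $\mathbb C\setminus(\mathfrak B\cup\{0\})$ the integrals $\varphi_\ell^{(1)}(z)=\int_{\eta_1}^zP_\ell\,ds/R_\ell$ and $\varphi_\ell^{(2)}(z)=\int_{\eta_1}^zQ_\ell\,ds/R_\ell$ do not depend on the path; they are primitives of $P_\ell/R_\ell$, $Q_\ell/R_\ell$ that tend to $0$ at $\eta_1$.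 Then $P_\ell(\alpha^{\pm1})\ne0$, and $$\xi=\xi(\phi):=\frac{2Q_\ell(\alpha)}{P_\ell(\alpha)}=\frac{2Q_\ell(\alpha^{-1})}{P_\ell(\alpha^{-1})}$$ is real and differentiable in $\phi$ with $\dfrac{d\xi}{d\phi}<0$; thus $\operatorname{Re}\alpha$ is a strictly increasing function of $\xi$. Let $\Phi(z;\xi,1)=\xi(z-z^{-1})-(z^2-z^{-2})$ and, for this $\xi=\xi(\phi)$, $g_\ell=\frac{\xi}{2}\varphi^{(1)}_\ell-\varphi^{(2)}_\ell-\frac12\Phi(\cdot\,;\xi,1)$. Let $\Omega_0=0$ and, for $1\le k\le\ell$, $\Omega_k=\frac{\xi}{2}\Omega^{(1)}_k-\Omega_k^{(2)}$, where $\Omega^{(1)}_k$, $\Omega^{(2)}_k$ are twice the integrals of $P_\ell\,dz/R_\ell$, $Q_\ell\,dz/R_\ell$ from $\eta_1$ to $\eta_{2k}$ (to $\alpha$ if $k=\ell$) along a path outside the unit circle. Boundary values on the unit circle from the exterior and the interior are denoted by $+$ and $-$. Then: 1. $g_\ell$ is analytic in $\mathbb C\setminus\mathfrak B$ (with a removable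 singularity at $0$). 2. $g_{\ell+}+g_{\ell-}=-\Phi(z;\xi,1)$ on $\gamma_j\cup\overline{\gamma_j}$, and $g_{\ell+}-g_{\ell-}=\Omega_j$ on $\gamma^{\rm gap}_j\cup\overline{\gamma^{\rm gap}_j}$, for $j=1,\dots,\ell$. 3. There are constants $g_{\ell\infty},g_\ell^{(1)}$ with $g_\ell(z)=g_{\ell\infty}+g_\ell^{(1)}z^{-1}+\mathcal O(z^{-2})$ as $z\to\infty$ and $g_\ell(z)=-g_{\ell\infty}+\mathcal O(z)$ as $z\to0$. With the upper sign for $|z|>1$ and the lower sign for $|z|<1$, $$g_\ell(z)=-\tfrac12\Phi(z;\xi,1)\pm\tfrac12\Omega_{\lfloor j/2\rfloor}+\mathcal O\big(|z-w|^{1/2}\big),\quad z\to w\in\{\eta_j,\eta_j^{-1}\},\ j=1,\dots,2\ell-1,$$ $$g_\ell(z)=-\tfrac12\Phi(z;\xi,1)\pm\tfrac12\Omega_{\ell}+\mathcal O\big(|z-w|^{3/2}\big),\quad z\to w\in\{\alpha,\alpha^{-1}\};$$ for $j=1$, where $\Omega_0=0$, the estimate holds as $z\to w$ in all of $\mathbb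 C\setminus\mathfrak B$. 4. $g_\ell(z)+g_\ell(z^{-1})=0$ for $z\in\mathbb C\setminus(\mathfrak B\cup\{0\})$. -/

import Mathlib

open Filter Topology Asymptotics

noncomputable section

namespace DarkGas

/-- The point `e^{it}` of the unit circle. -/
def cis (t : ℝ) : ℂ := Complex.exp (t * Complex.I)

/-- Arguments of the points that separate bands and gaps in the closed upper half circle:
`θ 1 < … < θ (2ℓ-1)` (the arguments of the fixed endpoints `η_j`), then `φ = arg α_ℓ` at the
index `2ℓ`, then `π`. -/
def ang (θ : ℕ → ℝ) (ℓ : ℕ) (φ : ℝ) (j : ℕ) : ℝ :=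
  if j < 2 * ℓ then θ j else if j = 2 * ℓ then φ else Real.pi

/-- The `j`-th (open) band `γ_j`, for `1 ≤ j ≤ ℓ`. -/
def band (θ : ℕ → ℝ) (ℓ : ℕ) (φ : ℝ) (j : ℕ) : Set ℂ :=
  cis '' Set.Ioo (ang θ ℓ φ (2 * j - 1)) (ang θ ℓ φ (2 * j))

/-- The complex conjugate of the `j`-th band. -/
def bandConj (θ : ℕ → ℝ) (ℓ : ℕ) (φ : ℝ) (j : ℕ) : Set ℂ :=
  cis '' Set.Ioo (-ang θ ℓ φ (2 * j)) (-ang θ ℓ φ (2 * j - 1))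

/-- The `j`-th (closed) gap, for `1 ≤ j ≤ ℓ`; the last one is the arc `[α_ℓ, -1]`. -/
def gap (θ : ℕ → ℝ) (ℓ : ℕ) (φ : ℝ) (j : ℕ) : Set ℂ :=
  cis '' Set.Icc (ang θ ℓ φ (2 * j)) (ang θ ℓ φ (2 * j + 1))

/-- The complex conjugate of the `j`-th gap. -/
def gapConj (θ : ℕ → ℝ) (ℓ : ℕ) (φ : ℝ) (j : ℕ) : Set ℂ :=
  cis '' Set.Icc (-ang θ ℓ φ (2 * j + 1)) (-ang θ ℓ φ (2 * j))

/-- The closed arc from `η_1` through `-1` to `η_1⁻¹`: the union of all bands and gaps with their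
endpoints. -/
def cut (θ : ℕ → ℝ) : Set ℂ :=
  cis '' Set.Icc (θ 1) (2 * Real.pi - θ 1)

/-- The punctured plane slit along `cut`: the domain of the Abelian integrals. -/
def slitDomain (θ : ℕ → ℝ) : Set ℂ := {z | z ≠ 0 ∧ z ∉ cut θ}

/-- For `a < b < a + 2π`: the branch of `√((z - e^{ia})(z - e^{ib}))` whose cut is the arc
`{e^{it} : a ≤ t ≤ b}` and which is `~ z` at infinity. The Möbius map inside the principal square
root takes the arc `a < t < b` onto the negative half-line. -/
def arcSqrt (a b : ℝ) (z : ℂ) : ℂ :=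
  Complex.exp (-((b - a) / 4 * Complex.I)) * (z - cis b) *
    (Complex.exp ((b - a) / 2 * Complex.I) * ((z - cis a) / (z - cis b))) ^ (1 / 2 : ℂ)

theorem arcSqrt_sq (a b : ℝ) (z : ℂ) : arcSqrt a b z ^ 2 = (z - cis a) * (z - cis b) := by
  have hs : ∀ w : ℂ, (w ^ (1 / 2 : ℂ)) ^ 2 = w := by
    intro w
    rw [one_div]
    exact Complex.cpow_nat_inv_pow w two_ne_zero
  have he : Complex.exp (-((b - a) / 4 * Complex.I)) ^ 2 *
      Complex.exp ((b - a) / 2 * Complex.I) = 1 := by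
    rw [← Complex.exp_nat_mul, ← Complex.exp_add, ← Complex.exp_zero]
    congr 1
    push_cast
    ring
  unfold arcSqrt
  rw [mul_pow, mul_pow, hs]
  by_cases hz : z - cis b = 0
  · simp [hz]
  · calc _ = (Complex.exp (-((b - a) / 4 * Complex.I)) ^ 2 *
          Complex.exp ((b - a) / 2 * Complex.I)) * ((z - cis b) ^ 2 *
          ((z - cis a) / (z - cis b))) := by ring
      _ = _ := by rw [he]; field_simp

/-- `R_ℓ(z)`, with branch cuts along the bands and their conjugates, `~ z^{2ℓ}` at infinity. -/
def R (θ : ℕ → ℝ) (ℓ : ℕ) (φ : ℝ) (z : ℂ) : ℂ :=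
  ∏ j ∈ Finset.Icc 1 ℓ,
    (arcSqrt (ang θ ℓ φ (2 * j - 1)) (ang θ ℓ φ (2 * j)) z *
      arcSqrt (-ang θ ℓ φ (2 * j)) (-ang θ ℓ φ (2 * j - 1)) z)

/-- `P_ℓ(z)` with coefficients `B_0, …, B_{ℓ+1}`. -/
def P {ℓ : ℕ} (B : Fin (ℓ + 2) → ℝ) (z : ℂ) : ℂ :=
  ((∑ j : Fin (ℓ + 1), (B j.castSucc : ℂ) * z ^ (2 * ℓ + 2 - (j : ℕ))) +
    (∑ j : Fin (ℓ + 1), (B j.castSucc : ℂ) * z ^ (j : ℕ)) +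
    (B (Fin.last (ℓ + 1)) : ℂ) * z ^ (ℓ + 1)) / z ^ 2

/-- `Q_ℓ(z)` with coefficients `C_0, …, C_{ℓ+2}`. -/
def Q {ℓ : ℕ} (C : Fin (ℓ + 3) → ℝ) (z : ℂ) : ℂ :=
  ((∑ j : Fin (ℓ + 2), (C j.castSucc : ℂ) * z ^ (2 * ℓ + 4 - (j : ℕ))) +
    (∑ j : Fin (ℓ + 2), (C j.castSucc : ℂ) * z ^ (j : ℕ)) +
    (C (Fin.last (ℓ + 2)) : ℂ) * z ^ (ℓ + 2)) / z ^ 3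

/-- `∫ f(z) dz` along the arc of radius `r` about the origin from argument `a` to argument `b`. -/
def arcIntegral (f : ℂ → ℂ) (r a b : ℝ) : ℂ :=
  ∫ t in a..b, f (r * cis t) * (r * Complex.I * cis t)

/-- `∫ f(z) dz` along the segment of argument `a` from radius `r` to radius `s`. -/
def radialIntegral (f : ℂ → ℂ) (a r s : ℝ) : ℂ :=
  ∫ ρ in r..s, f (ρ * cis a) * cis a

/-- The integrals of `f(z) dz` over all gaps `γ_j^gap` and their conjugates, `1 ≤ j ≤ ℓ`,
vanish. -/
def GapIntegralsVanish (θ : ℕ → ℝ) (ℓ : ℕ) (φ : ℝ) (f : ℂ → ℂ) : Prop :=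
  ∀ j ∈ Finset.Icc 1 ℓ,
    arcIntegral f 1 (ang θ ℓ φ (2 * j)) (ang θ ℓ φ (2 * j + 1)) = 0 ∧
    arcIntegral f 1 (-ang θ ℓ φ (2 * j + 1)) (-ang θ ℓ φ (2 * j)) = 0

/-- The system that determines the coefficients of `P_ℓ`. -/
structure IsCoeffP (θ : ℕ → ℝ) (ℓ : ℕ) (φ : ℝ) (B : Fin (ℓ + 2) → ℝ) : Prop where
  zero : B 0 = 1
  one : B 1 = -(∑ j ∈ Finset.Icc 1 (2 * ℓ - 1), Real.cos (θ j)) - Real.cos φ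
  gaps : GapIntegralsVanish θ ℓ φ (fun z => P B z / R θ ℓ φ z)

/-- The system that determines the coefficients of `Q_ℓ`; here
`η_j + η_j⁻¹ = 2 cos θ_j` and `η_j² + η_j⁻² = 2 cos (2 θ_j)`. -/
structure IsCoeffQ (θ : ℕ → ℝ) (ℓ : ℕ) (φ : ℝ) (C : Fin (ℓ + 3) → ℝ) : Prop where
  zero : C 0 = 1
  one : C 1 = -(∑ j ∈ Finset.Icc 1 (2 * ℓ - 1), Real.cos (θ j)) - Real.cos φ
  two : C 2 = 1 / 8 *
    ((∑ j ∈ Finset.Icc 1 (2 * ℓ - 1), 2 * Real.cos (θ j)) ^ 2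
      - 2 * (∑ j ∈ Finset.Icc 1 (2 * ℓ - 1), 2 * Real.cos (2 * θ j)) + 2
      + 2 * (2 * Real.cos φ) * (∑ j ∈ Finset.Icc 1 (2 * ℓ - 1), 2 * Real.cos (θ j))
      - 2 * Real.cos (2 * φ))
  gaps : GapIntegralsVanish θ ℓ φ (fun z => Q C z / R θ ℓ φ z)

/-- `ξ = 2 Q_ℓ(α_ℓ) / P_ℓ(α_ℓ)` with `α_ℓ = e^{iφ}`, where the coefficients of `P_ℓ` and `Q_ℓ`
depend on `φ`. The quotient is real, which the theorem states. -/
def xi {ℓ : ℕ} (B : ℝ → Fin (ℓ + 2) → ℝ) (C : ℝ → Fin (ℓ + 3) → ℝ) (φ : ℝ) : ℝ :=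
  (2 * Q (C φ) (cis φ) / P (B φ) (cis φ)).re

/-- The phase `Φ(z; x, t)`. -/
def Phase (x t : ℝ) (z : ℂ) : ℂ :=
  x * (z - z⁻¹) - t * (z ^ 2 - (z ^ 2)⁻¹)

/-- `∫_{η_1}^z f(s) ds` in the slit domain, along the radius from `η_1 = e^{iθ_1}` to the circle
of radius `|z|` and then along that circle to `z`. -/
def abelIntegral (θ : ℕ → ℝ) (f : ℂ → ℂ) (z : ℂ) : ℂ :=
  radialIntegral f (θ 1) 1 ‖z‖ + arcIntegral f ‖z‖ (θ 1) z.arg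

/-- `φ_ℓ^{(1)}`. -/
def phi1 (θ : ℕ → ℝ) (ℓ : ℕ) (φ : ℝ) (B : Fin (ℓ + 2) → ℝ) : ℂ → ℂ :=
  abelIntegral θ (fun s => P B s / R θ ℓ φ s)

/-- `φ_ℓ^{(2)}`. -/
def phi2 (θ : ℕ → ℝ) (ℓ : ℕ) (φ : ℝ) (C : Fin (ℓ + 3) → ℝ) : ℂ → ℂ :=
  abelIntegral θ (fun s => Q C s / R θ ℓ φ s)

/-- `g_ℓ(z; ξ) = (ξ/2) φ_ℓ^{(1)}(z) - φ_ℓ^{(2)}(z) - Φ(z; ξ, 1)/2`. -/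
def g (θ : ℕ → ℝ) (ℓ : ℕ) (φ : ℝ) (B : Fin (ℓ + 2) → ℝ) (C : Fin (ℓ + 3) → ℝ) (ξ : ℝ)
    (z : ℂ) : ℂ :=
  (ξ / 2 * phi1 θ ℓ φ B z - phi2 θ ℓ φ C z) - Phase ξ 1 z / 2

/-- `2 ∫ f(z) dz` from `η_1` to the left end `η_{2k}` (`α_ℓ` if `k = ℓ`) of the `k`-th gap, along
a path outside the unit circle: radially out to radius 2, along that circle, radially back in. -/
def outerPeriod (θ : ℕ → ℝ) (ℓ : ℕ) (φ : ℝ) (f : ℂ → ℂ) (k : ℕ) : ℂ :=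
  2 * (radialIntegral f (θ 1) 1 2 + arcIntegral f 2 (θ 1) (ang θ ℓ φ (2 * k)) +
    radialIntegral f (ang θ ℓ φ (2 * k)) 2 1)

/-- `Ω_k(ξ) = (ξ/2) Ω_k^{(1)} - Ω_k^{(2)}` for `k ≥ 1`, and `Ω_0 = 0`. -/
def Om (θ : ℕ → ℝ) (ℓ : ℕ) (φ : ℝ) (B : Fin (ℓ + 2) → ℝ) (C : Fin (ℓ + 3) → ℝ) (ξ : ℝ)
    (k : ℕ) : ℂ :=
  if k = 0 then 0 else
    ξ / 2 * outerPeriod θ ℓ φ (fun s => P B s / R θ ℓ φ s) k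
      - outerPeriod θ ℓ φ (fun s => Q C s / R θ ℓ φ s) k

/-- The exterior of the unit circle; boundary values from here carry the index `+`. -/
def outside : Set ℂ := {z | 1 < ‖z‖}

/-- The interior of the unit circle; boundary values from here carry the index `-`. -/
def inside : Set ℂ := {z | ‖z‖ < 1}

/-- `h₊` and `h₋` are the boundary values of `h` at the point `z` of the unit circle. -/
def BoundaryValues (h : ℂ → ℂ) (z hp hm : ℂ) : Prop :=
  Tendsto h (𝓝[outside] z) (𝓝 hp) ∧ Tendsto h (𝓝[inside] z) (𝓝 hm)

/-- Near the point `w` of the unit circle, `h = -Φ/2 + O((z - w)^p)` up to the constant `c/2`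
outside and `-c/2` inside the unit circle. -/
def LocalBehaviour (h : ℂ → ℂ) (ξ : ℝ) (c w : ℂ) (p : ℝ) : Prop :=
  ((fun z => h z - (-(Phase ξ 1 z) / 2 + c / 2)) =O[𝓝[outside] w] fun z => ‖z - w‖ ^ p) ∧
  ((fun z => h z - (-(Phase ξ 1 z) / 2 - c / 2)) =O[𝓝[inside] w] fun z => ‖z - w‖ ^ p)

/-- `φ_ℓ^{(1)}` and `φ_ℓ^{(2)}` are primitives of `P_ℓ/R_ℓ` and `Q_ℓ/R_ℓ` on the slit domain that
vanish at `η_1`, so the choice of path in their definition does not matter. -/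
structure IntegralsWellDefined (θ : ℕ → ℝ) (ℓ : ℕ) (φ : ℝ) (B : Fin (ℓ + 2) → ℝ)
    (C : Fin (ℓ + 3) → ℝ) : Prop where
  deriv1 : ∀ z ∈ slitDomain θ, HasDerivAt (phi1 θ ℓ φ B) (P B z / R θ ℓ φ z) z
  deriv2 : ∀ z ∈ slitDomain θ, HasDerivAt (phi2 θ ℓ φ C) (Q C z / R θ ℓ φ z) z
  base1 : Tendsto (phi1 θ ℓ φ B) (𝓝[slitDomain θ] cis (θ 1)) (𝓝 0)
  base2 : Tendsto (phi2 θ ℓ φ C) (𝓝[slitDomain θ] cis (θ 1)) (𝓝 0)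

/-- The properties of the `g`-function. -/
structure GProperties (θ : ℕ → ℝ) (ℓ : ℕ) (φ : ℝ) (ξ : ℝ) (Ω : ℕ → ℂ) (h : ℂ → ℂ) : Prop where
  /-- Analyticity off the bands and gaps, including the removable singularity at `0`, and the
  expansions at infinity and at `0`. -/
  analytic_asymptotics : ∃ ginf g1 : ℂ,
    AnalyticOnNhd ℂ (Function.update h 0 (-ginf)) (cut θ)ᶜ ∧
    ((fun z => h z - (ginf + g1 / z)) =O[Bornology.cobounded ℂ] fun z => (z ^ 2)⁻¹) ∧
    ((fun z => h z - -ginf) =O[𝓝[≠] 0] fun z => z)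
  jump_band : ∀ j ∈ Finset.Icc 1 ℓ, ∀ z ∈ band θ ℓ φ j ∪ bandConj θ ℓ φ j,
    ∃ hp hm : ℂ, BoundaryValues h z hp hm ∧ hp + hm = -(Phase ξ 1 z)
  jump_gap : ∀ j ∈ Finset.Icc 1 ℓ, ∀ z ∈ gap θ ℓ φ j ∪ gapConj θ ℓ φ j,
    ∃ hp hm : ℂ, BoundaryValues h z hp hm ∧ hp - hm = Ω j
  local_first : ∀ w : ℂ, w = cis (θ 1) ∨ w = (cis (θ 1))⁻¹ →
    (fun z => h z - -(Phase ξ 1 z) / 2) =O[𝓝[slitDomain θ] w] fun z => ‖z - w‖ ^ (1 / 2 : ℝ)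
  local_eta : ∀ j ∈ Finset.Icc 1 (2 * ℓ - 1), ∀ w : ℂ, w = cis (θ j) ∨ w = (cis (θ j))⁻¹ →
    LocalBehaviour h ξ (Ω (j / 2)) w (1 / 2)
  local_alpha : ∀ w : ℂ, w = cis φ ∨ w = (cis φ)⁻¹ → LocalBehaviour h ξ (Ω ℓ) w (3 / 2)
  symmetry : ∀ z ∈ slitDomain θ, h z + h z⁻¹ = 0

end DarkGas

end

/-! ### Square roots cut along arcs of the unit circle. -/

noncomputable section
namespace DarkGas

/-! Everything is done in the coordinate `w = log z`. The palindromic numerators turn both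
differentials into `f(2 cosh w) dw / ρ(w)` (`kernel`), where `f` is a real monic polynomial, `p` of
degree `ℓ + 1` for `P` and `q` of degree `ℓ + 2` for `Q`, and `ρ(w) = e^{-ℓw} R(e^w)` satisfies `ρ²
= ∏ (2 cosh w - 2 cos τ_k)`, the `τ_k` being the arguments of the branch points. On the plane slit
along `iy`, `|y| ≥ θ₁`, the function `ρ` is even, real and without zeros. This domain is star-shaped
about `0`, so there is an odd, conjugation-symmetric primitive `prim` that vanishes at `0`.

Let `b(t)` (`bdry`) be the limit of `prim` at `it` from the right. By the two symmetries the limit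
from the left is `-conj b(t)`; the sum of both is `2i Im b(t)`, the difference `2 Re b(t)`. On the
imaginary axis `ρ²` is real, negative on bands and positive inside gaps, so `Im b` is constant along
each band and `Re b` along each gap. The expansion at `z = 0` leaves no residue, hence `prim` has
period `2πi` off the axis and `Im b(π) = 0`. The vanishing gap integrals carry this zero from `π`
down to `θ₁` (`bdry_ang_im`), so `Im b = 0` on all bands. On the arc through `z = 1`, `Re b` is
constant and vanishes at `0`. Thus `b(θ₁) = 0`, `prim ∘ log` is the Abelian integral from `η₁`
(`abelIntegral_eq`), and the jumps, the constants `Ω_k = 2 b(τ_{2k})` and the symmetry of `g` are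
read off. The exponents `1/2` and `3/2` come from the inverse square root singularity of the kernel,
which a square root coordinate opens up; `ξ` is the value for which `h = (ξ/2) p - q` vanishes at
the moving endpoint.

Coefficients: `1/ρ` has constant sign on a gap, so a vanishing integral forces a root of `f` there.
A polynomial of degree `< ℓ` with `ℓ` vanishing gap integrals is therefore zero, and the square
linear system for the coefficients is injective. Moreover the integral over the arc from `0` to `θ₁`
vanishes by itself, so a normalised `f` has `ℓ + 1` such roots.

Monotonicity: on the gaps away from the moving endpoint the conditions read `∫ f(2 cos u) W(u) (2
cos u - a)^{-1/2} du = 0` with `a = 2 cos φ` and `W` independent of `φ`. Write `h = (X - a) h₁`, and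
let `ḣ` be the derivative of `h` in `φ` through the coefficients of `p` and `q`, with `ξ` frozen.
Differentiating the conditions shows that `ḣ - sin φ · h₁` satisfies them again; its degree is `<
ℓ`, so it is zero (`deriv_eq_of_root`). Differentiating `h(a) = 0` then gives `ξ' = 2 sin φ · h₁(a)
/ p(a)`. Finally `p` and `-h₁` are monic of degree `ℓ + 1` with one root in each of the same `ℓ + 1`
gaps, so they have equal sign at `a` and `ξ' < 0`. -/

theorem cis_eq (t : ℝ) : cis t = Real.cos t + Real.sin t * Complex.I := by
  simp [cis, Complex.exp_mul_I]

theorem norm_cis (t : ℝ) : ‖cis t‖ = 1 := by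
  simp [cis, Complex.norm_exp_ofReal_mul_I]

theorem cis_ne_zero (t : ℝ) : cis t ≠ 0 := Complex.exp_ne_zero _

theorem cis_inv (t : ℝ) : (cis t)⁻¹ = cis (-t) := by
  simp [cis, ← Complex.exp_neg]

theorem cis_add_inv (t : ℝ) : cis t + (cis t)⁻¹ = 2 * Real.cos t := by
  rw [cis_inv, cis_eq, cis_eq]; simp; ring

/-- Multiplying by the conjugate denominator shows the argument of the square root in `arcSqrt` up
to a positive factor. If `sin ((b - a) / 2) ≠ 0` it is real only for `|z| = 1`, and on the circle
its sign tells whether `z` lies on the arc. -/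
theorem mobius_mul_conj (a b : ℝ) (z : ℂ) :
    Complex.exp ((b - a) / 2 * Complex.I) * (z - cis a) * (starRingEnd ℂ) (z - cis b) =
      ⟨(Complex.normSq z + 1) * Real.cos ((b - a) / 2) - 2 * (z * cis (-((a + b) / 2))).re,
        (Complex.normSq z - 1) * Real.sin ((b - a) / 2)⟩ := by
  obtain ⟨m, δ, rfl, rfl⟩ : ∃ m δ : ℝ, a = m - δ ∧ b = m + δ :=
    ⟨(a + b) / 2, (b - a) / 2, by ring, by ring⟩
  have e : Complex.exp (((m + δ : ℝ) - (m - δ : ℝ)) / 2 * Complex.I) = cis δ := by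
    rw [cis]; congr 1; push_cast; ring
  have e1 : (m + δ - (m - δ)) / 2 = δ := by ring
  have e2 : -((m - δ + (m + δ)) / 2) = -m := by ring
  rw [e, e1, e2]
  simp only [cis_eq, Real.cos_add, Real.sin_add, Real.cos_sub, Real.sin_sub, Real.cos_neg,
    Real.sin_neg]
  have hm := Real.sin_sq_add_cos_sq m
  have hd := Real.sin_sq_add_cos_sq δ
  generalize Real.cos m = cm at *
  generalize Real.sin m = sm at *
  generalize Real.cos δ = cd at *
  generalize Real.sin δ = sd at *
  obtain ⟨x, y⟩ := z
  apply Complex.ext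
  · simp [Complex.normSq_apply]
    linear_combination (cd * (sd ^ 2 + cd ^ 2)) * hm + (cd - 2 * cm * x - 2 * sm * y) * hd
  · simp [Complex.normSq_apply]
    linear_combination (-sd * (sd ^ 2 + cd ^ 2)) * hm + (-sd) * hd

theorem mobius_mem_slitPlane {a b : ℝ} {z : ℂ} (hz : z ≠ cis b)
    (h : 0 < (Complex.normSq z + 1) * Real.cos ((b - a) / 2) -
        2 * (z * cis (-((a + b) / 2))).re ∨
      (Complex.normSq z - 1) * Real.sin ((b - a) / 2) ≠ 0) :
    Complex.exp ((b - a) / 2 * Complex.I) * ((z - cis a) / (z - cis b)) ∈ Complex.slitPlane := by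
  have hz' : z - cis b ≠ 0 := sub_ne_zero.2 hz
  have hn : 0 < Complex.normSq (z - cis b) := Complex.normSq_pos.2 hz'
  have key : Complex.exp ((b - a) / 2 * Complex.I) * ((z - cis a) / (z - cis b)) =
      ((Complex.normSq (z - cis b))⁻¹ : ℝ) * (⟨(Complex.normSq z + 1) * Real.cos ((b - a) / 2) -
        2 * (z * cis (-((a + b) / 2))).re,
        (Complex.normSq z - 1) * Real.sin ((b - a) / 2)⟩ : ℂ) := by
    rw [← mobius_mul_conj, div_eq_mul_inv (z - cis a), Complex.inv_def (z - cis b)]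
    push_cast
    ring
  rw [key, Complex.mem_slitPlane_iff, Complex.re_ofReal_mul, Complex.im_ofReal_mul]
  rcases h with h | h
  · left; positivity
  · right; exact mul_ne_zero (inv_ne_zero hn.ne') h

theorem differentiableAt_arcSqrt {a b : ℝ} {z : ℂ} (hz : z ≠ cis b)
    (h : 0 < (Complex.normSq z + 1) * Real.cos ((b - a) / 2) -
        2 * (z * cis (-((a + b) / 2))).re ∨
      (Complex.normSq z - 1) * Real.sin ((b - a) / 2) ≠ 0) :
    DifferentiableAt ℂ (arcSqrt a b) z := by
  have hm := mobius_mem_slitPlane hz h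
  have hz' : z - cis b ≠ 0 := sub_ne_zero.2 hz
  unfold arcSqrt
  refine DifferentiableAt.mul (by fun_prop) ?_
  refine DifferentiableAt.cpow ?_ (by fun_prop) hm
  refine DifferentiableAt.const_mul ?_ _
  exact DifferentiableAt.div (by fun_prop) (by fun_prop) hz'

theorem differentiableAt_arcSqrt_of_norm_ne_one {a b : ℝ} (hab : a < b) (hb : b < a + 2 * Real.pi)
    {z : ℂ} (hz : ‖z‖ ≠ 1) : DifferentiableAt ℂ (arcSqrt a b) z := by
  refine differentiableAt_arcSqrt ?_ (Or.inr (mul_ne_zero ?_ ?_))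
  · rintro rfl; exact hz (norm_cis b)
  · rw [Complex.normSq_eq_norm_sq, sub_ne_zero]
    intro h
    exact hz ((pow_eq_one_iff_of_nonneg (norm_nonneg z) two_ne_zero).1 h)
  · exact (Real.sin_pos_of_pos_of_lt_pi (by linarith) (by linarith)).ne'

theorem cos_lt_cos_of_lt_of_lt {x δ : ℝ} (hδ : 0 < δ) (h1 : δ < x) (h2 : x < 2 * Real.pi - δ) :
    Real.cos x < Real.cos δ := by
  have : 0 < Real.cos δ - Real.cos x := by
    rw [Real.cos_sub_cos]
    have e : Real.sin ((δ - x) / 2) = -Real.sin ((x - δ) / 2) := by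
      rw [← Real.sin_neg]; congr 1; ring
    rw [e]
    have h3 := Real.sin_pos_of_pos_of_lt_pi (x := (x - δ) / 2) (by linarith) (by linarith)
    have h4 := Real.sin_pos_of_pos_of_lt_pi (x := (δ + x) / 2) (by linarith) (by linarith)
    nlinarith [mul_pos h3 h4]
  linarith

/-- For `z = e^{it}`, with `m = (a + b) / 2` and `δ = (b - a) / 2`, the real part in
`mobius_mul_conj` is `2 cos δ - 2 cos (t - m)`, which is positive off the closed arc. -/
theorem differentiableAt_arcSqrt_cis {a b t : ℝ} (hab : a < b)
    (ht : (b - 2 * Real.pi < t ∧ t < a) ∨ (b < t ∧ t < a + 2 * Real.pi)) :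
    DifferentiableAt ℂ (arcSqrt a b) (cis t) := by
  have key : Real.cos (t - (a + b) / 2) < Real.cos ((b - a) / 2) := by
    rcases ht with ⟨h1, h2⟩ | ⟨h1, h2⟩
    · rw [← Real.cos_neg]
      exact cos_lt_cos_of_lt_of_lt (by linarith) (by linarith) (by linarith)
    · exact cos_lt_cos_of_lt_of_lt (by linarith) (by linarith) (by linarith)
  have e : cis t * cis (-((a + b) / 2)) = cis (t - (a + b) / 2) := by
    simp only [cis, ← Complex.exp_add]; congr 1; push_cast; ring
  have hre : ∀ s, (cis s).re = Real.cos s := by intro s; simp [cis_eq, Complex.cos_ofReal_re]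
  refine differentiableAt_arcSqrt ?_ (Or.inl ?_)
  · intro h
    have h3 : (cis (b - (a + b) / 2)).re = (cis (t - (a + b) / 2)).re := by
      rw [← e, h]; congr 1
      simp only [cis, ← Complex.exp_add]; congr 1; push_cast; ring
    rw [hre, hre] at h3
    have : b - (a + b) / 2 = (b - a) / 2 := by ring
    rw [this] at h3
    linarith
  · rw [e, hre, Complex.normSq_eq_norm_sq, norm_cis]
    linarith

/-- At `0` the root is taken of `e^{-i(b - a)/2}`, and `-(b - a)/2` lies in `(-π, 0)`, so the
principal branch simply halves the exponent. -/
theorem arcSqrt_zero {a b : ℝ} (hab : a < b) (hb : b < a + 2 * Real.pi) :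
    arcSqrt a b 0 = -cis ((a + b) / 2) := by
  have e : Complex.exp ((b - a) / 2 * Complex.I) * ((0 - cis a) / (0 - cis b)) =
      Complex.exp (-((b - a) / 2 * Complex.I)) := by
    have : (0 - cis a) / (0 - cis b) = cis a / cis b := by
      simp [neg_div_neg_eq]
    rw [this, cis, cis, ← Complex.exp_sub, ← Complex.exp_add]
    congr 1; ring
  unfold arcSqrt
  rw [e, Complex.cpow_def_of_ne_zero (Complex.exp_ne_zero _), Complex.log_exp]
  · rw [cis, cis, zero_sub, mul_neg, neg_mul, ← Complex.exp_add, ← Complex.exp_add]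
    congr 2; push_cast; ring
  · have : (-(((b:ℂ) - a) / 2 * Complex.I)).im = -((b - a) / 2) := by
      simp
    rw [this]; linarith
  · have : (-(((b:ℂ) - a) / 2 * Complex.I)).im = -((b - a) / 2) := by
      simp
    rw [this]; linarith [Real.pi_pos]

end DarkGas
end

/-! ### The function `R`, its square, and its symmetries in the logarithmic coordinate. -/

noncomputable section
namespace DarkGas

/-- The separating arguments are increasing in `(0, π]`. -/
structure Admissible (θ : ℕ → ℝ) (ℓ : ℕ) (φ : ℝ) : Prop where
  one_le : 1 ≤ ℓ
  pos : 0 < ang θ ℓ φ 1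
  mono : StrictMonoOn (ang θ ℓ φ) (Set.Icc 1 (2 * ℓ + 1))

variable {θ : ℕ → ℝ} {ℓ : ℕ} {φ : ℝ}

theorem ang_last (θ : ℕ → ℝ) (ℓ : ℕ) (φ : ℝ) : ang θ ℓ φ (2 * ℓ + 1) = Real.pi := by
  simp [ang]

theorem ang_two_mul (θ : ℕ → ℝ) (ℓ : ℕ) (φ : ℝ) : ang θ ℓ φ (2 * ℓ) = φ := by
  simp [ang]

theorem ang_of_lt {k : ℕ} (hk : k < 2 * ℓ) : ang θ ℓ φ k = θ k := by
  simp [ang, hk]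

namespace Admissible

theorem ang_one (H : Admissible θ ℓ φ) : ang θ ℓ φ 1 = θ 1 :=
  ang_of_lt (by have := H.one_le; omega)

theorem lt (H : Admissible θ ℓ φ) {i j : ℕ} (hi : 1 ≤ i) (hij : i < j) (hj : j ≤ 2 * ℓ + 1) :
    ang θ ℓ φ i < ang θ ℓ φ j :=
  H.mono ⟨hi, by omega⟩ ⟨by omega, hj⟩ hij

theorem le (H : Admissible θ ℓ φ) {i j : ℕ} (hi : 1 ≤ i) (hij : i ≤ j) (hj : j ≤ 2 * ℓ + 1) :
    ang θ ℓ φ i ≤ ang θ ℓ φ j :=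
  H.mono.monotoneOn ⟨hi, by omega⟩ ⟨by omega, hj⟩ hij

theorem ang_pos (H : Admissible θ ℓ φ) {k : ℕ} (hk : 1 ≤ k) (hk' : k ≤ 2 * ℓ + 1) :
    0 < ang θ ℓ φ k := H.pos.trans_le (H.le le_rfl hk hk')

theorem ang_lt_pi (H : Admissible θ ℓ φ) {k : ℕ} (hk : 1 ≤ k) (hk' : k ≤ 2 * ℓ) :
    ang θ ℓ φ k < Real.pi := by
  rw [← ang_last θ ℓ φ]; exact H.lt hk (by omega) le_rfl

theorem theta_pos (H : Admissible θ ℓ φ) : 0 < θ 1 := H.ang_one ▸ H.pos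

theorem theta_lt_pi (H : Admissible θ ℓ φ) : θ 1 < Real.pi :=
  H.ang_one ▸ H.ang_lt_pi le_rfl (by have := H.one_le; omega)

theorem theta_le (H : Admissible θ ℓ φ) {k : ℕ} (hk : 1 ≤ k) (hk' : k ≤ 2 * ℓ + 1) :
    θ 1 ≤ ang θ ℓ φ k := H.ang_one ▸ H.le le_rfl hk hk'

end Admissible

/-- Groups the branch points by bands: signs and branches are controlled per band, zeros per branch
point. -/
theorem prod_pairs {M : Type*} [CommMonoid M] (u : ℕ → M) (n : ℕ) :
    ∏ j ∈ Finset.Icc 1 n, (u (2 * j - 1) * u (2 * j)) = ∏ k ∈ Finset.Icc 1 (2 * n), u k := by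
  induction n with
  | zero => simp
  | succ n ih =>
    rw [Finset.prod_Icc_succ_top (by omega), ih, show 2 * (n + 1) = 2 * n + 1 + 1 by ring,
      Finset.prod_Icc_succ_top (by omega), Finset.prod_Icc_succ_top (by omega), mul_assoc]
    simp

theorem sq_R (θ : ℕ → ℝ) (ℓ : ℕ) (φ : ℝ) (z : ℂ) :
    R θ ℓ φ z ^ 2 = ∏ k ∈ Finset.Icc 1 (2 * ℓ), (z ^ 2 - 2 * Real.cos (ang θ ℓ φ k) * z + 1) := by
  have h : ∀ t : ℝ, (z - cis t) * (z - cis (-t)) = z ^ 2 - 2 * Real.cos t * z + 1 := by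
    intro t
    rw [← cis_add_inv t, ← cis_inv t]
    linear_combination (mul_inv_cancel₀ (cis_ne_zero t))
  rw [← prod_pairs, R, ← Finset.prod_pow]
  refine Finset.prod_congr rfl fun j _ => ?_
  rw [mul_pow, arcSqrt_sq, arcSqrt_sq, ← h, ← h]
  ring

theorem differentiableAt_R_of_norm_ne_one (H : Admissible θ ℓ φ) {z : ℂ} (hz : ‖z‖ ≠ 1) :
    DifferentiableAt ℂ (R θ ℓ φ) z := by
  unfold R
  refine DifferentiableAt.fun_finsetProd fun j hj => ?_
  rw [Finset.mem_Icc] at hj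
  have h1 := H.lt (i := 2 * j - 1) (j := 2 * j) (by omega) (by omega) (by omega)
  have h2 := H.ang_pos (k := 2 * j - 1) (by omega) (by omega)
  have h3 := H.ang_lt_pi (k := 2 * j) (by omega) (by omega)
  exact (differentiableAt_arcSqrt_of_norm_ne_one h1 (by linarith) hz).mul
    (differentiableAt_arcSqrt_of_norm_ne_one (by linarith) (by linarith) hz)

theorem differentiableAt_R_cis (H : Admissible θ ℓ φ) {t : ℝ} (h0 : -θ 1 < t) (hpi : t ≤ Real.pi)
    (ht : ∀ j ∈ Finset.Icc 1 ℓ, t < ang θ ℓ φ (2 * j - 1) ∨ ang θ ℓ φ (2 * j) < t) :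
    DifferentiableAt ℂ (R θ ℓ φ) (cis t) := by
  unfold R
  refine DifferentiableAt.fun_finsetProd fun j hj => ?_
  have h := ht j hj
  rw [Finset.mem_Icc] at hj
  have h1 := H.lt (i := 2 * j - 1) (j := 2 * j) (by omega) (by omega) (by omega)
  have h2 := H.theta_le (k := 2 * j - 1) (by omega) (by omega)
  have h3 := H.ang_lt_pi (k := 2 * j) (by omega) (by omega)
  have h4 := H.theta_pos
  have h5 := H.theta_lt_pi
  refine DifferentiableAt.mul (differentiableAt_arcSqrt_cis h1 ?_)
    (differentiableAt_arcSqrt_cis (by linarith) (Or.inr ⟨by linarith, by linarith⟩))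
  rcases h with h | h
  · exact Or.inl ⟨by linarith, h⟩
  · exact Or.inr ⟨h, by linarith⟩

/-- The factors of a band and of its conjugate are `-e^{im}` and `-e^{-im}` at `0`, so each pair
contributes `1` and no sign is left open. -/
theorem R_zero (H : Admissible θ ℓ φ) : R θ ℓ φ 0 = 1 := by
  unfold R
  refine Finset.prod_eq_one fun j hj => ?_
  rw [Finset.mem_Icc] at hj
  have h1 := H.lt (i := 2 * j - 1) (j := 2 * j) (by omega) (by omega) (by omega)
  have h2 := H.ang_pos (k := 2 * j - 1) (by omega) (by omega)
  have h3 := H.ang_lt_pi (k := 2 * j) (by omega) (by omega)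
  rw [arcSqrt_zero h1 (by linarith), arcSqrt_zero (by linarith) (by linarith), neg_mul_neg]
  simp only [cis, ← Complex.exp_add]
  rw [← Complex.exp_zero]; congr 1; push_cast; ring

/-- `∏ (2 cosh w - 2 cos τ_k)` over the branch points; this is `R(e^w)² e^{-2ℓw}`. -/
def branchProd (θ : ℕ → ℝ) (ℓ : ℕ) (φ : ℝ) (w : ℂ) : ℂ :=
  ∏ k ∈ Finset.Icc 1 (2 * ℓ), (2 * Complex.cosh w - 2 * Real.cos (ang θ ℓ φ k))

/-- `R` in the logarithmic coordinate, normalised to be even. -/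
def rootFn (θ : ℕ → ℝ) (ℓ : ℕ) (φ : ℝ) (w : ℂ) : ℂ :=
  Complex.exp (-(ℓ * w)) * R θ ℓ φ (Complex.exp w)

theorem two_mul_cosh (w : ℂ) : 2 * Complex.cosh w = Complex.exp w + (Complex.exp w)⁻¹ := by
  rw [Complex.cosh, Complex.exp_neg]; ring

theorem rootFn_sq (θ : ℕ → ℝ) (ℓ : ℕ) (φ : ℝ) (w : ℂ) :
    rootFn θ ℓ φ w ^ 2 = branchProd θ ℓ φ w := by
  have h : ∀ k, Complex.exp w ^ 2 - 2 * Real.cos (ang θ ℓ φ k) * Complex.exp w + 1 =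
      Complex.exp w * (2 * Complex.cosh w - 2 * Real.cos (ang θ ℓ φ k)) := by
    intro k
    have := Complex.exp_ne_zero w
    rw [two_mul_cosh]
    field_simp
    ring
  rw [rootFn, mul_pow, sq_R, branchProd]
  simp_rw [h]
  rw [Finset.prod_mul_distrib, Finset.prod_const, Nat.card_Icc, ← mul_assoc, ← Complex.exp_nat_mul,
    ← Complex.exp_nat_mul, ← Complex.exp_add]
  have : ((2 : ℕ) : ℂ) * -(ℓ * w) + ((2 * ℓ + 1 - 1 : ℕ) : ℂ) * w = 0 := by
    rw [Nat.add_sub_cancel]; push_cast; ring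
  rw [this, Complex.exp_zero, one_mul]

/-- The preimage of the slit domain under `exp`, up to periodicity: star-shaped about `0`. -/
def logDomain (θ : ℕ → ℝ) : Set ℂ := {w | w.re ≠ 0 ∨ |w.im| < θ 1}

theorem isOpen_logDomain (θ : ℕ → ℝ) : IsOpen (logDomain θ) := by
  apply IsOpen.union
  · exact isOpen_ne_fun Complex.continuous_re continuous_const
  · exact isOpen_lt (continuous_abs.comp Complex.continuous_im) continuous_const

theorem smul_mem_logDomain (hθ : 0 < θ 1) {w : ℂ} (hw : w ∈ logDomain θ) {s : ℝ} (hs : 0 ≤ s)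
    (hs' : s ≤ 1) : (s : ℂ) * w ∈ logDomain θ := by
  rcases hs.eq_or_lt with rfl | h
  · right; simpa using hθ
  rcases hw with hw | hw
  · left; simpa using ⟨h.ne', hw⟩
  · right
    rw [Complex.im_ofReal_mul, abs_mul, abs_of_pos h]
    exact (mul_le_of_le_one_left (abs_nonneg _) hs').trans_lt hw

theorem zero_mem_logDomain (hθ : 0 < θ 1) : (0 : ℂ) ∈ logDomain θ := by
  right; simpa using hθ

theorem isPreconnected_logDomain (hθ : 0 < θ 1) : IsPreconnected (logDomain θ) := by
  have : StarConvex ℝ 0 (logDomain θ) := by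
    rw [starConvex_zero_iff]
    intro w hw s hs hs'
    rw [Complex.real_smul]
    exact smul_mem_logDomain hθ hw hs hs'
  exact (this.isPathConnected (zero_mem_logDomain hθ)).isConnected.isPreconnected

theorem neg_mem_logDomain {w : ℂ} (hw : w ∈ logDomain θ) : -w ∈ logDomain θ := by
  simpa [logDomain] using hw

theorem conj_mem_logDomain {w : ℂ} (hw : w ∈ logDomain θ) :
    (starRingEnd ℂ) w ∈ logDomain θ := by
  simpa [logDomain] using hw

theorem branchProd_eq_zero_iff (w : ℂ) : branchProd θ ℓ φ w = 0 ↔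
    ∃ k ∈ Finset.Icc 1 (2 * ℓ), Complex.cosh w = Real.cos (ang θ ℓ φ k) := by
  rw [branchProd, Finset.prod_eq_zero_iff]
  refine exists_congr fun k => and_congr_right fun _ => ?_
  rw [sub_eq_zero]
  exact mul_right_inj' two_ne_zero

theorem cosh_im_eq {w : ℂ} {c : ℝ} (h : Complex.cosh w = c) :
    Real.sinh w.re * Real.sin w.im = 0 ∧ Real.cosh w.re * Real.cos w.im = c := by
  rw [← Complex.re_add_im w, Complex.cosh_add, Complex.cosh_mul_I, Complex.sinh_mul_I] at h
  constructor
  · have := congrArg Complex.im h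
    simpa [← Complex.ofReal_cosh, ← Complex.ofReal_sinh, ← Complex.ofReal_cos,
      ← Complex.ofReal_sin] using this
  · have := congrArg Complex.re h
    simpa [← Complex.ofReal_cosh, ← Complex.ofReal_sinh, ← Complex.ofReal_cos,
      ← Complex.ofReal_sin] using this

/-- If `cosh w` is real, then `sinh (re w) sin (im w) = 0`; the second factor cannot vanish, since
then `|cosh w| ≥ 1 > |cos t|`. -/
theorem re_eq_zero_of_cosh_eq_cos {w : ℂ} {t : ℝ} (h0 : 0 < t) (hpi : t < Real.pi)
    (h : Complex.cosh w = Real.cos t) : w.re = 0 := by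
  obtain ⟨h1, h2⟩ := cosh_im_eq h
  rcases mul_eq_zero.1 h1 with h1 | h1
  · exact Real.sinh_eq_zero.1 h1
  · exfalso
    have h3 := Real.one_le_cosh w.re
    have h4 : Real.cos w.im ^ 2 = 1 := by nlinarith [Real.sin_sq_add_cos_sq w.im]
    have h5 : 0 < Real.sin t := Real.sin_pos_of_pos_of_lt_pi h0 hpi
    have h6 : Real.cos t ^ 2 < 1 := by nlinarith [Real.sin_sq_add_cos_sq t]
    rw [← h2, mul_pow, h4] at h6
    nlinarith

theorem branchProd_ne_zero (H : Admissible θ ℓ φ) {w : ℂ} (hw : w ∈ logDomain θ) :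
    branchProd θ ℓ φ w ≠ 0 := by
  rw [Ne, branchProd_eq_zero_iff]
  rintro ⟨k, hk, h⟩
  rw [Finset.mem_Icc] at hk
  have h1 := H.theta_le (k := k) hk.1 (by omega)
  have h2 := H.ang_lt_pi hk.1 hk.2
  have h3 := H.ang_pos (k := k) hk.1 (by omega)
  have h4 := re_eq_zero_of_cosh_eq_cos h3 h2 h
  obtain ⟨-, h5⟩ := cosh_im_eq h
  rw [h4, Real.cosh_zero, one_mul, ← Real.cos_abs w.im] at h5
  have h6 : |w.im| < θ 1 := hw.resolve_left (by simp [h4])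
  exact absurd h5 (Real.cos_lt_cos_of_nonneg_of_le_pi (abs_nonneg _) h2.le (by linarith)).ne'

theorem exp_I_mul (t : ℝ) : Complex.exp (t * Complex.I) = cis t := rfl

theorem differentiableAt_rootFn_of_R {w : ℂ} (h : DifferentiableAt ℂ (R θ ℓ φ) (Complex.exp w)) :
    DifferentiableAt ℂ (rootFn θ ℓ φ) w := by
  unfold rootFn
  exact DifferentiableAt.mul (by fun_prop)
    (DifferentiableAt.comp (g := R θ ℓ φ) w h Complex.differentiableAt_exp)

theorem differentiableAt_rootFn (H : Admissible θ ℓ φ) {w : ℂ} (hw : w ∈ logDomain θ) :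
    DifferentiableAt ℂ (rootFn θ ℓ φ) w := by
  apply differentiableAt_rootFn_of_R
  by_cases h : w.re = 0
  · have h1 := hw.resolve_left (by simp [h])
    have h2 : w = (w.im : ℂ) * Complex.I := by
      apply Complex.ext <;> simp [h]
    rw [h2, exp_I_mul]
    rw [abs_lt] at h1
    refine differentiableAt_R_cis H h1.1 (h1.2.trans H.theta_lt_pi).le fun j hj => Or.inl ?_
    rw [Finset.mem_Icc] at hj
    exact h1.2.trans_le (H.theta_le (by omega) (by omega))
  · apply differentiableAt_R_of_norm_ne_one H
    rw [Complex.norm_exp]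
    simpa using h

theorem branchProd_neg (w : ℂ) : branchProd θ ℓ φ (-w) = branchProd θ ℓ φ w := by
  simp [branchProd]

theorem branchProd_conj (w : ℂ) :
    branchProd θ ℓ φ ((starRingEnd ℂ) w) = (starRingEnd ℂ) (branchProd θ ℓ φ w) := by
  simp only [branchProd, map_prod, map_sub, map_mul, Complex.conj_ofReal, Complex.cosh_conj,
    Complex.conj_ofNat]

theorem rootFn_ne_zero (H : Admissible θ ℓ φ) {w : ℂ} (hw : w ∈ logDomain θ) :
    rootFn θ ℓ φ w ≠ 0 := fun h => branchProd_ne_zero H hw (by rw [← rootFn_sq, h]; simp)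

/-- Both sides are continuous square roots of the same zero-free function on a connected set, and
they agree at `0`. The same argument proves `rootFn_conj`, where agreement at `0` holds because
`ρ(0)² = ∏ (2 - 2 cos τ_k) ≥ 0` makes `ρ(0)` real. -/
theorem rootFn_neg (H : Admissible θ ℓ φ) {w : ℂ} (hw : w ∈ logDomain θ) :
    rootFn θ ℓ φ (-w) = rootFn θ ℓ φ w := by
  have hc : ContinuousOn (rootFn θ ℓ φ) (logDomain θ) := fun v hv =>
    (differentiableAt_rootFn H hv).continuousAt.continuousWithinAt
  refine (isPreconnected_logDomain H.theta_pos).eq_of_sq_eq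
    (f := fun w => rootFn θ ℓ φ (-w)) (g := rootFn θ ℓ φ) ?_ hc ?_
    (fun hx => rootFn_ne_zero H hx) (zero_mem_logDomain H.theta_pos) (by simp) hw
  · exact hc.comp continuous_neg.continuousOn fun v hv => neg_mem_logDomain hv
  · intro v _
    simp only [Pi.pow_apply, rootFn_sq, branchProd_neg]

/-- A complex number whose square is a nonnegative real is real. -/
theorem conj_eq_of_sq_eq {u : ℂ} {c : ℝ} (hc : 0 ≤ c) (h : u ^ 2 = c) :
    (starRingEnd ℂ) u = u := by
  rw [Complex.conj_eq_iff_im]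
  have h1 := congrArg Complex.re h
  have h2 := congrArg Complex.im h
  simp [pow_two] at h1 h2
  have h3 : u.re * u.im = 0 := by linarith
  rcases mul_eq_zero.1 h3 with h3 | h3
  · rw [h3] at h1; nlinarith
  · exact h3

theorem rootFn_conj (H : Admissible θ ℓ φ) {w : ℂ} (hw : w ∈ logDomain θ) :
    rootFn θ ℓ φ ((starRingEnd ℂ) w) = (starRingEnd ℂ) (rootFn θ ℓ φ w) := by
  have hc : ContinuousOn (rootFn θ ℓ φ) (logDomain θ) := fun v hv =>
    (differentiableAt_rootFn H hv).continuousAt.continuousWithinAt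
  have hsq : rootFn θ ℓ φ 0 ^ 2 =
      ((∏ k ∈ Finset.Icc 1 (2 * ℓ), (2 - 2 * Real.cos (ang θ ℓ φ k)) : ℝ) : ℂ) := by
    rw [rootFn_sq, branchProd]; push_cast; simp
  have h0 := conj_eq_of_sq_eq (Finset.prod_nonneg fun k _ => by
    have := Real.cos_le_one (ang θ ℓ φ k); linarith) hsq
  rw [← Complex.conj_conj (rootFn θ ℓ φ ((starRingEnd ℂ) w))]
  congr 1
  refine (isPreconnected_logDomain H.theta_pos).eq_of_sq_eq
    (f := fun w => (starRingEnd ℂ) (rootFn θ ℓ φ ((starRingEnd ℂ) w))) (g := rootFn θ ℓ φ) ?_ hc ?_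
    (fun hx => rootFn_ne_zero H hx) (zero_mem_logDomain H.theta_pos) (by simpa using h0) hw
  · exact Complex.continuous_conj.comp_continuousOn
      (hc.comp Complex.continuous_conj.continuousOn fun v hv => conj_mem_logDomain hv)
  · intro v _
    simp only [Pi.pow_apply, ← map_pow, rootFn_sq, branchProd_conj, Complex.conj_conj]

end DarkGas
end

/-! ### Primitives on star-shaped domains and their limits at boundary points. -/

noncomputable section
namespace DarkGas

/-- A holomorphic function on an open set that is star-shaped about `0` has a primitive. -/
theorem hasDerivAt_radialPrimitive {U : Set ℂ} (hU : IsOpen U)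
    (hstar : ∀ w ∈ U, ∀ s : ℝ, 0 ≤ s → s ≤ 1 → (s : ℂ) * w ∈ U) {K : ℂ → ℂ}
    (hK : DifferentiableOn ℂ K U) {w : ℂ} (hw : w ∈ U) :
    HasDerivAt (fun v => ∫ s in (0 : ℝ)..1, K (s * v) * v) (K w) w := by
  obtain ⟨ε, hε, hball⟩ := Metric.nhds_basis_closedBall.mem_iff.1 (hU.mem_nhds hw)
  have hK' : ContinuousOn (deriv K) U := (hK.deriv hU).continuousOn
  have hcs : IsCompact (Set.Icc (0 : ℝ) 1 ×ˢ Metric.closedBall w ε) :=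
    isCompact_Icc.prod (isCompact_closedBall w ε)
  have hmaps : Set.MapsTo (fun p : ℝ × ℂ => (p.1 : ℂ) * p.2)
      (Set.Icc (0 : ℝ) 1 ×ˢ Metric.closedBall w ε) U :=
    fun p hp => hstar p.2 (hball hp.2) p.1 hp.1.1 hp.1.2
  have hmul : Continuous fun p : ℝ × ℂ => (p.1 : ℂ) * p.2 := by fun_prop
  have hc1 : ContinuousOn (fun p : ℝ × ℂ => K (p.1 * p.2))
      (Set.Icc (0 : ℝ) 1 ×ˢ Metric.closedBall w ε) :=
    hK.continuousOn.comp hmul.continuousOn hmaps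
  have hc2 : ContinuousOn (fun p : ℝ × ℂ => deriv K (p.1 * p.2))
      (Set.Icc (0 : ℝ) 1 ×ˢ Metric.closedBall w ε) :=
    hK'.comp hmul.continuousOn hmaps
  have hc3 : ContinuousOn (fun p : ℝ × ℂ => deriv K (p.1 * p.2) * p.1 * p.2 + K (p.1 * p.2))
      (Set.Icc (0 : ℝ) 1 ×ˢ Metric.closedBall w ε) :=
    ((hc2.mul (Complex.continuous_ofReal.comp continuous_fst).continuousOn).mul
      continuous_snd.continuousOn).add hc1
  obtain ⟨C, hC⟩ := hcs.exists_bound_of_continuousOn hc3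
  have hsec : ∀ v ∈ Metric.closedBall w ε, Set.MapsTo (fun s : ℝ => (s, v)) (Set.uIcc (0 : ℝ) 1)
      (Set.Icc (0 : ℝ) 1 ×ˢ Metric.closedBall w ε) := by
    intro v hv s hs
    rw [Set.uIcc_of_le zero_le_one] at hs
    exact ⟨hs, hv⟩
  have hFc : ∀ v ∈ Metric.closedBall w ε,
      ContinuousOn (fun s : ℝ => K (s * v) * v) (Set.uIcc 0 1) := by
    intro v hv
    exact (hc1.comp (f := fun s : ℝ => (s, v)) (by fun_prop) (hsec v hv)).mul continuousOn_const
  have hF'c : ContinuousOn (fun s : ℝ => deriv K (s * w) * s * w + K (s * w)) (Set.uIcc 0 1) :=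
    hc3.comp (f := fun s : ℝ => (s, w)) (by fun_prop) (hsec w (Metric.mem_closedBall_self hε.le))
  have hder : ∀ v ∈ U, ∀ s : ℝ, 0 ≤ s → s ≤ 1 →
      HasDerivAt K (deriv K (s * v)) (s * v) := fun v hv s h0 h1 =>
    (hK.differentiableAt (hU.mem_nhds (hstar v hv s h0 h1))).hasDerivAt
  have hmeas : ∀ᶠ v in 𝓝 w, MeasureTheory.AEStronglyMeasurable (fun s : ℝ => K (s * v) * v)
      (MeasureTheory.volume.restrict (Set.uIoc 0 1)) := by
    filter_upwards [Metric.closedBall_mem_nhds w hε] with v hv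
    exact ((hFc v hv).mono Set.uIoc_subset_uIcc).aestronglyMeasurable measurableSet_uIoc
  have hmeas' := (hF'c.mono Set.uIoc_subset_uIcc).aestronglyMeasurable
    (μ := MeasureTheory.volume) measurableSet_uIoc
  have hbound : ∀ᵐ s : ℝ, s ∈ Set.uIoc (0 : ℝ) 1 → ∀ v ∈ Metric.closedBall w ε,
      ‖deriv K (s * v) * s * v + K (s * v)‖ ≤ C :=
    MeasureTheory.ae_of_all _ fun s hs v hv => hC (s, v) (hsec v hv (Set.uIoc_subset_uIcc hs))
  have hdiff : ∀ᵐ s : ℝ, s ∈ Set.uIoc (0 : ℝ) 1 → ∀ v ∈ Metric.closedBall w ε,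
      HasDerivAt (fun v => K (s * v) * v) (deriv K (s * v) * s * v + K (s * v)) v := by
    refine MeasureTheory.ae_of_all _ fun s hs v hv => ?_
    have hs' := Set.uIoc_subset_uIcc hs
    rw [Set.uIcc_of_le zero_le_one] at hs'
    have h2 : HasDerivAt (fun v : ℂ => (s : ℂ) * v) (s * 1) v := (hasDerivAt_id v).const_mul _
    have h3 : HasDerivAt (fun v : ℂ => K (s * v)) (deriv K (s * v) * (s * 1)) v :=
      (hder v (hball hv) s hs'.1 hs'.2).comp v h2
    have h4 : HasDerivAt (fun v : ℂ => K (s * v) * v)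
        (deriv K (s * v) * (s * 1) * v + K (s * v) * 1) v := h3.mul (hasDerivAt_id v)
    simpa only [mul_one] using h4
  have main := (intervalIntegral.hasDerivAt_integral_of_dominated_loc_of_deriv_le
    (Metric.closedBall_mem_nhds w hε) hmeas
    (hFc w (Metric.mem_closedBall_self hε.le)).intervalIntegrable hmeas' hbound
    intervalIntegrable_const hdiff).2
  -- The integrand obtained by differentiating in `v` is `d/ds (s K(sw))`, so the integral collapses
  -- to `K(w)`.
  have hFTC : ∀ s ∈ Set.uIcc (0 : ℝ) 1, HasDerivAt (fun s : ℝ => (s : ℂ) * K (s * w))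
      (deriv K (s * w) * s * w + K (s * w)) s := by
    intro s hs
    rw [Set.uIcc_of_le zero_le_one] at hs
    have h1 : HasDerivAt (fun s : ℝ => (s : ℂ)) 1 s := Complex.ofRealCLM.hasDerivAt
    have h2 : HasDerivAt (fun s : ℝ => (s : ℂ) * w) (1 * w) s := h1.mul_const w
    have h3 : HasDerivAt (fun s : ℝ => K (s * w)) (deriv K (s * w) * (1 * w)) s :=
      (hder w hw s hs.1 hs.2).comp s h2
    have h4 := h1.mul h3
    rw [show deriv K (s * w) * s * w + K (s * w) =
      1 * K (s * w) + s * (deriv K (s * w) * (1 * w)) by ring]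
    exact h4
  rw [intervalIntegral.integral_eq_sub_of_hasDerivAt hFTC hF'c.intervalIntegrable] at main
  simpa using main

/-- A function on a convex set with derivative `O(|ζ|^m)` has a limit at the boundary point `0`,
which is attained at the rate `|ζ|^(m+1)`. -/
theorem exists_limit_of_deriv_bound {S : Set ℂ} (hS : Convex ℝ S) (hcl : (0 : ℂ) ∈ closure S)
    (h0 : (0 : ℂ) ∉ S) {f f' : ℂ → ℂ} {δ M : ℝ} {m : ℕ} (hδ : 0 < δ) (hM : 0 ≤ M)
    (hd : ∀ ζ ∈ S, ‖ζ‖ < δ → HasDerivAt f (f' ζ) ζ)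
    (hb : ∀ ζ ∈ S, ‖ζ‖ < δ → ‖f' ζ‖ ≤ M * ‖ζ‖ ^ m) :
    ∃ L : ℂ, ∀ ζ ∈ S, ‖ζ‖ < δ → ‖f ζ - L‖ ≤ M * ‖ζ‖ ^ (m + 1) := by
  have hlip : ∀ ρ < δ, ∀ x ∈ S, ∀ y ∈ S, ‖x‖ ≤ ρ → ‖y‖ ≤ ρ →
      ‖f y - f x‖ ≤ M * ρ ^ m * ‖y - x‖ := by
    intro ρ hρ x hx y hy hxρ hyρ
    refine Convex.norm_image_sub_le_of_norm_hasDerivWithin_le (f' := f')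
      (s := S ∩ Metric.closedBall 0 ρ) (fun ζ hζ => ?_) (fun ζ hζ => ?_)
      (hS.inter (convex_closedBall 0 ρ)) ⟨hx, by simpa using hxρ⟩ ⟨hy, by simpa using hyρ⟩
    · have : ‖ζ‖ ≤ ρ := by simpa using hζ.2
      exact (hd ζ hζ.1 (by linarith)).hasDerivWithinAt
    · have : ‖ζ‖ ≤ ρ := by simpa using hζ.2
      refine (hb ζ hζ.1 (by linarith)).trans ?_
      gcongr
  have hne : (𝓝[S] (0 : ℂ)).NeBot := mem_closure_iff_nhdsWithin_neBot.1 hcl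
  have hsmall : ∀ ρ > 0, ∀ᶠ ζ in 𝓝[S] (0 : ℂ), ζ ∈ S ∧ ‖ζ‖ ≤ ρ := by
    intro ρ hρ
    refine eventually_mem_nhdsWithin.and (mem_nhdsWithin_of_mem_nhds ?_)
    filter_upwards [Metric.closedBall_mem_nhds (0 : ℂ) hρ] with ζ hζ using by simpa using hζ
  have huc : UniformContinuousOn f (S ∩ Metric.closedBall 0 (δ / 2)) := by
    refine LipschitzOnWith.uniformContinuousOn (K := Real.toNNReal (M * (δ / 2) ^ m)) ?_
    refine LipschitzOnWith.of_dist_le_mul fun x hx y hy => ?_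
    rw [Real.coe_toNNReal _ (by positivity), dist_eq_norm, dist_eq_norm]
    exact hlip (δ / 2) (by linarith) y hy.1 x hx.1 (by simpa using hy.2) (by simpa using hx.2)
  have hca : Cauchy (map f (𝓝[S] (0 : ℂ))) := by
    refine Cauchy.map_of_le (cauchy_nhds.mono' hne nhdsWithin_le_nhds) huc ?_
    rw [le_principal_iff]
    filter_upwards [hsmall (δ / 2) (by linarith)] with ζ hζ using ⟨hζ.1, by simpa using hζ.2⟩
  obtain ⟨L, hL⟩ := CompleteSpace.complete hca
  refine ⟨L, fun ζ hζ hζδ => ?_⟩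
  have hζ0 : 0 < ‖ζ‖ := norm_pos_iff.2 fun h => h0 (h ▸ hζ)
  have hT : Tendsto f (𝓝[S] (0 : ℂ)) (𝓝 L) := hL
  have h1 : Tendsto (fun y => ‖f ζ - f y‖) (𝓝[S] (0 : ℂ)) (𝓝 ‖f ζ - L‖) :=
    (tendsto_const_nhds.sub hT).norm
  have h2 : Tendsto (fun y => M * ‖ζ‖ ^ m * ‖ζ - y‖) (𝓝[S] (0 : ℂ))
      (𝓝 (M * ‖ζ‖ ^ m * ‖ζ - 0‖)) := by
    have : Continuous fun y => M * ‖ζ‖ ^ m * ‖ζ - y‖ := by fun_prop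
    exact (this.tendsto 0).mono_left nhdsWithin_le_nhds
  -- Let `y → 0` in the Lipschitz estimate on the ball of radius `‖ζ‖` itself; this choice of radius
  -- yields the rate.
  have h3 := le_of_tendsto_of_tendsto h1 h2 (by
    filter_upwards [hsmall ‖ζ‖ hζ0] with y hy
    exact hlip ‖ζ‖ hζδ y hy.1 ζ hζ hy.2 le_rfl)
  rw [sub_zero] at h3
  rw [pow_succ]
  linarith

/-- The same at an end point of a slit or a boundary point of a half plane, which is opened up by
the square root `ζ` with `w = w₀ + c ζ²`. -/
theorem exists_limit_of_sq_param {S : Set ℂ} (hS : Convex ℝ S) (hcl : (0 : ℂ) ∈ closure S)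
    (h0 : (0 : ℂ) ∉ S) {G K : ℂ → ℂ} {w₀ c : ℂ} (hc : ‖c‖ = 1) {δ M : ℝ} {m : ℕ} (hδ : 0 < δ)
    (hM : 0 ≤ M)
    (hd : ∀ ζ ∈ S, ‖ζ‖ < δ → HasDerivAt G (K (w₀ + c * ζ ^ 2)) (w₀ + c * ζ ^ 2))
    (hb : ∀ ζ ∈ S, ‖ζ‖ < δ → ‖K (w₀ + c * ζ ^ 2)‖ * ‖ζ‖ ≤ M * ‖ζ‖ ^ m) :
    ∃ L : ℂ, ∀ ζ ∈ S, ‖ζ‖ < δ → ‖G (w₀ + c * ζ ^ 2) - L‖ ≤ 2 * M * ‖ζ‖ ^ (m + 1) := by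
  -- The factor `ζ` in `dw = 2cζ dζ` absorbs an inverse square root singularity of `K` at `w₀`.
  refine exists_limit_of_deriv_bound hS hcl h0 (f := fun ζ => G (w₀ + c * ζ ^ 2))
    (f' := fun ζ => K (w₀ + c * ζ ^ 2) * (c * (2 * ζ))) hδ (by positivity) ?_ ?_
  · intro ζ hζ hζδ
    have h1 : HasDerivAt (fun ζ : ℂ => w₀ + c * ζ ^ 2) (c * (2 * ζ)) ζ := by
      simpa using ((hasDerivAt_pow 2 ζ).const_mul c).const_add w₀
    exact (hd ζ hζ hζδ).comp ζ h1
  · intro ζ hζ hζδ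
    have := hb ζ hζ hζδ
    simp only [norm_mul, hc, Complex.norm_ofNat]
    linarith

/-- The square root opens the slit plane to the right half plane, and the right half plane to the
sector `|im| < re`. Both images are convex, as `exists_limit_of_sq_param` requires, whereas the slit
plane is not. -/
theorem exists_sq_eq_of_mem_slitPlane {v : ℂ} (hv : v ∈ Complex.slitPlane) :
    ∃ ζ : ℂ, ζ ^ 2 = v ∧ 0 < ζ.re ∧ (0 < v.re → |ζ.im| < ζ.re) := by
  obtain ⟨ζ, hζ⟩ := IsAlgClosed.exists_pow_nat_eq v (n := 2) two_pos
  have hre : ζ.re ≠ 0 := by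
    intro h
    have h1 := congrArg Complex.re hζ
    have h2 := congrArg Complex.im hζ
    simp [pow_two, h] at h1 h2
    rcases hv with hv | hv
    · nlinarith [mul_self_nonneg ζ.im]
    · exact hv h2.symm
  have key : ∀ ζ : ℂ, ζ ^ 2 = v → 0 < ζ.re → (0 < v.re → |ζ.im| < ζ.re) := by
    intro ζ hζ h hv
    have h1 := congrArg Complex.re hζ
    simp [pow_two] at h1
    exact abs_lt_of_sq_lt_sq (by nlinarith) h.le
  rcases hre.lt_or_gt with h | h
  · exact ⟨-ζ, by simpa using hζ, by simpa using h, key _ (by simpa using hζ) (by simpa using h)⟩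
  · exact ⟨ζ, hζ, h, key ζ hζ h⟩

theorem convex_sector : Convex ℝ {ζ : ℂ | |ζ.im| < ζ.re} := by
  intro x hx y hy a b ha hb hab
  simp only [Set.mem_ofPred_eq, abs_lt, Complex.add_re, Complex.add_im, Complex.real_smul,
    Complex.re_ofReal_mul, Complex.im_ofReal_mul] at *
  rcases ha.eq_or_lt with rfl | ha
  · have : b = 1 := by linarith
    subst this
    constructor <;> linarith
  · constructor <;> nlinarith

theorem convex_re_pos : Convex ℝ {ζ : ℂ | 0 < ζ.re} := convex_halfSpace_re_gt 0

theorem zero_mem_closure_of_ofReal_mem {S : Set ℂ} (h : ∀ x : ℝ, 0 < x → (x : ℂ) ∈ S) :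
    (0 : ℂ) ∈ closure S := by
  rw [Metric.mem_closure_iff]
  intro ε hε
  refine ⟨((ε / 2 : ℝ) : ℂ), h _ (by linarith), ?_⟩
  rw [dist_comm, dist_zero_right, Complex.norm_real, Real.norm_of_nonneg] <;> linarith

end DarkGas
end

/-! ### The differentials and their primitives in the logarithmic coordinate. -/

noncomputable section
namespace DarkGas

variable {θ : ℕ → ℝ} {ℓ : ℕ} {φ : ℝ}

/-- The differential `z^{ℓ-1} f(z + z⁻¹) dz / R(z)` in the logarithmic coordinate `w = log z`. -/
def kernel (θ : ℕ → ℝ) (ℓ : ℕ) (φ : ℝ) (f : Polynomial ℝ) (w : ℂ) : ℂ :=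
  Polynomial.aeval (2 * Complex.cosh w) f / rootFn θ ℓ φ w

/-- The primitive of `kernel` on `logDomain` that vanishes at `0`. -/
def prim (θ : ℕ → ℝ) (ℓ : ℕ) (φ : ℝ) (f : Polynomial ℝ) (w : ℂ) : ℂ :=
  ∫ s in (0 : ℝ)..1, kernel θ ℓ φ f (s * w) * w

theorem differentiableAt_aeval_cosh (f : Polynomial ℝ) (w : ℂ) :
    DifferentiableAt ℂ (fun w => Polynomial.aeval (2 * Complex.cosh w) f) w := by
  have h1 : DifferentiableAt ℂ (fun w => 2 * Complex.cosh w) w := by fun_prop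
  exact (f.differentiable_aeval (𝕜 := ℂ) (2 * Complex.cosh w)).comp w h1

theorem continuous_aeval_cosh (f : Polynomial ℝ) :
    Continuous fun w => Polynomial.aeval (2 * Complex.cosh w) f :=
  continuous_iff_continuousAt.2 fun w => (differentiableAt_aeval_cosh f w).continuousAt

theorem differentiableAt_kernel_of_rootFn {f : Polynomial ℝ} {w : ℂ}
    (h : DifferentiableAt ℂ (rootFn θ ℓ φ) w) (h0 : rootFn θ ℓ φ w ≠ 0) :
    DifferentiableAt ℂ (kernel θ ℓ φ f) w :=
  (differentiableAt_aeval_cosh f w).div h h0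

theorem differentiableAt_kernel (H : Admissible θ ℓ φ) (f : Polynomial ℝ) {w : ℂ}
    (hw : w ∈ logDomain θ) : DifferentiableAt ℂ (kernel θ ℓ φ f) w :=
  differentiableAt_kernel_of_rootFn (differentiableAt_rootFn H hw) (rootFn_ne_zero H hw)

theorem hasDerivAt_prim (H : Admissible θ ℓ φ) (f : Polynomial ℝ) {w : ℂ}
    (hw : w ∈ logDomain θ) : HasDerivAt (prim θ ℓ φ f) (kernel θ ℓ φ f w) w :=
  hasDerivAt_radialPrimitive (isOpen_logDomain θ)
    (fun _ hv _ h0 h1 => smul_mem_logDomain H.theta_pos hv h0 h1)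
    (fun _ hv => (differentiableAt_kernel H f hv).differentiableWithinAt) hw

theorem prim_zero (f : Polynomial ℝ) : prim θ ℓ φ f 0 = 0 := by simp [prim]

theorem kernel_neg (H : Admissible θ ℓ φ) (f : Polynomial ℝ) {w : ℂ} (hw : w ∈ logDomain θ) :
    kernel θ ℓ φ f (-w) = kernel θ ℓ φ f w := by
  rw [kernel, kernel, rootFn_neg H hw, Complex.cosh_neg]

theorem kernel_conj (H : Admissible θ ℓ φ) (f : Polynomial ℝ) {w : ℂ} (hw : w ∈ logDomain θ) :
    kernel θ ℓ φ f ((starRingEnd ℂ) w) = (starRingEnd ℂ) (kernel θ ℓ φ f w) := by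
  have : 2 * Complex.cosh ((starRingEnd ℂ) w) = (starRingEnd ℂ) (2 * Complex.cosh w) := by
    rw [Complex.cosh_conj, map_mul, Complex.conj_ofNat]
  rw [kernel, kernel, rootFn_conj H hw, this, map_div₀]
  congr 1
  exact Polynomial.aeval_algHom_apply Complex.conjAe.toAlgHom _ f

theorem prim_neg (H : Admissible θ ℓ φ) (f : Polynomial ℝ) {w : ℂ} (hw : w ∈ logDomain θ) :
    prim θ ℓ φ f (-w) = -prim θ ℓ φ f w := by
  rw [prim, prim, ← intervalIntegral.integral_neg]
  refine intervalIntegral.integral_congr fun s hs => ?_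
  rw [Set.uIcc_of_le zero_le_one] at hs
  simp only [mul_neg]
  rw [kernel_neg H f (smul_mem_logDomain H.theta_pos hw hs.1 hs.2)]

theorem prim_conj (H : Admissible θ ℓ φ) (f : Polynomial ℝ) {w : ℂ} (hw : w ∈ logDomain θ) :
    prim θ ℓ φ f ((starRingEnd ℂ) w) = (starRingEnd ℂ) (prim θ ℓ φ f w) := by
  rw [prim, prim, intervalIntegral.integral_of_le zero_le_one,
    intervalIntegral.integral_of_le zero_le_one, ← integral_conj,
    ← intervalIntegral.integral_of_le zero_le_one, ← intervalIntegral.integral_of_le zero_le_one]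
  refine intervalIntegral.integral_congr fun s hs => ?_
  rw [Set.uIcc_of_le zero_le_one] at hs
  simp only [map_mul]
  rw [← kernel_conj H f (smul_mem_logDomain H.theta_pos hw hs.1 hs.2)]
  simp

theorem rootFn_add_two_pi (w : ℂ) :
    rootFn θ ℓ φ (w + 2 * Real.pi * Complex.I) = rootFn θ ℓ φ w := by
  rw [rootFn, rootFn, Complex.exp_periodic w]
  congr 1
  rw [Complex.exp_eq_exp_iff_exists_int]
  exact ⟨-ℓ, by push_cast; ring⟩

theorem kernel_add_two_pi (f : Polynomial ℝ) (w : ℂ) :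
    kernel θ ℓ φ f (w + 2 * Real.pi * Complex.I) = kernel θ ℓ φ f w := by
  rw [kernel, kernel, rootFn_add_two_pi, two_mul_cosh, two_mul_cosh, Complex.exp_periodic w]

theorem kernel_sq (f : Polynomial ℝ) (w : ℂ) : kernel θ ℓ φ f w ^ 2 =
    (Polynomial.aeval (2 * Complex.cosh w) f) ^ 2 / branchProd θ ℓ φ w := by
  rw [kernel, div_pow, rootFn_sq]

theorem continuous_branchProd : Continuous (branchProd θ ℓ φ) := by
  unfold branchProd; fun_prop

theorem cosh_mul_I (t : ℝ) : Complex.cosh (t * Complex.I) = (Real.cos t : ℝ) := by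
  rw [Complex.cosh_mul_I, Complex.ofReal_cos]

/-- Branch points are simple zeros: the angles are distinct in `(0, π)`, so only one factor
vanishes, and its derivative `2 sinh (it) = 2i sin t` does not. -/
theorem exists_deriv_branchProd (H : Admissible θ ℓ φ) {t : ℝ}
    (ht : branchProd θ ℓ φ (t * Complex.I) = 0) :
    ∃ d : ℂ, d ≠ 0 ∧ HasDerivAt (branchProd θ ℓ φ) d (t * Complex.I) := by
  obtain ⟨k, hk, hcos⟩ := (branchProd_eq_zero_iff _).1 ht
  have hfac : branchProd θ ℓ φ = fun w => (2 * Complex.cosh w - 2 * Real.cos (ang θ ℓ φ k)) *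
      ∏ j ∈ (Finset.Icc 1 (2 * ℓ)).erase k, (2 * Complex.cosh w - 2 * Real.cos (ang θ ℓ φ j)) := by
    funext w
    exact (Finset.mul_prod_erase _ _ hk).symm
  have hrest : ∏ j ∈ (Finset.Icc 1 (2 * ℓ)).erase k,
      (2 * Complex.cosh (t * Complex.I) - 2 * Real.cos (ang θ ℓ φ j)) ≠ 0 := by
    rw [Finset.prod_ne_zero_iff]
    intro j hj h
    obtain ⟨hjk, hj⟩ := Finset.mem_erase.1 hj
    rw [Finset.mem_Icc] at hj hk
    rw [hcos, sub_eq_zero] at h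
    have h1 : Real.cos (ang θ ℓ φ k) = Real.cos (ang θ ℓ φ j) := by
      have := mul_left_cancel₀ two_ne_zero h
      exact_mod_cast this
    have h2 := Real.injOn_cos ⟨(H.ang_pos hk.1 (by omega)).le, (H.ang_lt_pi hk.1 hk.2).le⟩
      ⟨(H.ang_pos hj.1 (by omega)).le, (H.ang_lt_pi hj.1 hj.2).le⟩ h1
    exact hjk (H.mono.injOn ⟨hj.1, by omega⟩ ⟨hk.1, by omega⟩ h2.symm)
  have hprod : DifferentiableAt ℂ (fun w => ∏ j ∈ (Finset.Icc 1 (2 * ℓ)).erase k,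
      (2 * Complex.cosh w - 2 * Real.cos (ang θ ℓ φ j))) (t * Complex.I) := by
    refine DifferentiableAt.fun_finsetProd fun j _ => by fun_prop
  have h1 : HasDerivAt (fun w => 2 * Complex.cosh w - 2 * Real.cos (ang θ ℓ φ k))
      (2 * Complex.sinh (t * Complex.I)) (t * Complex.I) :=
    ((Complex.hasDerivAt_cosh _).const_mul 2).sub_const _
  have h2 := h1.mul hprod.hasDerivAt
  rw [show 2 * Complex.cosh (t * Complex.I) - 2 * (Real.cos (ang θ ℓ φ k) : ℂ) = 0 by
    rw [hcos, sub_self], zero_mul, add_zero] at h2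
  rw [hfac]
  refine ⟨_, mul_ne_zero (mul_ne_zero two_ne_zero ?_) hrest, h2⟩
  rw [Complex.sinh_mul_I, ← Complex.ofReal_sin]
  refine mul_ne_zero (Complex.ofReal_ne_zero.2 fun hs => ?_) Complex.I_ne_zero
  rw [Finset.mem_Icc] at hk
  rw [cosh_mul_I] at hcos
  have h3 : Real.cos t = Real.cos (ang θ ℓ φ k) := by exact_mod_cast hcos
  have h4 := Real.sin_pos_of_pos_of_lt_pi (H.ang_pos hk.1 (by omega)) (H.ang_lt_pi hk.1 hk.2)
  have h5 := Real.sin_sq_add_cos_sq t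
  rw [hs, h3] at h5
  nlinarith [Real.sin_sq_add_cos_sq (ang θ ℓ φ k)]

/-- A linear lower bound holds at simple zeros, and trivially at all other points of the axis, so
that the kernel estimates need not distinguish the two. -/
theorem branchProd_lower_bound (H : Admissible θ ℓ φ) (t : ℝ) :
    ∃ c : ℝ, 0 < c ∧ ∀ᶠ w in 𝓝 (t * Complex.I : ℂ),
      c * ‖w - t * Complex.I‖ ≤ ‖branchProd θ ℓ φ w‖ := by
  by_cases ht : branchProd θ ℓ φ (t * Complex.I) = 0
  · obtain ⟨d, hd, hder⟩ := exists_deriv_branchProd H ht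
    have hd' : 0 < ‖d‖ := norm_pos_iff.2 hd
    refine ⟨‖d‖ / 2, by linarith, ?_⟩
    have h := (hasDerivAt_iff_isLittleO.1 hder).def (c := ‖d‖ / 2) (by linarith)
    filter_upwards [h] with w hw
    rw [ht, sub_zero, smul_eq_mul] at hw
    have h1 : ‖(w - t * Complex.I) * d‖ ≤ ‖branchProd θ ℓ φ w‖ +
        ‖branchProd θ ℓ φ w - (w - t * Complex.I) * d‖ := by
      have := norm_sub_le (branchProd θ ℓ φ w) (branchProd θ ℓ φ w - (w - t * Complex.I) * d)
      rwa [sub_sub_cancel] at this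
    rw [norm_mul] at h1
    nlinarith
  · have hpos : 0 < ‖branchProd θ ℓ φ (t * Complex.I)‖ := norm_pos_iff.2 ht
    refine ⟨‖branchProd θ ℓ φ (t * Complex.I)‖ / 2, by linarith, ?_⟩
    have h1 : ∀ᶠ w in 𝓝 (t * Complex.I : ℂ), ‖branchProd θ ℓ φ (t * Complex.I)‖ / 2 <
        ‖branchProd θ ℓ φ w‖ :=
      continuous_branchProd.norm.continuousAt.eventually_const_lt (by linarith)
    filter_upwards [h1, Metric.closedBall_mem_nhds (t * Complex.I : ℂ) one_pos] with w hw hw1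
    rw [Metric.mem_closedBall, dist_eq_norm] at hw1
    nlinarith [norm_nonneg (w - t * Complex.I)]

/-- This is `kernel = O(|w - it|^{-1/2})`, written for the square because `kernel²` is a quotient of
entire functions and involves no branch. -/
theorem kernel_bound (H : Admissible θ ℓ φ) (f : Polynomial ℝ) (t : ℝ) :
    ∃ M : ℝ, 0 ≤ M ∧ ∀ᶠ w in 𝓝 (t * Complex.I : ℂ),
      ‖kernel θ ℓ φ f w‖ ^ 2 * ‖w - t * Complex.I‖ ≤ M ^ 2 := by
  obtain ⟨c, hc, hb⟩ := branchProd_lower_bound H t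
  set A := ‖Polynomial.aeval (2 * Complex.cosh (t * Complex.I)) f‖ + 1 with hA
  have hA0 : 0 < A := by positivity
  have h1 : ∀ᶠ w in 𝓝 (t * Complex.I : ℂ), ‖Polynomial.aeval (2 * Complex.cosh w) f‖ < A :=
    (continuous_aeval_cosh f).norm.continuousAt.eventually_lt_const (by linarith)
  refine ⟨Real.sqrt (A ^ 2 / c), Real.sqrt_nonneg _, ?_⟩
  filter_upwards [hb, h1] with w hw hw1
  rw [Real.sq_sqrt (by positivity), ← norm_pow, kernel_sq, norm_div, norm_pow]
  rcases (norm_nonneg (w - t * Complex.I)).eq_or_lt with h0 | h0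
  · rw [← h0, mul_zero]; positivity
  have h2 : 0 < ‖branchProd θ ℓ φ w‖ := lt_of_lt_of_le (by positivity) hw
  rw [div_mul_eq_mul_div, div_le_div_iff₀ h2 hc]
  have h3 : ‖Polynomial.aeval (2 * Complex.cosh w) f‖ ^ 2 ≤ A ^ 2 := by gcongr
  calc _ = ‖Polynomial.aeval (2 * Complex.cosh w) f‖ ^ 2 * (c * ‖w - t * Complex.I‖) := by ring
    _ ≤ A ^ 2 * ‖branchProd θ ℓ φ w‖ := by gcongr

/-- A zero of the numerator gains one full power and turns `O(|w - it|^{-1/2})` into `O(|w -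
it|^{1/2})`. It is what produces the exponent `3/2` at the moving endpoint. -/
theorem kernel_bound_of_root (H : Admissible θ ℓ φ) (f : Polynomial ℝ) {t : ℝ}
    (ht : f.eval (2 * Real.cos t) = 0) :
    ∃ M : ℝ, 0 ≤ M ∧ ∀ᶠ w in 𝓝 (t * Complex.I : ℂ),
      ‖kernel θ ℓ φ f w‖ ^ 2 ≤ M ^ 2 * ‖w - t * Complex.I‖ := by
  obtain ⟨c, hc, hb⟩ := branchProd_lower_bound H t
  have h0 : Polynomial.aeval (2 * Complex.cosh (t * Complex.I)) f = 0 := by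
    rw [cosh_mul_I, show (2 * (Real.cos t : ℝ) : ℂ) = ((2 * Real.cos t : ℝ) : ℂ) by push_cast; ring]
    have := Polynomial.aeval_algebraMap_apply ℂ (2 * Real.cos t) f
    simp only [Complex.coe_algebraMap] at this
    rw [this, Polynomial.coe_aeval_eq_eval, ht, Complex.ofReal_zero]
  obtain ⟨A, hA0, hA⟩ := (differentiableAt_aeval_cosh f (t * Complex.I)).isBigO_sub.exists_pos
  refine ⟨Real.sqrt (A ^ 2 / c), Real.sqrt_nonneg _, ?_⟩
  filter_upwards [hb, hA.bound] with w hw hw1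
  rw [h0, sub_zero] at hw1
  rw [Real.sq_sqrt (by positivity), ← norm_pow, kernel_sq, norm_div, norm_pow]
  rcases (norm_nonneg (w - t * Complex.I)).eq_or_lt with h | h
  · rw [← h, mul_zero] at hw1
    have := le_antisymm hw1 (norm_nonneg _)
    rw [this]; simp; positivity
  have h2 : 0 < ‖branchProd θ ℓ φ w‖ := lt_of_lt_of_le (by positivity) hw
  rw [div_mul_eq_mul_div, div_le_div_iff₀ h2 hc]
  have h3 : ‖Polynomial.aeval (2 * Complex.cosh w) f‖ ^ 2 ≤ (A * ‖w - t * Complex.I‖) ^ 2 := by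
    gcongr
  calc _ ≤ (A * ‖w - t * Complex.I‖) ^ 2 * c := by gcongr
    _ = A ^ 2 * ‖w - t * Complex.I‖ * (c * ‖w - t * Complex.I‖) := by ring
    _ ≤ A ^ 2 * ‖w - t * Complex.I‖ * ‖branchProd θ ℓ φ w‖ := by gcongr

end DarkGas
end

/-! ### Boundary values of the primitive on the imaginary axis. -/

noncomputable section
namespace DarkGas

variable {θ : ℕ → ℝ} {ℓ : ℕ} {φ : ℝ}

/-- Used with `m = 0` in general and `m = 2` at a zero of the numerator. Since `|ζ|² = |w - it|`,
the rate `|ζ|^(m+1)` becomes exponent `1/2`, respectively `3/2`. -/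
theorem exists_prim_limit (H : Admissible θ ℓ φ) (f : Polynomial ℝ) {t : ℝ} {S : Set ℂ}
    (hS : Convex ℝ S) (hcl : (0 : ℂ) ∈ closure S) (h0 : (0 : ℂ) ∉ S) {c : ℂ} (hc : ‖c‖ = 1)
    {δ : ℝ} (hδ : 0 < δ) (hmem : ∀ ζ ∈ S, ‖ζ‖ < δ → t * Complex.I + c * ζ ^ 2 ∈ logDomain θ)
    {M : ℝ} (hM : 0 ≤ M) {m : ℕ} (hb : ∀ᶠ w in 𝓝 (t * Complex.I : ℂ),
      ‖kernel θ ℓ φ f w‖ ^ 2 * ‖w - t * Complex.I‖ ≤ M ^ 2 * ‖w - t * Complex.I‖ ^ m) :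
    ∃ L : ℂ, ∃ ε > 0, ∀ ζ ∈ S, ‖ζ‖ < ε →
      ‖prim θ ℓ φ f (t * Complex.I + c * ζ ^ 2) - L‖ ≤ 2 * M * ‖ζ‖ ^ (m + 1) := by
  have hcont : Tendsto (fun ζ : ℂ => t * Complex.I + c * ζ ^ 2) (𝓝 0) (𝓝 (t * Complex.I)) := by
    have : Continuous fun ζ : ℂ => t * Complex.I + c * ζ ^ 2 := by fun_prop
    simpa using this.tendsto 0
  obtain ⟨ε, hε, hball⟩ := Metric.eventually_nhds_iff.1 (hcont.eventually hb)
  have hbound : ∀ ζ ∈ S, ‖ζ‖ < min δ ε →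
      ‖kernel θ ℓ φ f (t * Complex.I + c * ζ ^ 2)‖ * ‖ζ‖ ≤ M * ‖ζ‖ ^ m := by
    intro ζ hζ h
    have h1 := hball (y := ζ) (by simpa using h.trans_le (min_le_right _ _))
    rw [add_sub_cancel_left, norm_mul, hc, one_mul, norm_pow] at h1
    refine abs_le_of_sq_le_sq' ?_ (by positivity) |>.2
    calc _ = ‖kernel θ ℓ φ f (t * Complex.I + c * ζ ^ 2)‖ ^ 2 * ‖ζ‖ ^ 2 := by ring
      _ ≤ _ := h1
      _ = _ := by ring
  obtain ⟨L, hL⟩ := exists_limit_of_sq_param hS hcl h0 (G := prim θ ℓ φ f) (K := kernel θ ℓ φ f)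
    (w₀ := t * Complex.I) hc (δ := min δ ε) (M := M) (m := m) (lt_min hδ hε) hM
    (fun ζ hζ h => hasDerivAt_prim H f (hmem ζ hζ (h.trans_le (min_le_left _ _)))) hbound
  exact ⟨L, min δ ε, lt_min hδ hε, hL⟩

theorem norm_pow_eq_rpow {ζ v : ℂ} (h : ζ ^ 2 = v) (n : ℕ) :
    ‖ζ‖ ^ n = ‖v‖ ^ ((n : ℝ) / 2) := by
  rw [← h, norm_pow, ← Real.rpow_natCast ‖ζ‖ 2, ← Real.rpow_mul (norm_nonneg _),
    ← Real.rpow_natCast]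
  congr 1
  push_cast; ring

/-- The right half plane; `exp` maps it to the exterior of the unit circle. -/
def rightHalf : Set ℂ := {w | 0 < w.re}

/-- The left half plane; `exp` maps it to the interior of the unit circle. -/
def leftHalf : Set ℂ := {w | w.re < 0}

theorem rightHalf_subset : rightHalf ⊆ logDomain θ := fun _ hw => Or.inl hw.ne'

theorem leftHalf_subset : leftHalf ⊆ logDomain θ := fun _ hw => Or.inl hw.ne

theorem I_mem_closure_rightHalf (t : ℝ) : (t * Complex.I : ℂ) ∈ closure rightHalf := by
  have : closure rightHalf = {w : ℂ | 0 ≤ w.re} := Complex.closure_setOfPred_lt_re 0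
  rw [this]
  simp

instance neBot_rightHalf (t : ℝ) : (𝓝[rightHalf] (t * Complex.I : ℂ)).NeBot :=
  mem_closure_iff_nhdsWithin_neBot.1 (I_mem_closure_rightHalf t)

theorem isBigO_right_of_bound (H : Admissible θ ℓ φ) (f : Polynomial ℝ) {t : ℝ}
    {M : ℝ} (hM : 0 ≤ M) {m : ℕ} (hb : ∀ᶠ w in 𝓝 (t * Complex.I : ℂ),
      ‖kernel θ ℓ φ f w‖ ^ 2 * ‖w - t * Complex.I‖ ≤ M ^ 2 * ‖w - t * Complex.I‖ ^ m) :
    ∃ L : ℂ, (fun w => prim θ ℓ φ f w - L) =O[𝓝[rightHalf] (t * Complex.I : ℂ)]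
      fun w => ‖w - t * Complex.I‖ ^ (((m + 1 : ℕ) : ℝ) / 2) := by
  have hmem : ∀ ζ ∈ {ζ : ℂ | |ζ.im| < ζ.re}, ‖ζ‖ < 1 →
      t * Complex.I + 1 * ζ ^ 2 ∈ logDomain θ := by
    intro ζ hζ _
    apply rightHalf_subset
    have h1 : |ζ.im| < ζ.re := hζ
    have := sq_lt_sq' (by linarith [abs_nonneg ζ.im]) h1
    simp only [rightHalf, Set.mem_ofPred_eq, one_mul]
    simp [pow_two]
    rw [sq_abs] at this
    nlinarith
  obtain ⟨L, ε, hε, hL⟩ := exists_prim_limit H f (S := {ζ : ℂ | |ζ.im| < ζ.re}) (c := 1)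
    convex_sector (zero_mem_closure_of_ofReal_mem fun x hx => by simpa using hx) (by simp)
    (by simp) one_pos hmem hM hb
  refine ⟨L, IsBigO.of_bound (2 * M) ?_⟩
  filter_upwards [self_mem_nhdsWithin,
    mem_nhdsWithin_of_mem_nhds (Metric.ball_mem_nhds _ (pow_pos hε 2))] with w hw hw'
  obtain ⟨ζ, h1, -, h2⟩ := exists_sq_eq_of_mem_slitPlane (v := w - t * Complex.I)
    (Or.inl (by simpa [rightHalf] using hw))
  have h3 : w = t * Complex.I + 1 * ζ ^ 2 := by rw [h1]; ring
  have h4 := hL ζ (h2 (by simpa [rightHalf] using hw)) (by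
    rw [Metric.mem_ball, dist_eq_norm, ← h1, norm_pow] at hw'
    exact lt_of_pow_lt_pow_left₀ 2 hε.le hw')
  rw [← h3, norm_pow_eq_rpow h1] at h4
  rwa [Real.norm_of_nonneg (by positivity)]

theorem tendsto_of_isBigO_rpow {l : Filter ℂ} {f : ℂ → ℂ} {L w₀ : ℂ} {p : ℝ} (hp : 0 < p)
    (hl : l ≤ 𝓝 w₀) (h : (fun w => f w - L) =O[l] fun w => ‖w - w₀‖ ^ p) :
    Tendsto f l (𝓝 L) := by
  rw [← tendsto_sub_nhds_zero_iff]
  refine h.trans_tendsto ?_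
  have h1 : Tendsto (fun w => ‖w - w₀‖) l (𝓝 0) := by
    have : Continuous fun w => ‖w - w₀‖ := by fun_prop
    simpa using (this.tendsto w₀).mono_left hl
  have h2 := h1.rpow_const (p := p) (Or.inr hp.le)
  rwa [Real.zero_rpow hp.ne'] at h2

/-- The boundary value at `it` of `prim` from the right half plane. -/
def bdry (θ : ℕ → ℝ) (ℓ : ℕ) (φ : ℝ) (f : Polynomial ℝ) (t : ℝ) : ℂ :=
  extendFrom rightHalf (prim θ ℓ φ f) (t * Complex.I)

theorem bdry_eq_of_tendsto {f : Polynomial ℝ} {t : ℝ} {L : ℂ}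
    (h : Tendsto (prim θ ℓ φ f) (𝓝[rightHalf] (t * Complex.I : ℂ)) (𝓝 L)) :
    bdry θ ℓ φ f t = L := extendFrom_eq (I_mem_closure_rightHalf t) h

theorem isBigO_prim_right (H : Admissible θ ℓ φ) (f : Polynomial ℝ) (t : ℝ) :
    (fun w => prim θ ℓ φ f w - bdry θ ℓ φ f t) =O[𝓝[rightHalf] (t * Complex.I : ℂ)]
      fun w => ‖w - t * Complex.I‖ ^ (1 / 2 : ℝ) := by
  obtain ⟨M, hM, hb⟩ := kernel_bound H f t
  obtain ⟨L, hL⟩ := isBigO_right_of_bound H f hM (m := 0) (by simpa using hb)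
  have hL' : (fun w => prim θ ℓ φ f w - L) =O[𝓝[rightHalf] (t * Complex.I : ℂ)]
      fun w => ‖w - t * Complex.I‖ ^ (1 / 2 : ℝ) := by simpa using hL
  rwa [bdry_eq_of_tendsto (tendsto_of_isBigO_rpow (by norm_num) nhdsWithin_le_nhds hL')]

theorem isBigO_prim_right_of_root (H : Admissible θ ℓ φ) (f : Polynomial ℝ) {t : ℝ}
    (ht : f.eval (2 * Real.cos t) = 0) :
    (fun w => prim θ ℓ φ f w - bdry θ ℓ φ f t) =O[𝓝[rightHalf] (t * Complex.I : ℂ)]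
      fun w => ‖w - t * Complex.I‖ ^ (3 / 2 : ℝ) := by
  obtain ⟨M, hM, hb⟩ := kernel_bound_of_root H f ht
  obtain ⟨L, hL⟩ := isBigO_right_of_bound H f hM (m := 2) (by
    filter_upwards [hb] with w hw
    nlinarith [mul_le_mul_of_nonneg_right hw (norm_nonneg (w - t * Complex.I))])
  have hL' : (fun w => prim θ ℓ φ f w - L) =O[𝓝[rightHalf] (t * Complex.I : ℂ)]
      fun w => ‖w - t * Complex.I‖ ^ (3 / 2 : ℝ) := by
    convert hL using 4; norm_num
  rwa [bdry_eq_of_tendsto (tendsto_of_isBigO_rpow (by norm_num) nhdsWithin_le_nhds hL')]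

theorem tendsto_prim_right (H : Admissible θ ℓ φ) (f : Polynomial ℝ) (t : ℝ) :
    Tendsto (prim θ ℓ φ f) (𝓝[rightHalf] (t * Complex.I : ℂ)) (𝓝 (bdry θ ℓ φ f t)) :=
  tendsto_of_isBigO_rpow (by norm_num) nhdsWithin_le_nhds (isBigO_prim_right H f t)

/-- Near `iθ₁` the domain is the plane minus a single slit, not two half planes, so one limit serves
both sides of the circle. The square root with `c = -i` opens this slit. -/
theorem isBigO_prim_slit (H : Admissible θ ℓ φ) (f : Polynomial ℝ) :
    (fun w => prim θ ℓ φ f w - bdry θ ℓ φ f (θ 1)) =O[𝓝[logDomain θ] (θ 1 * Complex.I : ℂ)]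
      fun w => ‖w - θ 1 * Complex.I‖ ^ (1 / 2 : ℝ) := by
  obtain ⟨M, hM, hb⟩ := kernel_bound H f (θ 1)
  have hδ : 0 < Real.sqrt (θ 1) := Real.sqrt_pos.2 H.theta_pos
  -- For real `ζ` the point is `i(θ₁ - ζ²)`; the radius keeps it away from the opposite slit, which
  -- starts at `-iθ₁`.
  have hmem : ∀ ζ ∈ {ζ : ℂ | 0 < ζ.re}, ‖ζ‖ < Real.sqrt (θ 1) →
      θ 1 * Complex.I + -Complex.I * ζ ^ 2 ∈ logDomain θ := by
    intro ζ hζ hζ'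
    have h1 : 0 < ζ.re := hζ
    by_cases him : ζ.im = 0
    · right
      have h2 : ζ.re ^ 2 < θ 1 := by
        have h3 : ‖ζ‖ ^ 2 < θ 1 := by
          calc ‖ζ‖ ^ 2 < Real.sqrt (θ 1) ^ 2 := by gcongr
            _ = θ 1 := Real.sq_sqrt H.theta_pos.le
        rw [← Complex.normSq_eq_norm_sq, Complex.normSq_apply, him] at h3
        nlinarith
      simp [pow_two, him]
      rw [abs_lt]
      constructor <;> nlinarith [H.theta_pos]
    · left
      simp [pow_two]
      intro h
      have : ζ.re * ζ.im = 0 := by linarith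
      exact (mul_ne_zero h1.ne' him) this
  obtain ⟨L, ε, hε, hL⟩ := exists_prim_limit H f (t := θ 1) (S := {ζ : ℂ | 0 < ζ.re})
    (c := -Complex.I) convex_re_pos (zero_mem_closure_of_ofReal_mem fun x hx => by simpa using hx)
    (by simp) (by simp) hδ hmem hM (m := 0) (by simpa using hb)
  have hL' : (fun w => prim θ ℓ φ f w - L) =O[𝓝[logDomain θ] (θ 1 * Complex.I : ℂ)]
      fun w => ‖w - θ 1 * Complex.I‖ ^ (1 / 2 : ℝ) := by
    refine IsBigO.of_bound (2 * M) ?_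
    filter_upwards [self_mem_nhdsWithin,
      mem_nhdsWithin_of_mem_nhds (Metric.ball_mem_nhds _ (pow_pos hε 2))] with w hw hw'
    have hslit : Complex.I * (w - θ 1 * Complex.I) ∈ Complex.slitPlane := by
      rw [Complex.mem_slitPlane_iff]
      simp only [Complex.mul_re, Complex.mul_im, Complex.I_re, Complex.I_im, Complex.sub_re,
        Complex.sub_im, Complex.ofReal_re, Complex.ofReal_im]
      rcases hw with hw | hw
      · right; simpa using hw
      · left; have := (abs_lt.1 hw).2; linarith
    obtain ⟨ζ, h1, h2, -⟩ := exists_sq_eq_of_mem_slitPlane hslit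
    have h3 : w = θ 1 * Complex.I + -Complex.I * ζ ^ 2 := by
      rw [h1]
      linear_combination (w - θ 1 * Complex.I) * Complex.I_sq
    have h5 : ‖ζ‖ ^ 2 = ‖w - θ 1 * Complex.I‖ := by
      rw [← norm_pow, h1, norm_mul, Complex.norm_I, one_mul]
    have h4 := hL ζ h2 (by
      rw [Metric.mem_ball, dist_eq_norm, ← h5] at hw'
      exact lt_of_pow_lt_pow_left₀ 2 hε.le hw')
    rw [← h3, norm_pow_eq_rpow h1, norm_mul, Complex.norm_I, one_mul] at h4
    rw [Real.norm_of_nonneg (by positivity)]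
    simpa using h4
  rwa [bdry_eq_of_tendsto ((tendsto_of_isBigO_rpow (by norm_num) nhdsWithin_le_nhds hL').mono_left
    (nhdsWithin_mono _ rightHalf_subset))]

theorem continuous_bdry (H : Admissible θ ℓ φ) (f : Polynomial ℝ) :
    Continuous (bdry θ ℓ φ f) := by
  have h := continuousOn_extendFrom (A := rightHalf) (f := prim θ ℓ φ f)
    (B := Set.range fun t : ℝ => (t * Complex.I : ℂ))
    (by rintro _ ⟨t, rfl⟩; exact I_mem_closure_rightHalf t)
    (by rintro _ ⟨t, rfl⟩; exact ⟨_, tendsto_prim_right H f t⟩)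
  exact h.comp_continuous (f := fun t : ℝ => (t * Complex.I : ℂ)) (by fun_prop) fun t => ⟨t, rfl⟩

theorem tendsto_conj_rightHalf (t : ℝ) : Tendsto (starRingEnd ℂ)
    (𝓝[rightHalf] (t * Complex.I : ℂ)) (𝓝[rightHalf] ((-t : ℝ) * Complex.I : ℂ)) := by
  refine tendsto_nhdsWithin_iff.2 ⟨?_, ?_⟩
  · have := (Complex.continuous_conj.tendsto (t * Complex.I)).mono_left
      (nhdsWithin_le_nhds (s := rightHalf))
    simpa using this
  · filter_upwards [self_mem_nhdsWithin] with w hw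
    simpa [rightHalf] using hw

theorem bdry_neg (H : Admissible θ ℓ φ) (f : Polynomial ℝ) (t : ℝ) :
    bdry θ ℓ φ f (-t) = (starRingEnd ℂ) (bdry θ ℓ φ f t) := by
  apply bdry_eq_of_tendsto
  have h := (Complex.continuous_conj.tendsto _).comp
    ((tendsto_prim_right H f t).comp
      (by simpa only [neg_neg] using tendsto_conj_rightHalf (-t)))
  refine h.congr' ?_
  filter_upwards [self_mem_nhdsWithin] with w hw
  simp only [Function.comp]
  rw [prim_conj H f (rightHalf_subset hw), Complex.conj_conj]

theorem bdry_eq_prim (H : Admissible θ ℓ φ) (f : Polynomial ℝ) {t : ℝ} (ht : |t| < θ 1) :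
    bdry θ ℓ φ f t = prim θ ℓ φ f (t * Complex.I) := by
  apply bdry_eq_of_tendsto
  have : (t * Complex.I : ℂ) ∈ logDomain θ := by right; simpa using ht
  exact (hasDerivAt_prim H f this).continuousAt.tendsto.mono_left nhdsWithin_le_nhds

theorem tendsto_neg_leftHalf (t : ℝ) : Tendsto (fun w : ℂ => -w)
    (𝓝[leftHalf] (t * Complex.I : ℂ)) (𝓝[rightHalf] ((-t : ℝ) * Complex.I : ℂ)) := by
  refine tendsto_nhdsWithin_iff.2 ⟨?_, ?_⟩
  · have := (continuous_neg.tendsto (t * Complex.I : ℂ)).mono_left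
      (nhdsWithin_le_nhds (s := leftHalf))
    simpa using this
  · filter_upwards [self_mem_nhdsWithin] with w hw
    simpa [rightHalf, leftHalf] using hw

/-- Oddness carries the right-hand limit at `-it` to the left-hand limit at `it`, whose value is
`-b(-t) = -conj b(t)`. All jump relations rest on this. -/
theorem isBigO_left_of_right (H : Admissible θ ℓ φ) (f : Polynomial ℝ) {t p : ℝ}
    (h : (fun w => prim θ ℓ φ f w - bdry θ ℓ φ f (-t)) =O[𝓝[rightHalf] ((-t : ℝ) * Complex.I : ℂ)]
      fun w => ‖w - (-t : ℝ) * Complex.I‖ ^ p) :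
    (fun w => prim θ ℓ φ f w - -(starRingEnd ℂ) (bdry θ ℓ φ f t))
      =O[𝓝[leftHalf] (t * Complex.I : ℂ)] fun w => ‖w - t * Complex.I‖ ^ p := by
  have h1 := (h.comp_tendsto (tendsto_neg_leftHalf t)).neg_left
  refine h1.congr' ?_ ?_
  · filter_upwards [self_mem_nhdsWithin] with w hw
    simp only [Function.comp]
    rw [prim_neg H f (leftHalf_subset hw), bdry_neg H]
    ring
  · filter_upwards with w
    simp only [Function.comp]
    rw [← norm_neg]
    congr 2
    push_cast; ring

end DarkGas
end

/-! ### Bands and gaps: behaviour of the boundary values along the axis. -/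

noncomputable section
namespace DarkGas

variable {θ : ℕ → ℝ} {ℓ : ℕ} {φ : ℝ}

/-- `∏ (2 cos u - 2 cos τ_k)`, the value of `branchProd` at `iu`. -/
def realProd (θ : ℕ → ℝ) (ℓ : ℕ) (φ : ℝ) (u : ℝ) : ℝ :=
  ∏ k ∈ Finset.Icc 1 (2 * ℓ), (2 * Real.cos u - 2 * Real.cos (ang θ ℓ φ k))

theorem branchProd_mul_I (u : ℝ) :
    branchProd θ ℓ φ (u * Complex.I) = (realProd θ ℓ φ u : ℂ) := by
  rw [branchProd, realProd]
  push_cast [cosh_mul_I]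
  rfl

theorem aeval_cosh_mul_I (f : Polynomial ℝ) (u : ℝ) :
    Polynomial.aeval (2 * Complex.cosh (u * Complex.I)) f = ((f.eval (2 * Real.cos u) : ℝ) : ℂ) := by
  rw [cosh_mul_I, show (2 * (Real.cos u : ℝ) : ℂ) = ((2 * Real.cos u : ℝ) : ℂ) by push_cast; ring]
  have := Polynomial.aeval_algebraMap_apply ℂ (2 * Real.cos u) f
  simp only [Complex.coe_algebraMap] at this
  rw [this, Polynomial.coe_aeval_eq_eval]

/-- The arguments in `(-θ₁, π]` that do not lie in a closed band. -/
def gapSet (θ : ℕ → ℝ) (ℓ : ℕ) (φ : ℝ) : Set ℝ :=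
  {u | -θ 1 < u ∧ u ≤ Real.pi ∧
    ∀ j ∈ Finset.Icc 1 ℓ, u < ang θ ℓ φ (2 * j - 1) ∨ ang θ ℓ φ (2 * j) < u}

/-- The arguments in the open bands. -/
def bandSet (θ : ℕ → ℝ) (ℓ : ℕ) (φ : ℝ) : Set ℝ :=
  {u | ∃ j ∈ Finset.Icc 1 ℓ, u ∈ Set.Ioo (ang θ ℓ φ (2 * j - 1)) (ang θ ℓ φ (2 * j))}

theorem pair_pos_of_lt {a b u : ℝ} (hab : a < b) (hb : b < Real.pi) (hu : |u| < a) :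
    0 < (2 * Real.cos u - 2 * Real.cos a) * (2 * Real.cos u - 2 * Real.cos b) := by
  rw [← Real.cos_abs u]
  have h1 := Real.cos_lt_cos_of_nonneg_of_le_pi (abs_nonneg u) (by linarith) hu
  have h2 := Real.cos_lt_cos_of_nonneg_of_le_pi (abs_nonneg u) hb.le (hu.trans hab)
  exact mul_pos (by linarith) (by linarith)

theorem pair_pos_of_gt {a b u : ℝ} (ha : 0 < a) (hab : a < b) (hu : b < u) (hpi : u ≤ Real.pi) :
    0 < (2 * Real.cos u - 2 * Real.cos a) * (2 * Real.cos u - 2 * Real.cos b) := by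
  have h1 := Real.cos_lt_cos_of_nonneg_of_le_pi ha.le hpi (hab.trans hu)
  have h2 := Real.cos_lt_cos_of_nonneg_of_le_pi (by linarith) hpi hu
  exact mul_pos_of_neg_of_neg (by linarith) (by linarith)

theorem realProd_eq (u : ℝ) : realProd θ ℓ φ u = ∏ j ∈ Finset.Icc 1 ℓ,
    ((2 * Real.cos u - 2 * Real.cos (ang θ ℓ φ (2 * j - 1))) *
      (2 * Real.cos u - 2 * Real.cos (ang θ ℓ φ (2 * j)))) :=
  (prod_pairs (fun k => 2 * Real.cos u - 2 * Real.cos (ang θ ℓ φ k)) ℓ).symm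

/-- The two factors belonging to one band have equal signs outside that closed band and opposite
signs inside it. Hence all pairs are positive on a gap, and exactly one is negative on a band. -/
theorem realProd_pos (H : Admissible θ ℓ φ) {u : ℝ} (hu : u ∈ gapSet θ ℓ φ) :
    0 < realProd θ ℓ φ u := by
  obtain ⟨h0, hpi, hu⟩ := hu
  rw [realProd_eq]
  refine Finset.prod_pos fun j hj => ?_
  have h := hu j hj
  rw [Finset.mem_Icc] at hj
  have h1 := H.lt (i := 2 * j - 1) (j := 2 * j) (by omega) (by omega) (by omega)
  have h2 := H.theta_le (k := 2 * j - 1) (by omega) (by omega)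
  have h3 := H.ang_lt_pi (k := 2 * j) (by omega) (by omega)
  have h4 := H.ang_pos (k := 2 * j - 1) (by omega) (by omega)
  rcases h with h | h
  · exact pair_pos_of_lt h1 h3 (abs_lt.2 ⟨by linarith, h⟩)
  · exact pair_pos_of_gt h4 h1 h hpi

theorem realProd_neg_of_mem (H : Admissible θ ℓ φ) {u : ℝ} (hu : u ∈ bandSet θ ℓ φ) :
    realProd θ ℓ φ u < 0 := by
  obtain ⟨j, hj, hu1, hu2⟩ := hu
  rw [realProd_eq, ← Finset.mul_prod_erase _ _ hj]
  rw [Finset.mem_Icc] at hj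
  have h4 := H.ang_pos (k := 2 * j - 1) (by omega) (by omega)
  have h3 := H.ang_lt_pi (k := 2 * j) (by omega) (by omega)
  refine mul_neg_of_neg_of_pos ?_ (Finset.prod_pos fun i hi => ?_)
  · have h1 := Real.cos_lt_cos_of_nonneg_of_le_pi h4.le (by linarith) hu1
    have h2 := Real.cos_lt_cos_of_nonneg_of_le_pi (by linarith) h3.le hu2
    exact mul_neg_of_neg_of_pos (by linarith) (by linarith)
  · obtain ⟨hij, hi⟩ := Finset.mem_erase.1 hi
    rw [Finset.mem_Icc] at hi
    have h1 := H.lt (i := 2 * i - 1) (j := 2 * i) (by omega) (by omega) (by omega)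
    have h5 := H.ang_pos (k := 2 * i - 1) (by omega) (by omega)
    have h6 := H.ang_lt_pi (k := 2 * i) (by omega) (by omega)
    rcases lt_or_gt_of_ne hij with h | h
    · have := H.lt (i := 2 * i) (j := 2 * j - 1) (by omega) (by omega) (by omega)
      exact pair_pos_of_gt h5 h1 (by linarith) (by linarith)
    · have := H.lt (i := 2 * j) (j := 2 * i - 1) (by omega) (by omega) (by omega)
      exact pair_pos_of_lt h1 h6 (by rw [abs_of_pos (by linarith)]; linarith)

theorem continuousAt_kernel_mul_I (H : Admissible θ ℓ φ) (f : Polynomial ℝ) {u : ℝ}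
    (hu : u ∈ gapSet θ ℓ φ) : ContinuousAt (kernel θ ℓ φ f) (u * Complex.I) := by
  refine (differentiableAt_kernel_of_rootFn (differentiableAt_rootFn_of_R ?_) ?_).continuousAt
  · rw [exp_I_mul]
    exact differentiableAt_R_cis H hu.1 hu.2.1 hu.2.2
  · intro h
    have := rootFn_sq θ ℓ φ (u * Complex.I)
    rw [h, branchProd_mul_I] at this
    have h2 := realProd_pos H hu
    have h3 : realProd θ ℓ φ u = 0 := by
      apply Complex.ofReal_injective
      rw [← this]; simp
    exact h2.ne' h3

theorem kernel_sq_mul_I (f : Polynomial ℝ) (u : ℝ) : kernel θ ℓ φ f (u * Complex.I) ^ 2 =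
    ((f.eval (2 * Real.cos u) ^ 2 / realProd θ ℓ φ u : ℝ) : ℂ) := by
  rw [kernel_sq, branchProd_mul_I, aeval_cosh_mul_I]
  push_cast; rfl

theorem kernel_im_eq_zero (H : Admissible θ ℓ φ) (f : Polynomial ℝ) {u : ℝ}
    (hu : u ∈ gapSet θ ℓ φ) : (kernel θ ℓ φ f (u * Complex.I)).im = 0 :=
  Complex.conj_eq_iff_im.1 (conj_eq_of_sq_eq
    (div_nonneg (sq_nonneg _) (realProd_pos H hu).le) (kernel_sq_mul_I f u))

theorem tendsto_add_mul_I (u : ℝ) : Tendsto (fun ε : ℝ => (ε + u * Complex.I : ℂ)) (𝓝[>] 0)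
    (𝓝[rightHalf] (u * Complex.I : ℂ)) := by
  refine tendsto_nhdsWithin_iff.2 ⟨?_, ?_⟩
  · have : Continuous fun ε : ℝ => (ε + u * Complex.I : ℂ) := by fun_prop
    simpa using (this.tendsto 0).mono_left nhdsWithin_le_nhds
  · filter_upwards [self_mem_nhdsWithin] with ε hε
    simpa [rightHalf] using hε

theorem hasDerivAt_add_mul_I (ε u : ℝ) :
    HasDerivAt (fun u : ℝ => (ε + u * Complex.I : ℂ)) Complex.I u := by
  have h1 : HasDerivAt (fun u : ℝ => (u : ℂ)) 1 u := Complex.ofRealCLM.hasDerivAt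
  simpa using (h1.mul_const Complex.I).const_add (ε : ℂ)

theorem prim_sub_eq_integral (H : Admissible θ ℓ φ) (f : Polynomial ℝ) {ε : ℝ} (hε : ε ≠ 0)
    (s t : ℝ) : IntervalIntegrable (fun u : ℝ => kernel θ ℓ φ f (ε + u * Complex.I) * Complex.I)
      MeasureTheory.volume s t ∧
    ∫ u in s..t, kernel θ ℓ φ f (ε + u * Complex.I) * Complex.I =
      prim θ ℓ φ f (ε + t * Complex.I) - prim θ ℓ φ f (ε + s * Complex.I) := by
  have hmem : ∀ u : ℝ, (ε + u * Complex.I : ℂ) ∈ logDomain θ := fun u => Or.inl (by simpa using hε)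
  have hc : Continuous fun u : ℝ => kernel θ ℓ φ f (ε + u * Complex.I) * Complex.I := by
    refine Continuous.mul (continuous_iff_continuousAt.2 fun u => ?_) continuous_const
    exact ContinuousAt.comp (g := kernel θ ℓ φ f)
      (differentiableAt_kernel H f (hmem u)).continuousAt
      (hasDerivAt_add_mul_I ε u).continuousAt
  refine ⟨hc.intervalIntegrable s t, ?_⟩
  exact intervalIntegral.integral_eq_sub_of_hasDerivAt (fun u _ =>
    (hasDerivAt_prim H f (hmem u)).comp u (hasDerivAt_add_mul_I ε u)) (hc.intervalIntegrable s t)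

/-- The square of the kernel extends continuously to the axis away from branch points; its bound on
a compact strip is the dominating constant in `bdry_sub_eq_integral`. -/
theorem exists_kernel_bound (H : Admissible θ ℓ φ) (f : Polynomial ℝ) {s t : ℝ}
    (hne : ∀ u ∈ Set.Icc s t, realProd θ ℓ φ u ≠ 0) :
    ∃ C : ℝ, ∀ ε ∈ Set.Ioc (0 : ℝ) 1, ∀ u ∈ Set.Icc s t,
      ‖kernel θ ℓ φ f (ε + u * Complex.I)‖ ≤ C := by
  have hcont : ContinuousOn (fun p : ℝ × ℝ =>
      (Polynomial.aeval (2 * Complex.cosh (p.1 + p.2 * Complex.I)) f) ^ 2 /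
        branchProd θ ℓ φ (p.1 + p.2 * Complex.I)) (Set.Icc 0 1 ×ˢ Set.Icc s t) := by
    have hp : Continuous fun p : ℝ × ℝ => (p.1 + p.2 * Complex.I : ℂ) := by fun_prop
    refine ContinuousOn.div (((continuous_aeval_cosh f).comp hp).pow 2).continuousOn
      (continuous_branchProd.comp hp).continuousOn ?_
    rintro ⟨ε, u⟩ ⟨hε, hu⟩
    rcases hε.1.eq_or_lt with h | h
    · simp only at h
      simp only [← h, Complex.ofReal_zero, zero_add, branchProd_mul_I]
      exact Complex.ofReal_ne_zero.2 (hne u hu)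
    · exact branchProd_ne_zero H (Or.inl (by simpa using h.ne'))
  obtain ⟨C, hC⟩ := (isCompact_Icc.prod isCompact_Icc).exists_bound_of_continuousOn hcont
  refine ⟨Real.sqrt C, fun ε hε u hu => Real.le_sqrt_of_sq_le ?_⟩
  rw [← norm_pow, kernel_sq]
  exact hC (ε, u) ⟨⟨hε.1.le, hε.2⟩, hu⟩

/-- Differences of boundary values as integrals of the boundary values of the kernel, for a real
linear functional `T`. -/
theorem bdry_sub_eq_integral (H : Admissible θ ℓ φ) (f : Polynomial ℝ) {s t : ℝ} (hst : s ≤ t)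
    (hne : ∀ u ∈ Set.Icc s t, realProd θ ℓ φ u ≠ 0) (T : ℂ →L[ℝ] ℝ) {k : ℝ → ℝ}
    (hk : ∀ u ∈ Set.Icc s t, Tendsto (fun w => T (kernel θ ℓ φ f w * Complex.I))
      (𝓝[rightHalf] (u * Complex.I : ℂ)) (𝓝 (k u))) :
    T (bdry θ ℓ φ f t) - T (bdry θ ℓ φ f s) = ∫ u in s..t, k u := by
  obtain ⟨C, hC⟩ := exists_kernel_bound H f hne
  have hε : ∀ᶠ ε : ℝ in 𝓝[>] 0, ε ∈ Set.Ioc (0 : ℝ) 1 := Ioc_mem_nhdsGT one_pos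
  have h1 : Tendsto (fun ε : ℝ => ∫ u in s..t, T (kernel θ ℓ φ f (ε + u * Complex.I) * Complex.I))
      (𝓝[>] 0) (𝓝 (∫ u in s..t, k u)) := by
    refine intervalIntegral.tendsto_integral_filter_of_dominated_convergence
      (fun _ => ‖T‖ * C) ?_ ?_ intervalIntegrable_const ?_
    · filter_upwards [hε] with ε hε
      have h := (prim_sub_eq_integral H f hε.1.ne' s t).1.def'.aestronglyMeasurable
      exact T.continuous.comp_aestronglyMeasurable h
    · filter_upwards [hε] with ε hε
      refine MeasureTheory.ae_of_all _ fun u hu => ?_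
      rw [Set.uIoc_of_le hst] at hu
      refine (T.le_opNorm _).trans ?_
      rw [norm_mul, Complex.norm_I, mul_one]
      gcongr
      exact hC ε hε u ⟨hu.1.le, hu.2⟩
    · refine MeasureTheory.ae_of_all _ fun u hu => ?_
      rw [Set.uIoc_of_le hst] at hu
      exact (hk u ⟨hu.1.le, hu.2⟩).comp (tendsto_add_mul_I u)
  have h2 : Tendsto (fun ε : ℝ => T (prim θ ℓ φ f (ε + t * Complex.I)) -
      T (prim θ ℓ φ f (ε + s * Complex.I))) (𝓝[>] 0)
      (𝓝 (T (bdry θ ℓ φ f t) - T (bdry θ ℓ φ f s))) :=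
    ((T.continuous.tendsto _).comp ((tendsto_prim_right H f t).comp (tendsto_add_mul_I t))).sub
      ((T.continuous.tendsto _).comp ((tendsto_prim_right H f s).comp (tendsto_add_mul_I s)))
  refine tendsto_nhds_unique h2 (h1.congr' ?_)
  filter_upwards [hε] with ε hε
  obtain ⟨h3, h4⟩ := prim_sub_eq_integral H f hε.1.ne' s t
  rw [T.intervalIntegral_comp_comm h3, h4, map_sub]

/-- On a band only `kernel²` has an evident limit, a nonpositive real number. The identity `(re z)²
= (|z²| + re z²) / 2` then sends the real part to `0` without any choice of branch; this is why
boundary differences are computed through a real functional. -/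
theorem tendsto_kernel_re_of_neg (f : Polynomial ℝ) {u : ℝ} (hu : realProd θ ℓ φ u < 0) :
    Tendsto (fun w => (kernel θ ℓ φ f w).re) (𝓝 (u * Complex.I : ℂ)) (𝓝 0) := by
  have hsq : Tendsto (fun w => kernel θ ℓ φ f w ^ 2) (𝓝 (u * Complex.I : ℂ))
      (𝓝 (kernel θ ℓ φ f (u * Complex.I) ^ 2)) := by
    simp_rw [kernel_sq]
    refine (((continuous_aeval_cosh f).pow 2).continuousAt.div continuous_branchProd.continuousAt
      ?_).tendsto
    rw [branchProd_mul_I]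
    exact Complex.ofReal_ne_zero.2 hu.ne
  set q := f.eval (2 * Real.cos u) ^ 2 / realProd θ ℓ φ u with hq
  have hq0 : q ≤ 0 := div_nonpos_of_nonneg_of_nonpos (sq_nonneg _) hu.le
  rw [kernel_sq_mul_I, ← hq] at hsq
  have h1 : Tendsto (fun w => (‖kernel θ ℓ φ f w ^ 2‖ + (kernel θ ℓ φ f w ^ 2).re) / 2)
      (𝓝 (u * Complex.I : ℂ)) (𝓝 0) := by
    have := (hsq.norm.add ((Complex.continuous_re.tendsto _).comp hsq)).div_const 2
    rw [Complex.norm_real, Complex.ofReal_re, Real.norm_of_nonpos hq0] at this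
    simpa using this
  have h2 : ∀ z : ℂ, (‖z ^ 2‖ + (z ^ 2).re) / 2 = z.re ^ 2 := by
    intro z
    rw [norm_pow, ← Complex.normSq_eq_norm_sq, Complex.normSq_apply, pow_two z, Complex.mul_re]
    ring
  simp_rw [h2] at h1
  have h3 := h1.sqrt
  simp_rw [Real.sqrt_sq_eq_abs, Real.sqrt_zero] at h3
  exact (tendsto_zero_iff_abs_tendsto_zero _).2 h3

/-- The integral formula needs closed intervals free of branch points; continuity of the boundary
values extends its consequence to the branch points at the ends. -/
theorem eqOn_Icc_of_forall_Ioo {c : ℝ → ℝ} (hc : Continuous c) {s t : ℝ} (hst : s < t)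
    (h : ∀ a ∈ Set.Ioo s t, ∀ b ∈ Set.Ioo s t, a ≤ b → c b - c a = 0) :
    ∀ a ∈ Set.Icc s t, ∀ b ∈ Set.Icc s t, c a = c b := by
  have hm : (s + t) / 2 ∈ Set.Ioo s t := ⟨by linarith, by linarith⟩
  have h1 : Set.EqOn c (fun _ => c ((s + t) / 2)) (Set.Ioo s t) := by
    intro a ha
    rcases le_total a ((s + t) / 2) with h' | h'
    · have := h a ha _ hm h'; simp only; linarith
    · have := h _ hm a ha h'; simp only; linarith
  have h2 := h1.closure hc continuous_const
  rw [closure_Ioo hst.ne] at h2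
  intro a ha b hb
  rw [h2 ha, h2 hb]

/-- Along the axis `d prim = kernel · i du`. The kernel tends to imaginary values on a band, so only
`Re b` moves there; in `bdry_re_eq_of_gap` it is real and only `Im b` moves. -/
theorem bdry_im_eq_of_band (H : Admissible θ ℓ φ) (f : Polynomial ℝ) {s t : ℝ} (hst : s < t)
    (hsub : Set.Ioo s t ⊆ bandSet θ ℓ φ) {a b : ℝ} (ha : a ∈ Set.Icc s t) (hb : b ∈ Set.Icc s t) :
    (bdry θ ℓ φ f a).im = (bdry θ ℓ φ f b).im := by
  refine eqOn_Icc_of_forall_Ioo (c := fun u => (bdry θ ℓ φ f u).im)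
    (Complex.continuous_im.comp (continuous_bdry H f)) hst (fun x hx y hy hxy => ?_) a ha b hb
  have hband : ∀ u ∈ Set.Icc x y, realProd θ ℓ φ u < 0 := fun u hu =>
    realProd_neg_of_mem H (hsub ⟨hx.1.trans_le hu.1, hu.2.trans_lt hy.2⟩)
  have := bdry_sub_eq_integral H f hxy (fun u hu => (hband u hu).ne) Complex.imCLM (k := fun _ => 0)
    (fun u hu => by
      simpa using (tendsto_kernel_re_of_neg f (hband u hu)).mono_left nhdsWithin_le_nhds)
  simpa using this

theorem bdry_re_eq_of_gap (H : Admissible θ ℓ φ) (f : Polynomial ℝ) {s t : ℝ} (hst : s < t)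
    (hsub : Set.Ioo s t ⊆ gapSet θ ℓ φ) {a b : ℝ} (ha : a ∈ Set.Icc s t) (hb : b ∈ Set.Icc s t) :
    (bdry θ ℓ φ f a).re = (bdry θ ℓ φ f b).re := by
  refine eqOn_Icc_of_forall_Ioo (c := fun u => (bdry θ ℓ φ f u).re)
    (Complex.continuous_re.comp (continuous_bdry H f)) hst (fun x hx y hy hxy => ?_) a ha b hb
  have hgap : ∀ u ∈ Set.Icc x y, u ∈ gapSet θ ℓ φ := fun u hu =>
    hsub ⟨hx.1.trans_le hu.1, hu.2.trans_lt hy.2⟩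
  have := bdry_sub_eq_integral H f hxy (fun u hu => (realProd_pos H (hgap u hu)).ne')
    Complex.reCLM (k := fun _ => 0) (fun u hu => by
      have h1 := ((Complex.continuous_im.tendsto _).comp
        (continuousAt_kernel_mul_I H f (hgap u hu)).tendsto).mono_left
        (nhdsWithin_le_nhds (s := rightHalf))
      rw [kernel_im_eq_zero H f (hgap u hu)] at h1
      simpa using h1.neg)
  simpa using this

theorem continuousOn_kernel_re (H : Admissible θ ℓ φ) (f : Polynomial ℝ) :
    ContinuousOn (fun u : ℝ => (kernel θ ℓ φ f (u * Complex.I)).re) (gapSet θ ℓ φ) := by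
  intro u hu
  refine ContinuousAt.continuousWithinAt ?_
  have h1 : ContinuousAt (fun u : ℝ => (u * Complex.I : ℂ)) u := by fun_prop
  exact Complex.continuous_re.continuousAt.comp
    (ContinuousAt.comp (g := kernel θ ℓ φ f) (continuousAt_kernel_mul_I H f hu) h1)

theorem bdry_im_sub_of_Icc_gap (H : Admissible θ ℓ φ) (f : Polynomial ℝ) {s t : ℝ} (hst : s ≤ t)
    (hsub : Set.Icc s t ⊆ gapSet θ ℓ φ) :
    (bdry θ ℓ φ f t).im - (bdry θ ℓ φ f s).im =
      ∫ u in s..t, (kernel θ ℓ φ f (u * Complex.I)).re := by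
  refine bdry_sub_eq_integral H f hst (fun u hu => (realProd_pos H (hsub hu)).ne')
    Complex.imCLM (fun u hu => ?_)
  have h1 := ((Complex.continuous_re.tendsto _).comp
    (continuousAt_kernel_mul_I H f (hsub hu)).tendsto).mono_left
    (nhdsWithin_le_nhds (s := rightHalf))
  simpa [Function.comp_def] using h1

theorem hasDerivAt_bdry_im (H : Admissible θ ℓ φ) (f : Polynomial ℝ) {s t : ℝ}
    (hsub : Set.Ioo s t ⊆ gapSet θ ℓ φ) {u : ℝ} (hu : u ∈ Set.Ioo s t) :
    HasDerivAt (fun u => (bdry θ ℓ φ f u).im) (kernel θ ℓ φ f (u * Complex.I)).re u := by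
  obtain ⟨x, hx1, hx2⟩ := exists_between hu.1
  obtain ⟨y, hy1, hy2⟩ := exists_between hu.2
  have hxy : ∀ v ∈ Set.Ioo x y, Set.Icc x v ⊆ gapSet θ ℓ φ := fun v hv w hw =>
    hsub ⟨hx1.trans_le hw.1, (hw.2.trans_lt hv.2).trans hy2⟩
  have hcont := continuousOn_kernel_re H f
  have hopen : ContinuousOn (fun u : ℝ => (kernel θ ℓ φ f (u * Complex.I)).re) (Set.Ioo x y) :=
    hcont.mono fun v hv => hxy v hv ⟨hv.1.le, le_rfl⟩
  have h1 : HasDerivAt (fun v => ∫ r in x..v, (kernel θ ℓ φ f (r * Complex.I)).re)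
      (kernel θ ℓ φ f (u * Complex.I)).re u := by
    refine intervalIntegral.integral_hasDerivAt_right ?_ ?_ ?_
    · refine ContinuousOn.intervalIntegrable (hcont.mono ?_)
      rw [Set.uIcc_of_le hx2.le]
      exact hxy u ⟨hx2, hy1⟩
    · exact hopen.stronglyMeasurableAtFilter isOpen_Ioo u ⟨hx2, hy1⟩
    · exact hopen.continuousAt (Ioo_mem_nhds hx2 hy1)
  refine (h1.const_add (bdry θ ℓ φ f x).im).congr_of_eventuallyEq ?_
  filter_upwards [Ioo_mem_nhds hx2 hy1] with v hv
  have := bdry_im_sub_of_Icc_gap H f hv.1.le (hxy v hv)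
  linarith

theorem kernel_re_ne_zero (H : Admissible θ ℓ φ) {f : Polynomial ℝ} {u : ℝ}
    (hu : u ∈ gapSet θ ℓ φ) (hf : f.eval (2 * Real.cos u) ≠ 0) :
    (kernel θ ℓ φ f (u * Complex.I)).re ≠ 0 := by
  intro h
  have h0 : kernel θ ℓ φ f (u * Complex.I) = 0 := Complex.ext h (kernel_im_eq_zero H f hu)
  have h1 := kernel_sq_mul_I (θ := θ) (ℓ := ℓ) (φ := φ) f u
  rw [h0] at h1
  have h2 : f.eval (2 * Real.cos u) ^ 2 / realProd θ ℓ φ u = 0 := by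
    have : ((f.eval (2 * Real.cos u) ^ 2 / realProd θ ℓ φ u : ℝ) : ℂ) = 0 := by
      rw [← h1]; simp
    exact_mod_cast this
  exact (div_ne_zero (pow_ne_zero 2 hf) (realProd_pos H hu).ne') h2

theorem kernel_re_sign (H : Admissible θ ℓ φ) {f : Polynomial ℝ} {s t : ℝ}
    (hsub : Set.Ioo s t ⊆ gapSet θ ℓ φ) (hf : ∀ u ∈ Set.Ioo s t, f.eval (2 * Real.cos u) ≠ 0) :
    (∀ u ∈ Set.Ioo s t, 0 < (kernel θ ℓ φ f (u * Complex.I)).re) ∨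
      ∀ u ∈ Set.Ioo s t, (kernel θ ℓ φ f (u * Complex.I)).re < 0 := by
  by_contra hcon
  push Not at hcon
  obtain ⟨⟨a, ha, ha'⟩, b, hb, hb'⟩ := hcon
  have hc : ContinuousOn (fun u : ℝ => (kernel θ ℓ φ f (u * Complex.I)).re) (Set.Ioo s t) :=
    (continuousOn_kernel_re H f).mono hsub
  obtain ⟨c, hc1, hc2⟩ := isPreconnected_Ioo.intermediate_value ha hb hc ⟨ha', hb'⟩
  exact kernel_re_ne_zero H (hsub hc1) (hf c hc1) hc2

/-- For `f = 1` the kernel keeps one sign on a gap and is the derivative of `Im b`, which is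
continuous up to the ends. A one-signed derivative of a continuous function is integrable, so the
end singularities need no estimate; general `f` only multiplies by a continuous factor. -/
theorem intervalIntegrable_kernel_one (H : Admissible θ ℓ φ) {s t : ℝ} (hst : s < t)
    (hsub : Set.Ioo s t ⊆ gapSet θ ℓ φ) :
    IntervalIntegrable (fun u : ℝ => (kernel θ ℓ φ 1 (u * Complex.I)).re)
      MeasureTheory.volume s t := by
  have hcont : Continuous fun u => (bdry θ ℓ φ 1 u).im :=
    Complex.continuous_im.comp (continuous_bdry H 1)
  rcases kernel_re_sign H (f := 1) hsub (by simp) with h | h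
  · refine intervalIntegral.intervalIntegrable_deriv_of_nonneg hcont.continuousOn ?_ ?_
    · rw [min_eq_left hst.le, max_eq_right hst.le]
      exact fun u hu => hasDerivAt_bdry_im H 1 hsub hu
    · rw [min_eq_left hst.le, max_eq_right hst.le]
      exact fun u hu => (h u hu).le
  · rw [← neg_neg (fun u : ℝ => (kernel θ ℓ φ 1 (u * Complex.I)).re)]
    refine IntervalIntegrable.neg ?_
    refine intervalIntegral.intervalIntegrable_deriv_of_nonneg hcont.neg.continuousOn ?_ ?_
    · rw [min_eq_left hst.le, max_eq_right hst.le]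
      exact fun u hu => (hasDerivAt_bdry_im H 1 hsub hu).neg
    · rw [min_eq_left hst.le, max_eq_right hst.le]
      exact fun u hu => neg_nonneg.2 (h u hu).le

theorem kernel_re_eq_mul (f : Polynomial ℝ) (u : ℝ) : (kernel θ ℓ φ f (u * Complex.I)).re =
    f.eval (2 * Real.cos u) * (kernel θ ℓ φ 1 (u * Complex.I)).re := by
  rw [kernel, kernel, aeval_cosh_mul_I, map_one, one_div, div_eq_mul_inv, Complex.re_ofReal_mul]

theorem intervalIntegrable_kernel (H : Admissible θ ℓ φ) (f : Polynomial ℝ) {s t : ℝ} (hst : s < t)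
    (hsub : Set.Ioo s t ⊆ gapSet θ ℓ φ) :
    IntervalIntegrable (fun u : ℝ => (kernel θ ℓ φ f (u * Complex.I)).re)
      MeasureTheory.volume s t := by
  simp_rw [kernel_re_eq_mul f]
  refine (intervalIntegrable_kernel_one H hst hsub).continuousOn_mul ?_
  have : Continuous fun u => f.eval (2 * Real.cos u) :=
    f.continuous.comp (continuous_const.mul Real.continuous_cos)
  exact this.continuousOn

theorem integral_kernel_eq (H : Admissible θ ℓ φ) (f : Polynomial ℝ) {s t : ℝ} (hst : s < t)
    (hsub : Set.Ioo s t ⊆ gapSet θ ℓ φ) :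
    ∫ u in s..t, (kernel θ ℓ φ f (u * Complex.I)).re =
      (bdry θ ℓ φ f t).im - (bdry θ ℓ φ f s).im :=
  intervalIntegral.integral_eq_sub_of_hasDerivAt_of_le hst.le
    (Complex.continuous_im.comp (continuous_bdry H f)).continuousOn
    (fun _ hu => hasDerivAt_bdry_im H f hsub hu) (intervalIntegrable_kernel H f hst hsub)

/-- Without a root of `f` the integrand would keep one strict sign, because the kernel is real on a
gap and vanishes only where `f` does. Every root count below starts here. -/
theorem exists_root_of_integral_eq_zero (H : Admissible θ ℓ φ) {f : Polynomial ℝ} {s t : ℝ}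
    (hst : s < t) (hsub : Set.Ioo s t ⊆ gapSet θ ℓ φ)
    (h0 : ∫ u in s..t, (kernel θ ℓ φ f (u * Complex.I)).re = 0) :
    ∃ u ∈ Set.Ioo s t, f.eval (2 * Real.cos u) = 0 := by
  by_contra hcon
  push Not at hcon
  have hfk := intervalIntegrable_kernel H f hst hsub
  rcases kernel_re_sign H hsub hcon with h | h
  · exact (intervalIntegral.intervalIntegral_pos_of_pos_on hfk h hst).ne' h0
  · have := intervalIntegral.intervalIntegral_pos_of_pos_on hfk.neg
      (fun u hu => neg_pos.2 (h u hu)) hst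
    simp only [Pi.neg_apply, intervalIntegral.integral_neg] at this
    linarith

theorem Ioo_gap_subset (H : Admissible θ ℓ φ) {j : ℕ} (hj : 1 ≤ j) (hj' : j ≤ ℓ) :
    Set.Ioo (ang θ ℓ φ (2 * j)) (ang θ ℓ φ (2 * j + 1)) ⊆ gapSet θ ℓ φ := by
  intro u hu
  have h1 := H.ang_pos (k := 2 * j) (by omega) (by omega)
  have h2 := H.le (i := 2 * j + 1) (j := 2 * ℓ + 1) (by omega) (by omega) le_rfl
  rw [ang_last] at h2
  refine ⟨by linarith [hu.1, H.theta_pos], hu.2.le.trans h2, fun i hi => ?_⟩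
  rw [Finset.mem_Icc] at hi
  rcases le_or_gt i j with h | h
  · right
    exact (H.le (i := 2 * i) (j := 2 * j) (by omega) (by omega) (by omega)).trans_lt hu.1
  · left
    exact hu.2.trans_le (H.le (i := 2 * j + 1) (j := 2 * i - 1) (by omega) (by omega) (by omega))

theorem Ioo_central_subset (H : Admissible θ ℓ φ) : Set.Ioo (-θ 1) (θ 1) ⊆ gapSet θ ℓ φ := by
  intro u hu
  refine ⟨hu.1, (hu.2.trans H.theta_lt_pi).le, fun i hi => Or.inl ?_⟩
  rw [Finset.mem_Icc] at hi
  exact hu.2.trans_le (H.theta_le (by omega) (by omega))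

theorem Ioo_band_subset {j : ℕ} (hj : 1 ≤ j) (hj' : j ≤ ℓ) :
    Set.Ioo (ang θ ℓ φ (2 * j - 1)) (ang θ ℓ φ (2 * j)) ⊆ bandSet θ ℓ φ :=
  fun _ hu => ⟨j, Finset.mem_Icc.2 ⟨hj, hj'⟩, hu⟩

end DarkGas
end

/-! ### Absence of residues, periodicity, and normalised differentials. -/

noncomputable section
namespace DarkGas

variable {θ : ℕ → ℝ} {ℓ : ℕ} {φ : ℝ}

/-- The coefficient of `dz / z` in the differential `z^{ℓ-1} f(z + z⁻¹) dz / R(z)`. -/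
def logCoeff (θ : ℕ → ℝ) (ℓ : ℕ) (φ : ℝ) (f : Polynomial ℝ) (z : ℂ) : ℂ :=
  z ^ ℓ * Polynomial.aeval (z + z⁻¹) f / R θ ℓ φ z

theorem kernel_eq_logCoeff (f : Polynomial ℝ) (w : ℂ) :
    kernel θ ℓ φ f w = logCoeff θ ℓ φ f (Complex.exp w) := by
  rw [kernel, logCoeff, rootFn, two_mul_cosh, Complex.exp_neg, ← Complex.exp_nat_mul]
  have := Complex.exp_ne_zero (ℓ * w)
  field_simp

/-- The differential has principal part `(a z⁻¹ + b z⁻²) dz / z` at `0`; in particular it has no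
residue. -/
def HasPrincipalPart (θ : ℕ → ℝ) (ℓ : ℕ) (φ : ℝ) (f : Polynomial ℝ) (a b : ℂ) : Prop :=
  Tendsto (fun z => logCoeff θ ℓ φ f z - (a * z⁻¹ + b * (z ^ 2)⁻¹)) (𝓝[≠] 0) (𝓝 0)

theorem HasPrincipalPart.comb {f g : Polynomial ℝ} {a b a' b' : ℂ}
    (hf : HasPrincipalPart θ ℓ φ f a b) (hg : HasPrincipalPart θ ℓ φ g a' b') (c : ℝ) :
    HasPrincipalPart θ ℓ φ (Polynomial.C c * f - g) (c * a - a') (c * b - b') := by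
  have h := (hf.const_mul (c : ℂ)).sub hg
  rw [mul_zero, sub_zero] at h
  refine h.congr fun z => ?_
  simp only [logCoeff, map_sub, map_mul, Polynomial.aeval_C, Complex.coe_algebraMap]
  ring

theorem kernel_comb (f g : Polynomial ℝ) (c : ℝ) (w : ℂ) :
    kernel θ ℓ φ (Polynomial.C c * f - g) w = c * kernel θ ℓ φ f w - kernel θ ℓ φ g w := by
  simp only [kernel, map_sub, map_mul, Polynomial.aeval_C, Complex.coe_algebraMap]
  ring

theorem intervalIntegrable_radial (H : Admissible θ ℓ φ) (f : Polynomial ℝ) {w : ℂ}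
    (hw : w ∈ logDomain θ) : IntervalIntegrable (fun s : ℝ => kernel θ ℓ φ f (s * w) * w)
      MeasureTheory.volume 0 1 := by
  refine ContinuousOn.intervalIntegrable fun s hs => ContinuousAt.continuousWithinAt ?_
  rw [Set.uIcc_of_le zero_le_one] at hs
  refine ContinuousAt.mul ?_ continuousAt_const
  refine ContinuousAt.comp (g := kernel θ ℓ φ f) (f := fun s : ℝ => (s * w : ℂ))
    (differentiableAt_kernel H f (smul_mem_logDomain H.theta_pos hw hs.1 hs.2)).continuousAt
    (by fun_prop)

theorem prim_comb (H : Admissible θ ℓ φ) (f g : Polynomial ℝ) (c : ℝ) {w : ℂ}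
    (hw : w ∈ logDomain θ) : prim θ ℓ φ (Polynomial.C c * f - g) w =
      c * prim θ ℓ φ f w - prim θ ℓ φ g w := by
  rw [prim, prim, prim, ← intervalIntegral.integral_const_mul, ← intervalIntegral.integral_sub
    ((intervalIntegrable_radial H f hw).const_mul _) (intervalIntegrable_radial H g hw)]
  refine intervalIntegral.integral_congr fun s _ => ?_
  simp only [kernel_comb]
  ring

theorem integral_exp_period (n : ℕ) (hn : n ≠ 0) (x : ℝ) :
    ∫ u in (0 : ℝ)..2 * Real.pi, Complex.exp (-(n * (x + u * Complex.I))) = 0 := by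
  have h : ∀ u ∈ Set.uIcc (0 : ℝ) (2 * Real.pi),
      HasDerivAt (fun u : ℝ => Complex.exp (-(n * (x + u * Complex.I))) / (-(n * Complex.I)))
        (Complex.exp (-(n * (x + u * Complex.I)))) u := by
    intro u _
    have h1 := ((hasDerivAt_add_mul_I x u).const_mul (n : ℂ)).neg.cexp.div_const (-(n * Complex.I))
    have hn' : (-(n * Complex.I) : ℂ) ≠ 0 := by simp [hn]
    rwa [mul_div_assoc, div_self hn', mul_one] at h1
  rw [intervalIntegral.integral_eq_sub_of_hasDerivAt h (by
    apply Continuous.intervalIntegrable; fun_prop), sub_eq_zero]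
  congr 1
  rw [Complex.exp_eq_exp_iff_exists_int]
  exact ⟨-n, by push_cast; ring⟩

/-- The kernel is periodic, so the increment over a period is constant on the half plane. It is
computed far to the left, where `exp` maps the period segment to a small circle about `0`: the
principal part integrates to zero and the remainder tends to zero. -/
theorem prim_add_two_pi_left (H : Admissible θ ℓ φ) {f : Polynomial ℝ} {a b : ℂ}
    (hf : HasPrincipalPart θ ℓ φ f a b) {w : ℂ} (hw : w ∈ leftHalf) :
    prim θ ℓ φ f (w + 2 * Real.pi * Complex.I) = prim θ ℓ φ f w := by
  have hshift : ∀ v ∈ leftHalf, v + 2 * Real.pi * Complex.I ∈ leftHalf := by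
    intro v hv
    simpa [leftHalf] using hv
  have hconst : ∀ v ∈ leftHalf, prim θ ℓ φ f (v + 2 * Real.pi * Complex.I) - prim θ ℓ φ f v =
      prim θ ℓ φ f (w + 2 * Real.pi * Complex.I) - prim θ ℓ φ f w := by
    intro v hv
    have hd : ∀ v ∈ leftHalf, HasDerivWithinAt (fun v => prim θ ℓ φ f (v + 2 * Real.pi * Complex.I) -
        prim θ ℓ φ f v) 0 leftHalf v := by
      intro v hv
      have h1 := (hasDerivAt_prim H f (leftHalf_subset (hshift v hv))).comp_add_const v
        (2 * Real.pi * Complex.I)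
      have h2 := h1.sub (hasDerivAt_prim H f (leftHalf_subset hv))
      rw [kernel_add_two_pi, sub_self] at h2
      exact h2.hasDerivWithinAt
    have h3 := Convex.norm_image_sub_le_of_norm_hasDerivWithin_le (C := 0) hd (by simp)
      (convex_halfSpace_re_lt 0) hw hv
    rw [zero_mul, norm_le_zero_iff, sub_eq_zero] at h3
    exact h3
  rw [← sub_eq_zero, ← norm_le_zero_iff]
  refine le_of_forall_pos_le_add fun η hη => ?_
  rw [zero_add]
  obtain ⟨δ, hδ, hball⟩ := Metric.eventually_nhds_iff.1
    (eventually_nhdsWithin_iff.1 ((Metric.tendsto_nhds.1 hf) (η / (2 * Real.pi)) (by positivity)))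
  obtain ⟨x, hx0, hx⟩ : ∃ x : ℝ, x < 0 ∧ Real.exp x < δ := by
    have h1 := (tendsto_order.1 Real.tendsto_exp_atBot).2 δ hδ
    obtain ⟨x, h2, h3⟩ := (h1.and (eventually_lt_atBot 0)).exists
    exact ⟨x, h3, h2⟩
  rw [← hconst x (by simpa [leftHalf] using hx0)]
  obtain ⟨hi, he⟩ := prim_sub_eq_integral H f hx0.ne 0 (2 * Real.pi)
  have e1 : (x + ((2 * Real.pi : ℝ) : ℂ) * Complex.I) = x + 2 * Real.pi * Complex.I := by
    push_cast; ring
  rw [e1, Complex.ofReal_zero, zero_mul, add_zero] at he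
  rw [← he]
  -- The principal part contributes nothing, so subtracting its integral leaves only the `o(1)`
  -- remainder to be bounded.
  have hz : ∫ u in (0 : ℝ)..2 * Real.pi,
      (a * Complex.exp (-((1 : ℕ) * (x + u * Complex.I))) +
        b * Complex.exp (-((2 : ℕ) * (x + u * Complex.I)))) * Complex.I = 0 := by
    rw [intervalIntegral.integral_mul_const, intervalIntegral.integral_add,
      intervalIntegral.integral_const_mul, intervalIntegral.integral_const_mul,
      integral_exp_period 1 one_ne_zero, integral_exp_period 2 two_ne_zero]
    · simp
    · apply Continuous.intervalIntegrable; fun_prop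
    · apply Continuous.intervalIntegrable; fun_prop
  rw [← sub_zero (∫ u in (0 : ℝ)..2 * Real.pi, kernel θ ℓ φ f (x + u * Complex.I) * Complex.I),
    ← hz, ← intervalIntegral.integral_sub hi (by
      apply Continuous.intervalIntegrable; fun_prop)]
  have hbd := intervalIntegral.norm_integral_le_of_norm_le_const (a := 0) (b := 2 * Real.pi)
    (C := η / (2 * Real.pi)) (f := fun u : ℝ => kernel θ ℓ φ f (x + u * Complex.I) * Complex.I -
      (a * Complex.exp (-((1 : ℕ) * (x + u * Complex.I))) +
        b * Complex.exp (-((2 : ℕ) * (x + u * Complex.I)))) * Complex.I) (by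
    intro u _
    rw [← sub_mul, norm_mul, Complex.norm_I, mul_one, kernel_eq_logCoeff]
    have h1 := hball (y := Complex.exp (x + u * Complex.I)) (by
      rw [dist_zero_right, Complex.norm_exp]; simpa using hx) (Complex.exp_ne_zero _)
    rw [dist_zero_right] at h1
    refine le_of_eq_of_le ?_ h1.le
    rw [Complex.exp_neg, Complex.exp_neg, Complex.exp_nat_mul, Complex.exp_nat_mul, pow_one])
  refine hbd.trans_eq ?_
  rw [sub_zero, abs_of_pos (by positivity)]
  field_simp

theorem prim_add_two_pi (H : Admissible θ ℓ φ) {f : Polynomial ℝ} {a b : ℂ}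
    (hf : HasPrincipalPart θ ℓ φ f a b) {w : ℂ} (hw : w.re ≠ 0) :
    prim θ ℓ φ f (w + 2 * Real.pi * Complex.I) = prim θ ℓ φ f w := by
  rcases hw.lt_or_gt with h | h
  · exact prim_add_two_pi_left H hf h
  · have h1 : w + 2 * Real.pi * Complex.I ∈ logDomain θ := Or.inl (by simpa using hw)
    have h2 : -(w + 2 * Real.pi * Complex.I) ∈ leftHalf := by simpa [leftHalf] using h
    have h3 := prim_add_two_pi_left H hf h2
    rw [prim_neg H f h1, neg_add, neg_add_cancel_right, prim_neg H f (Or.inl hw)] at h3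
    exact (neg_injective h3).symm

theorem prim_add_int_mul_two_pi (H : Admissible θ ℓ φ) {f : Polynomial ℝ} {a b : ℂ}
    (hf : HasPrincipalPart θ ℓ φ f a b) {w : ℂ} (hw : w.re ≠ 0) (n : ℤ) :
    prim θ ℓ φ f (w + n * (2 * Real.pi * Complex.I)) = prim θ ℓ φ f w := by
  have hre : ∀ n : ℤ, (w + n * (2 * Real.pi * Complex.I)).re ≠ 0 := fun n => by simpa using hw
  induction n using Int.induction_on with
  | zero => simp
  | succ n ih =>
    rw [← ih, ← prim_add_two_pi H hf (hre n)]
    congr 1; push_cast; ring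
  | pred n ih =>
    rw [← ih, ← prim_add_two_pi H hf (hre (-n - 1))]
    congr 1; push_cast; ring

theorem prim_eq_of_exp_eq (H : Admissible θ ℓ φ) {f : Polynomial ℝ} {a b : ℂ}
    (hf : HasPrincipalPart θ ℓ φ f a b) {v w : ℂ} (hw : w.re ≠ 0)
    (h : Complex.exp v = Complex.exp w) : prim θ ℓ φ f v = prim θ ℓ φ f w := by
  obtain ⟨n, rfl⟩ := Complex.exp_eq_exp_iff_exists_int.1 h
  exact prim_add_int_mul_two_pi H hf hw n

/-- Periodicity gives `b(-π) = b(π)`, and conjugation gives `b(-π) = conj b(π)`. -/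
theorem bdry_pi_im (H : Admissible θ ℓ φ) {f : Polynomial ℝ} {a b : ℂ}
    (hf : HasPrincipalPart θ ℓ φ f a b) : (bdry θ ℓ φ f Real.pi).im = 0 := by
  have h : bdry θ ℓ φ f (-Real.pi) = bdry θ ℓ φ f Real.pi := by
    apply bdry_eq_of_tendsto
    have h1 : Tendsto (fun w : ℂ => w + 2 * Real.pi * Complex.I)
        (𝓝[rightHalf] ((-Real.pi : ℝ) * Complex.I : ℂ)) (𝓝[rightHalf] (Real.pi * Complex.I : ℂ)) := by
      refine tendsto_nhdsWithin_iff.2 ⟨?_, ?_⟩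
      · have : Continuous fun w : ℂ => w + 2 * Real.pi * Complex.I := by fun_prop
        have h2 := (this.tendsto ((-Real.pi : ℝ) * Complex.I : ℂ)).mono_left
          (nhdsWithin_le_nhds (s := rightHalf))
        convert h2 using 2
        push_cast; ring
      · filter_upwards [self_mem_nhdsWithin] with w hw
        simpa [rightHalf] using hw
    refine ((tendsto_prim_right H f Real.pi).comp h1).congr' ?_
    filter_upwards [self_mem_nhdsWithin] with w hw
    exact prim_add_two_pi H hf (ne_of_gt hw)
  rw [bdry_neg H] at h
  exact Complex.conj_eq_iff_im.1 h

/-- The polynomial `f` defines a normalised differential: no residue at `0`, and vanishing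
integrals over the gaps. -/
structure Normalized (θ : ℕ → ℝ) (ℓ : ℕ) (φ : ℝ) (f : Polynomial ℝ) (a b : ℂ) : Prop where
  principal : HasPrincipalPart θ ℓ φ f a b
  gaps : ∀ j ∈ Finset.Icc 1 ℓ, ∫ u in ang θ ℓ φ (2 * j)..ang θ ℓ φ (2 * j + 1),
    (kernel θ ℓ φ f (u * Complex.I)).re = 0

theorem Normalized.comb (H : Admissible θ ℓ φ) {f g : Polynomial ℝ} {a b a' b' : ℂ}
    (hf : Normalized θ ℓ φ f a b) (hg : Normalized θ ℓ φ g a' b') (c : ℝ) :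
    Normalized θ ℓ φ (Polynomial.C c * f - g) (c * a - a') (c * b - b') where
  principal := hf.principal.comb hg.principal c
  gaps j hj := by
    have h1 := hf.gaps j hj
    have h2 := hg.gaps j hj
    rw [Finset.mem_Icc] at hj
    have hst := H.lt (i := 2 * j) (j := 2 * j + 1) (by omega) (by omega) (by omega)
    have hsub := Ioo_gap_subset H hj.1 hj.2
    simp only [kernel_comb, Complex.sub_re, Complex.re_ofReal_mul]
    rw [intervalIntegral.integral_sub ((intervalIntegrable_kernel H f hst hsub).const_mul _)
      (intervalIntegrable_kernel H g hst hsub), intervalIntegral.integral_const_mul, h1, h2]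
    simp

/-- Descent from `π`, one interval at a time: `Im b` does not change across a band because it is
constant there, nor across a gap because the gap integral is its increment. -/
theorem bdry_ang_im (H : Admissible θ ℓ φ) {f : Polynomial ℝ} {a b : ℂ}
    (hf : Normalized θ ℓ φ f a b) {k : ℕ} (hk : 1 ≤ k) (hk' : k ≤ 2 * ℓ + 1) :
    (bdry θ ℓ φ f (ang θ ℓ φ k)).im = 0 := by
  have step : ∀ k, 1 ≤ k → k ≤ 2 * ℓ →
      (bdry θ ℓ φ f (ang θ ℓ φ k)).im = (bdry θ ℓ φ f (ang θ ℓ φ (k + 1))).im := by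
    intro k hk hk'
    have hlt := H.lt (i := k) (j := k + 1) hk (by omega) (by omega)
    rcases Nat.even_or_odd' k with ⟨j, rfl | rfl⟩
    · have h1 := hf.gaps j (Finset.mem_Icc.2 ⟨by omega, by omega⟩)
      rw [integral_kernel_eq H f hlt (Ioo_gap_subset H (by omega) (by omega))] at h1
      linarith
    · have hsub : Set.Ioo (ang θ ℓ φ (2 * j + 1)) (ang θ ℓ φ (2 * j + 1 + 1)) ⊆ bandSet θ ℓ φ :=
        Ioo_band_subset (j := j + 1) (by omega) (by omega)
      exact bdry_im_eq_of_band H f hlt hsub ⟨le_rfl, hlt.le⟩ ⟨hlt.le, le_rfl⟩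
  obtain ⟨n, hn⟩ := Nat.exists_eq_add_of_le hk'
  induction n generalizing k with
  | zero =>
    rw [show k = 2 * ℓ + 1 by omega, ang_last]
    exact bdry_pi_im H hf.principal
  | succ n ih =>
    rw [step k hk (by omega)]
    exact ih (by omega) (by omega) (by omega)

theorem bdry_central_re (H : Admissible θ ℓ φ) (f : Polynomial ℝ) {t : ℝ}
    (ht : t ∈ Set.Icc (-θ 1) (θ 1)) : (bdry θ ℓ φ f t).re = 0 := by
  have h0 := H.theta_pos
  rw [bdry_re_eq_of_gap H f (by linarith) (Ioo_central_subset H) ht ⟨by linarith, h0.le⟩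
    (b := 0), bdry_eq_prim H f (by simpa using h0)]
  simp [prim_zero]

/-- This permits passing from the base point `z = 1`, about which the domain is star-shaped and the
symmetries are visible, to the base point `η₁` of the Abelian integrals. -/
theorem bdry_theta_one (H : Admissible θ ℓ φ) {f : Polynomial ℝ} {a b : ℂ}
    (hf : Normalized θ ℓ φ f a b) : bdry θ ℓ φ f (θ 1) = 0 := by
  refine Complex.ext (bdry_central_re H f ⟨by linarith [H.theta_pos], le_rfl⟩) ?_
  have := bdry_ang_im H hf (k := 1) le_rfl (by omega)
  rwa [H.ang_one] at this

/-- A condition that is not imposed but follows. It supplies one more root of `f`, between `0` and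
`θ₁`, and it can replace the condition on the last gap, whose end moves with `φ`. -/
theorem integral_central_eq_zero (H : Admissible θ ℓ φ) {f : Polynomial ℝ} {a b : ℂ}
    (hf : Normalized θ ℓ φ f a b) :
    ∫ u in (0 : ℝ)..θ 1, (kernel θ ℓ φ f (u * Complex.I)).re = 0 := by
  have h0 := H.theta_pos
  rw [integral_kernel_eq H f h0
    (fun u hu => Ioo_central_subset H ⟨by linarith [hu.1], hu.2⟩), bdry_theta_one H hf,
    bdry_eq_prim H f (by simpa using h0)]
  simp [prim_zero]

end DarkGas
end

/-! ### Palindromic numerators as polynomials in `z + z⁻¹`, and the linear system. -/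

noncomputable section
namespace DarkGas

variable {θ : ℕ → ℝ} {ℓ : ℕ} {φ : ℝ}

/-- The polynomials `b_0 = 1` and `b_m(z + z⁻¹) = z^m + z^{-m}` for `m ≥ 1`. -/
def symBasis : ℕ → Polynomial ℝ
  | 0 => 1
  | m + 1 => Polynomial.Chebyshev.C ℝ ((m + 1 : ℕ) : ℤ)

theorem chebyshevC_succ_succ (m : ℕ) : Polynomial.Chebyshev.C ℝ ((m + 2 : ℕ) : ℤ) =
    Polynomial.X * Polynomial.Chebyshev.C ℝ ((m + 1 : ℕ) : ℤ) -
      Polynomial.Chebyshev.C ℝ ((m : ℕ) : ℤ) := by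
  have := Polynomial.Chebyshev.C_add_two ℝ (m : ℤ)
  push_cast
  exact this

theorem monic_chebyshevC (m : ℕ) :
    (Polynomial.Chebyshev.C ℝ ((m + 1 : ℕ) : ℤ)).Monic ∧
      (Polynomial.Chebyshev.C ℝ ((m + 1 : ℕ) : ℤ)).degree = (m + 1 : ℕ) := by
  induction m using Nat.strong_induction_on with
  | _ m ih =>
    match m with
    | 0 => simp [Polynomial.monic_X]
    | m + 1 =>
      obtain ⟨h1, h2⟩ := ih m (by omega)
      have hlow : (Polynomial.Chebyshev.C ℝ ((m : ℕ) : ℤ)).degree < ((m + 2 : ℕ) : WithBot ℕ) := by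
        match m with
        | 0 =>
          rw [Nat.cast_zero, Polynomial.Chebyshev.C_zero]
          refine lt_of_le_of_lt (Polynomial.degree_C_le (a := (2 : ℝ))) ?_
          norm_num
        | k + 1 =>
          rw [(ih k (by omega)).2]
          exact_mod_cast (by omega : k + 1 < k + 1 + 2)
      have hX : (Polynomial.X * Polynomial.Chebyshev.C ℝ ((m + 1 : ℕ) : ℤ)).degree =
          ((m + 2 : ℕ) : WithBot ℕ) := by
        rw [Polynomial.degree_mul, h2, Polynomial.degree_X]
        push_cast; ring
      rw [chebyshevC_succ_succ]
      constructor
      · exact (Polynomial.monic_X.mul h1).sub_of_left (by rw [hX]; exact hlow)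
      · rw [Polynomial.degree_sub_eq_left_of_degree_lt (by rw [hX]; exact hlow), hX]

theorem monic_symBasis (m : ℕ) : (symBasis m).Monic := by
  cases m with
  | zero => exact Polynomial.monic_one
  | succ m => exact (monic_chebyshevC m).1

theorem degree_symBasis (m : ℕ) : (symBasis m).degree = m := by
  cases m with
  | zero => exact Polynomial.degree_one
  | succ m => exact (monic_chebyshevC m).2

theorem aeval_chebyshevC {z : ℂ} (hz : z ≠ 0) (m : ℕ) :
    Polynomial.aeval (z + z⁻¹) (Polynomial.Chebyshev.C ℝ (m : ℤ)) = z ^ m + (z⁻¹) ^ m := by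
  induction m using Nat.strong_induction_on with
  | _ m ih =>
    match m with
    | 0 =>
      rw [Nat.cast_zero, Polynomial.Chebyshev.C_zero, map_ofNat]
      norm_num
    | 1 => simp
    | m + 2 =>
      rw [chebyshevC_succ_succ, map_sub, map_mul, Polynomial.aeval_X, ih (m + 1) (by omega),
        ih m (by omega)]
      have : z * z⁻¹ = 1 := mul_inv_cancel₀ hz
      generalize z⁻¹ = y at *
      linear_combination (z ^ m + y ^ m) * this

theorem aeval_symBasis {z : ℂ} (hz : z ≠ 0) {m : ℕ} (hm : m ≠ 0) :
    Polynomial.aeval (z + z⁻¹) (symBasis m) = z ^ m + (z⁻¹) ^ m := by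
  obtain ⟨m, rfl⟩ := Nat.exists_eq_succ_of_ne_zero hm
  exact aeval_chebyshevC hz (m + 1)

theorem degree_X_mul_symBasis_sub (m : ℕ) :
    (Polynomial.X * symBasis (m + 1) - symBasis (m + 2)).degree ≤
      ((m : ℕ) : WithBot ℕ) := by
  have : Polynomial.X * symBasis (m + 1) - symBasis (m + 2) =
      Polynomial.Chebyshev.C ℝ (m : ℤ) := by
    rw [symBasis, symBasis, chebyshevC_succ_succ, sub_sub_cancel]
  rw [this]
  cases m with
  | zero =>
    rw [Nat.cast_zero, Polynomial.Chebyshev.C_zero]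
    exact Polynomial.degree_C_le (a := (2 : ℝ))
  | succ m => exact (monic_chebyshevC m).2.le

/-- The polynomial `∑ c_j b_{n-j}` in `z + z⁻¹` behind a palindromic Laurent polynomial. -/
def symPoly (n : ℕ) : (Fin (n + 1) → ℝ) →ₗ[ℝ] Polynomial ℝ where
  toFun c := ∑ j : Fin (n + 1), c j • symBasis (n - j)
  map_add' c d := by simp [add_smul, Finset.sum_add_distrib]
  map_smul' a c := by simp [mul_smul, Finset.smul_sum]

theorem symPoly_apply (n : ℕ) (c : Fin (n + 1) → ℝ) :
    symPoly n c = ∑ j : Fin (n + 1), c j • symBasis (n - j) := rfl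

theorem aeval_symPoly {n : ℕ} (c : Fin (n + 1) → ℝ) {z : ℂ} (hz : z ≠ 0) :
    z ^ n * Polynomial.aeval (z + z⁻¹) (symPoly n c) =
      (∑ j : Fin n, (c j.castSucc : ℂ) * z ^ (2 * n - (j : ℕ))) +
        (∑ j : Fin n, (c j.castSucc : ℂ) * z ^ (j : ℕ)) + (c (Fin.last n) : ℂ) * z ^ n := by
  rw [symPoly_apply, Fin.sum_univ_castSucc, map_add, map_sum, mul_add, Finset.mul_sum,
    ← Finset.sum_add_distrib]
  congr 1
  · refine Finset.sum_congr rfl fun j _ => ?_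
    have hj := j.2
    rw [map_smul, Fin.val_castSucc, aeval_symBasis hz (by omega), Complex.real_smul]
    have h1 : z ^ n * z ^ (n - (j : ℕ)) = z ^ (2 * n - (j : ℕ)) := by
      rw [← pow_add]; congr 1; omega
    have h2 : z ^ n * (z⁻¹) ^ (n - (j : ℕ)) = z ^ (j : ℕ) := by
      rw [← pow_mul_pow_sub z hj.le, mul_assoc, ← mul_pow, mul_inv_cancel₀ hz, one_pow, mul_one]
    rw [← h1, ← h2]; ring
  · simp [symBasis, Complex.real_smul, mul_comm]

theorem P_eq {B : Fin (ℓ + 2) → ℝ} {z : ℂ} (hz : z ≠ 0) :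
    z * P B z = z ^ ℓ * Polynomial.aeval (z + z⁻¹) (symPoly (ℓ + 1) B) := by
  have h := aeval_symPoly B hz
  rw [P, show 2 * ℓ + 2 = 2 * (ℓ + 1) by ring, ← h, pow_succ]
  generalize Polynomial.aeval (z + z⁻¹) (symPoly (ℓ + 1) B) = y
  field_simp

theorem Q_eq {C : Fin (ℓ + 3) → ℝ} {z : ℂ} (hz : z ≠ 0) :
    z * Q C z = z ^ ℓ * Polynomial.aeval (z + z⁻¹) (symPoly (ℓ + 2) C) := by
  have h := aeval_symPoly C hz
  rw [Q, show 2 * ℓ + 4 = 2 * (ℓ + 2) by ring, ← h, pow_add]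
  generalize Polynomial.aeval (z + z⁻¹) (symPoly (ℓ + 2) C) = y
  field_simp

theorem degree_symPoly_lt {n m : ℕ} {c : Fin (n + 1) → ℝ}
    (h : ∀ j : Fin (n + 1), (j : ℕ) + m ≤ n → c j = 0) : (symPoly n c).degree < (m : ℕ) := by
  rw [symPoly_apply, Polynomial.degree_lt_iff_coeff_zero]
  intro i hi
  rw [Polynomial.finsetSum_coeff]
  refine Finset.sum_eq_zero fun j _ => ?_
  by_cases hj : (j : ℕ) + m ≤ n
  · simp [h j hj]
  · rw [Polynomial.coeff_smul, Polynomial.coeff_eq_zero_of_degree_lt, smul_zero]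
    rw [degree_symBasis]
    exact_mod_cast (by omega : n - (j : ℕ) < i)

/-- The polynomials `b_m`, as a sequence with one member of each degree. -/
def symSequence : Polynomial.Sequence ℝ where
  elems' := symBasis
  degree_eq' := degree_symBasis

theorem symPoly_injective (n : ℕ) : Function.Injective (symPoly n) := by
  rw [← LinearMap.ker_eq_bot, LinearMap.ker_eq_bot']
  intro c hc
  have hli := symSequence.linearIndependent.comp (fun j : Fin (n + 1) => n - (j : ℕ)) (by
    intro i j hij
    have hi := i.2
    have hj := j.2
    simp only at hij
    exact Fin.ext (by omega))
  funext j
  exact Fintype.linearIndependent_iff.1 hli c hc j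

theorem symPoly_monic {n : ℕ} {c : Fin (n + 1) → ℝ} (hc : c 0 = 1) :
    (symPoly n c).Monic ∧ (symPoly n c).degree = n := by
  have hsplit : symPoly n c = symBasis n + symPoly n (fun j => if j = 0 then 0 else c j) := by
    rw [symPoly_apply, symPoly_apply, Fin.sum_univ_succ, Fin.sum_univ_succ]
    simp [hc]
  have hlow : (symPoly n (fun j => if j = 0 then 0 else c j)).degree < (n : ℕ) := by
    refine degree_symPoly_lt fun j hj => ?_
    have : j = 0 := Fin.ext (by rw [Fin.val_zero]; omega)
    simp [this]
  rw [← degree_symBasis n] at hlow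
  rw [hsplit]
  exact ⟨(monic_symBasis n).add_of_left hlow,
    (Polynomial.degree_add_eq_left_of_degree_lt hlow).trans (degree_symBasis n)⟩

/-- A polynomial of degree less than `n` with `n` roots `2 cos u_i`. -/
theorem eq_zero_of_roots {f : Polynomial ℝ} {n : ℕ} (hdeg : f.degree < (n : ℕ)) {u : ℕ → ℝ}
    (hu : ∀ i < n, u i ∈ Set.Icc 0 Real.pi) (hmono : ∀ i j, i < j → j < n → u i ≠ u j)
    (hroot : ∀ i < n, f.eval (2 * Real.cos (u i)) = 0) : f = 0 := by
  refine Polynomial.eq_zero_of_degree_lt_of_eval_index_eq_zero (Finset.range n)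
    (v := fun i => 2 * Real.cos (u i)) ?_ (by simpa using hdeg) (fun i hi => hroot i (by simpa using hi))
  intro i hi j hj hij
  have hi' : i < n := by simpa using hi
  have hj' : j < n := by simpa using hj
  have h1 := Real.injOn_cos (hu i hi') (hu j hj') (by simp only at hij; linarith)
  by_contra hne
  rcases lt_or_gt_of_ne hne with h | h
  · exact hmono i j h hj' h1
  · exact hmono j i h hi' h1.symm

/-- The functional `f ↦ ∫ f(2 cos u) k(u) du`. -/
def moment (k : ℝ → ℝ) (s t : ℝ) (hk : IntervalIntegrable k MeasureTheory.volume s t) :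
    Polynomial ℝ →ₗ[ℝ] ℝ where
  toFun f := ∫ u in s..t, f.eval (2 * Real.cos u) * k u
  map_add' f g := by
    have hfk : ∀ f : Polynomial ℝ, IntervalIntegrable (fun u => f.eval (2 * Real.cos u) * k u)
        MeasureTheory.volume s t := fun f => hk.continuousOn_mul
      (f.continuous.comp (continuous_const.mul Real.continuous_cos)).continuousOn
    rw [← intervalIntegral.integral_add (hfk f) (hfk g)]
    simp only [Polynomial.eval_add, add_mul]
  map_smul' a f := by
    rw [RingHom.id_apply, smul_eq_mul, ← intervalIntegral.integral_const_mul]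
    simp only [Polynomial.eval_smul, smul_eq_mul, mul_assoc]

/-- The linear system for the coefficients `c` of `symPoly n c`: the coefficients of `b_m`, `m ≥ ℓ`,
are prescribed, and so are the values of `ℓ` functionals. -/
def coeffSystem (n ℓ : ℕ) (Λ : ℕ → Polynomial ℝ →ₗ[ℝ] ℝ) :
    (Fin (n + 1) → ℝ) →ₗ[ℝ] (Fin (n + 1) → ℝ) :=
  LinearMap.pi fun j => if (j : ℕ) + ℓ ≤ n then LinearMap.proj j
    else (Λ ((j : ℕ) + ℓ - n - 1)).comp (symPoly n)

theorem coeffSystem_apply_of_le {n ℓ : ℕ} {Λ : ℕ → Polynomial ℝ →ₗ[ℝ] ℝ} (c : Fin (n + 1) → ℝ)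
    {j : Fin (n + 1)} (hj : (j : ℕ) + ℓ ≤ n) : coeffSystem n ℓ Λ c j = c j := by
  simp [coeffSystem, hj]

theorem coeffSystem_apply_of_lt {n ℓ : ℕ} {Λ : ℕ → Polynomial ℝ →ₗ[ℝ] ℝ} (c : Fin (n + 1) → ℝ)
    {j : Fin (n + 1)} (hj : n < (j : ℕ) + ℓ) :
    coeffSystem n ℓ Λ c j = Λ ((j : ℕ) + ℓ - n - 1) (symPoly n c) := by
  simp [coeffSystem, hj.not_ge]

theorem coeffSystem_injective {n ℓ : ℕ} (hn : ℓ ≤ n) {Λ : ℕ → Polynomial ℝ →ₗ[ℝ] ℝ}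
    (hΛ : ∀ f : Polynomial ℝ, f.degree < (ℓ : ℕ) → (∀ i < ℓ, Λ i f = 0) → f = 0) :
    Function.Injective (coeffSystem n ℓ Λ) := by
  rw [← LinearMap.ker_eq_bot, LinearMap.ker_eq_bot']
  intro c hc
  have h1 : ∀ j : Fin (n + 1), (j : ℕ) + ℓ ≤ n → c j = 0 := fun j hj => by
    rw [← coeffSystem_apply_of_le (Λ := Λ) c hj, hc]; rfl
  apply symPoly_injective n
  rw [map_zero]
  refine hΛ _ (degree_symPoly_lt h1) fun i hi => ?_
  -- The rows `0, …, n - ℓ` fix coefficients and the last `ℓ` rows carry the functionals, so the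
  -- functional `i` sits in row `i + n + 1 - ℓ`.
  have h2 := coeffSystem_apply_of_lt (Λ := Λ) c (ℓ := ℓ)
    (j := ⟨i + n + 1 - ℓ, by omega⟩) (by simp only; omega)
  rw [hc] at h2
  simp only at h2
  rw [show i + n + 1 - ℓ + ℓ - n - 1 = i by omega] at h2
  exact h2.symm

/-- There are `n + 1` unknowns, `n + 1 - ℓ` prescribed coefficients and `ℓ` functionals. The system
is square, so uniqueness for the homogeneous problem gives existence as well. -/
theorem existsUnique_coeff {n ℓ : ℕ} (hn : ℓ ≤ n) {Λ : ℕ → Polynomial ℝ →ₗ[ℝ] ℝ}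
    (hΛ : ∀ f : Polynomial ℝ, f.degree < (ℓ : ℕ) → (∀ i < ℓ, Λ i f = 0) → f = 0)
    (d : Fin (n + 1) → ℝ) :
    ∃! c : Fin (n + 1) → ℝ, (∀ j : Fin (n + 1), (j : ℕ) + ℓ ≤ n → c j = d j) ∧
      ∀ i < ℓ, Λ i (symPoly n c) = 0 := by
  have hinj := coeffSystem_injective hn hΛ
  have hiff : ∀ c, coeffSystem n ℓ Λ c = (fun j : Fin (n + 1) => if (j : ℕ) + ℓ ≤ n then d j else 0)
      ↔ (∀ j : Fin (n + 1), (j : ℕ) + ℓ ≤ n → c j = d j) ∧ ∀ i < ℓ, Λ i (symPoly n c) = 0 := by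
    intro c
    constructor
    · intro h
      refine ⟨fun j hj => ?_, fun i hi => ?_⟩
      · rw [← coeffSystem_apply_of_le (Λ := Λ) c hj, h]; simp [hj]
      · have h2 := coeffSystem_apply_of_lt (Λ := Λ) c (ℓ := ℓ)
          (j := ⟨i + n + 1 - ℓ, by omega⟩) (by simp only; omega)
        rw [h] at h2
        simp only at h2
        rw [show i + n + 1 - ℓ + ℓ - n - 1 = i by omega, if_neg (by omega)] at h2
        exact h2.symm
    · rintro ⟨h1, h2⟩
      funext j
      by_cases hj : (j : ℕ) + ℓ ≤ n
      · rw [coeffSystem_apply_of_le c hj, h1 j hj]; simp [hj]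
      · rw [coeffSystem_apply_of_lt c (by omega), h2 _ (by have := j.2; omega)]; simp [hj]
  obtain ⟨c, hc⟩ := (LinearMap.injective_iff_surjective.1 hinj)
    (fun j : Fin (n + 1) => if (j : ℕ) + ℓ ≤ n then d j else 0)
  refine ⟨c, (hiff c).1 hc, fun c' hc' => hinj ?_⟩
  rw [hc, (hiff c').2 hc']

end DarkGas
end

/-! ### Integrals over gaps and expansions at the origin. -/

noncomputable section
namespace DarkGas

variable {θ : ℕ → ℝ} {ℓ : ℕ} {φ : ℝ}

theorem differentiableAt_R_cis_neg (H : Admissible θ ℓ φ) {u : ℝ} (hu : u ∈ gapSet θ ℓ φ) :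
    DifferentiableAt ℂ (R θ ℓ φ) (cis (-u)) := by
  obtain ⟨h0, hpi, hu⟩ := hu
  unfold R
  refine DifferentiableAt.fun_finsetProd fun j hj => ?_
  have h := hu j hj
  rw [Finset.mem_Icc] at hj
  have h1 := H.lt (i := 2 * j - 1) (j := 2 * j) (by omega) (by omega) (by omega)
  have h2 := H.theta_le (k := 2 * j - 1) (by omega) (by omega)
  have h3 := H.ang_lt_pi (k := 2 * j) (by omega) (by omega)
  have h4 := H.theta_pos
  have h5 := H.theta_lt_pi
  refine DifferentiableAt.mul (differentiableAt_arcSqrt_cis h1 (Or.inl ⟨by linarith, by linarith⟩))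
    (differentiableAt_arcSqrt_cis (by linarith) ?_)
  rcases h with h | h
  · exact Or.inr ⟨by linarith, by linarith⟩
  · exact Or.inl ⟨by linarith, by linarith⟩

/-- Points `iu` of the gaps with `u ≥ θ₁` lie outside `logDomain`, where evenness was proved. It
passes to the limit from the right half plane, since the kernel is continuous at both `iu` and
`-iu`. -/
theorem kernel_neg_mul_I (H : Admissible θ ℓ φ) (f : Polynomial ℝ) {u : ℝ}
    (hu : u ∈ gapSet θ ℓ φ) :
    kernel θ ℓ φ f ((-u : ℝ) * Complex.I) = kernel θ ℓ φ f (u * Complex.I) := by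
  have hc : ContinuousAt (kernel θ ℓ φ f) ((-u : ℝ) * Complex.I) := by
    refine (differentiableAt_kernel_of_rootFn (differentiableAt_rootFn_of_R ?_) ?_).continuousAt
    · rw [exp_I_mul]
      exact differentiableAt_R_cis_neg H hu
    · intro h
      have := rootFn_sq θ ℓ φ ((-u : ℝ) * Complex.I)
      rw [h, Complex.ofReal_neg, neg_mul, branchProd_neg, branchProd_mul_I] at this
      have h3 : realProd θ ℓ φ u = 0 := by
        apply Complex.ofReal_injective
        rw [← this]; simp
      exact (realProd_pos H hu).ne' h3
  have h1 : Tendsto (kernel θ ℓ φ f) (𝓝[rightHalf] (u * Complex.I : ℂ))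
      (𝓝 (kernel θ ℓ φ f (u * Complex.I))) :=
    (continuousAt_kernel_mul_I H f hu).tendsto.mono_left nhdsWithin_le_nhds
  have h2 : Tendsto (fun w : ℂ => -w) (𝓝[rightHalf] (u * Complex.I : ℂ))
      (𝓝 ((-u : ℝ) * Complex.I)) := by
    have := (continuous_neg.tendsto (u * Complex.I : ℂ)).mono_left
      (nhdsWithin_le_nhds (s := rightHalf))
    simpa using this
  refine tendsto_nhds_unique ((hc.tendsto.comp h2).congr' ?_) h1
  filter_upwards [self_mem_nhdsWithin] with w hw
  exact kernel_neg H f (rightHalf_subset hw)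

theorem arcIntegral_eq_kernel {F : ℂ → ℂ} {f : Polynomial ℝ}
    (hF : ∀ z ≠ 0, z * F z = logCoeff θ ℓ φ f z) {r : ℝ} (hr : 0 < r) (a b : ℝ) :
    arcIntegral F r a b =
      ∫ u in a..b, kernel θ ℓ φ f (Real.log r + u * Complex.I) * Complex.I := by
  unfold arcIntegral
  refine intervalIntegral.integral_congr fun u _ => ?_
  have h : Complex.exp (Real.log r + u * Complex.I) = r * cis u := by
    rw [Complex.exp_add, ← Complex.ofReal_exp, Real.exp_log hr, cis]
  simp only [kernel_eq_logCoeff, h]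
  rw [← hF _ (mul_ne_zero (Complex.ofReal_ne_zero.2 hr.ne') (cis_ne_zero u))]
  ring

theorem integral_kernel_ofReal (H : Admissible θ ℓ φ) (f : Polynomial ℝ) {s t : ℝ} (hst : s < t)
    (hsub : Set.Ioo s t ⊆ gapSet θ ℓ φ) :
    ∫ u in s..t, kernel θ ℓ φ f (u * Complex.I) =
      ((∫ u in s..t, (kernel θ ℓ φ f (u * Complex.I)).re : ℝ) : ℂ) := by
  rw [← intervalIntegral.integral_ofReal, intervalIntegral.integral_of_le hst.le,
    intervalIntegral.integral_of_le hst.le, MeasureTheory.integral_Ioc_eq_integral_Ioo,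
    MeasureTheory.integral_Ioc_eq_integral_Ioo]
  refine MeasureTheory.setIntegral_congr_fun measurableSet_Ioo fun u hu => ?_
  exact Complex.ext (by simp) (by simp [kernel_im_eq_zero H f (hsub hu)])

/-- Evenness makes the integral over a conjugate gap equal to that over the gap, and the kernel is
real there, so two complex conditions reduce to a single real one. This makes the system square. -/
theorem gapIntegralsVanish_iff (H : Admissible θ ℓ φ) {F : ℂ → ℂ} {f : Polynomial ℝ}
    (hF : ∀ z ≠ 0, z * F z = logCoeff θ ℓ φ f z) : GapIntegralsVanish θ ℓ φ F ↔
      ∀ j ∈ Finset.Icc 1 ℓ, ∫ u in ang θ ℓ φ (2 * j)..ang θ ℓ φ (2 * j + 1),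
        (kernel θ ℓ φ f (u * Complex.I)).re = 0 := by
  refine forall_congr' fun j => forall_congr' fun hj => ?_
  rw [Finset.mem_Icc] at hj
  have hst := H.lt (i := 2 * j) (j := 2 * j + 1) (by omega) (by omega) (by omega)
  have hsub := Ioo_gap_subset H hj.1 hj.2
  have h1 : arcIntegral F 1 (ang θ ℓ φ (2 * j)) (ang θ ℓ φ (2 * j + 1)) =
      ((∫ u in ang θ ℓ φ (2 * j)..ang θ ℓ φ (2 * j + 1),
        (kernel θ ℓ φ f (u * Complex.I)).re : ℝ) : ℂ) * Complex.I := by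
    rw [arcIntegral_eq_kernel hF one_pos, intervalIntegral.integral_mul_const,
      ← integral_kernel_ofReal H f hst hsub]
    simp
  have h2 : arcIntegral F 1 (-ang θ ℓ φ (2 * j + 1)) (-ang θ ℓ φ (2 * j)) =
      ((∫ u in ang θ ℓ φ (2 * j)..ang θ ℓ φ (2 * j + 1),
        (kernel θ ℓ φ f (u * Complex.I)).re : ℝ) : ℂ) * Complex.I := by
    rw [arcIntegral_eq_kernel hF one_pos, intervalIntegral.integral_mul_const,
      ← integral_kernel_ofReal H f hst hsub]
    congr 1
    simp only [Real.log_one, Complex.ofReal_zero, zero_add]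
    rw [← intervalIntegral.integral_comp_neg fun u : ℝ => kernel θ ℓ φ f (u * Complex.I),
      intervalIntegral.integral_of_le hst.le, intervalIntegral.integral_of_le hst.le,
      MeasureTheory.integral_Ioc_eq_integral_Ioo, MeasureTheory.integral_Ioc_eq_integral_Ioo]
    exact MeasureTheory.setIntegral_congr_fun measurableSet_Ioo fun u hu =>
      kernel_neg_mul_I H f (hsub hu)
  rw [h1, h2, and_self, mul_eq_zero, Complex.ofReal_eq_zero]
  simp [Complex.I_ne_zero]

theorem logCoeff_P (B : Fin (ℓ + 2) → ℝ) : ∀ z ≠ 0, z * (P B z / R θ ℓ φ z) =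
    logCoeff θ ℓ φ (symPoly (ℓ + 1) B) z := by
  intro z hz
  rw [logCoeff, ← P_eq hz, mul_div_assoc]

theorem logCoeff_Q (C : Fin (ℓ + 3) → ℝ) : ∀ z ≠ 0, z * (Q C z / R θ ℓ φ z) =
    logCoeff θ ℓ φ (symPoly (ℓ + 2) C) z := by
  intro z hz
  rw [logCoeff, ← Q_eq hz, mul_div_assoc]

/-- The coefficient of `z²` collects one `z²` from each factor and the second elementary symmetric
function, expressed by power sums because the prescribed `C 2` is given in that form. -/
theorem prod_quadratic_expansion (s : Finset ℕ) (a : ℕ → ℂ) : ∃ r : Polynomial ℂ, ∀ z : ℂ,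
    ∏ k ∈ s, (z ^ 2 - a k * z + 1) = 1 - (∑ k ∈ s, a k) * z +
      (s.card + ((∑ k ∈ s, a k) ^ 2 - ∑ k ∈ s, a k ^ 2) / 2) * z ^ 2 + z ^ 3 * r.eval z := by
  classical
  induction s using Finset.induction_on with
  | empty => exact ⟨0, fun z => by simp⟩
  | insert k s hk ih =>
    obtain ⟨r, hr⟩ := ih
    set σ := ∑ k ∈ s, a k
    set e := (s.card + (σ ^ 2 - ∑ k ∈ s, a k ^ 2) / 2 : ℂ)
    refine ⟨r * (Polynomial.X ^ 2 - Polynomial.C (a k) * Polynomial.X + 1) +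
      Polynomial.C (-σ - e * a k) + Polynomial.C e * Polynomial.X, fun z => ?_⟩
    rw [Finset.prod_insert hk, hr, Finset.sum_insert hk, Finset.sum_insert hk,
      Finset.card_insert_of_notMem hk]
    simp only [Polynomial.eval_add, Polynomial.eval_mul, Polynomial.eval_sub, Polynomial.eval_pow,
      Polynomial.eval_X, Polynomial.eval_C, Polynomial.eval_one]
    push_cast
    simp only [e]
    ring

/-- If `A² - R² = O(z^{m+1})` and `A(0) = R(0) = 1`, then `A/R - 1 = o(z^m)`. -/
theorem tendsto_div_sub_one {A R ρ : ℂ → ℂ} {m : ℕ} (hA : ContinuousAt A 0) (hA0 : A 0 = 1)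
    (hR : ContinuousAt R 0) (hR0 : R 0 = 1) (hρ : ContinuousAt ρ 0)
    (h : ∀ z, A z ^ 2 - R z ^ 2 = z ^ (m + 1) * ρ z) :
    Tendsto (fun z => (z ^ m)⁻¹ * (A z / R z) - (z ^ m)⁻¹) (𝓝[≠] 0) (𝓝 0) := by
  have hlim : Tendsto (fun z => z * ρ z / ((A z + R z) * R z)) (𝓝[≠] 0) (𝓝 0) := by
    have hc : ContinuousAt (fun z => z * ρ z / ((A z + R z) * R z)) 0 := by
      refine ContinuousAt.div (continuousAt_id.mul hρ) ((hA.add hR).mul hR) ?_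
      rw [hA0, hR0]; norm_num
    have := hc.tendsto.mono_left (nhdsWithin_le_nhds (s := {0}ᶜ))
    simpa using this
  refine hlim.congr' ?_
  have h1 : ∀ᶠ z in 𝓝[≠] (0 : ℂ), R z ≠ 0 :=
    nhdsWithin_le_nhds (hR.eventually_ne (by rw [hR0]; exact one_ne_zero))
  have h2 : ∀ᶠ z in 𝓝[≠] (0 : ℂ), A z + R z ≠ 0 :=
    nhdsWithin_le_nhds ((hA.add hR).eventually_ne (by
      simp only [Pi.add_apply, hR0, hA0]; norm_num))
  filter_upwards [h1, h2, self_mem_nhdsWithin] with z hz1 hz2 hz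
  have hz' : z ≠ 0 := hz
  -- Only `R²` has an explicit expansion; dividing `A² - R²` by `A + R`, which tends to `2`, selects
  -- the right branch.
  have h3 : (A z - R z) * (A z + R z) = z ^ (m + 1) * ρ z := by rw [← h]; ring
  have h4 : A z - R z = z ^ (m + 1) * ρ z / (A z + R z) := by
    rw [eq_div_iff hz2, h3]
  have h5 : (z ^ m)⁻¹ * (A z / R z) - (z ^ m)⁻¹ = (z ^ m)⁻¹ * (A z - R z) / R z := by
    field_simp
  rw [h5, h4, pow_succ]
  field_simp

theorem P_expansion (hℓ : 1 ≤ ℓ) (B : Fin (ℓ + 2) → ℝ) : ∃ r : Polynomial ℂ, ∀ z ≠ 0,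
    z ^ 2 * P B z = B 0 + B 1 * z + z ^ 2 * r.eval z := by
  obtain ⟨n, rfl⟩ : ∃ n, ℓ = n + 1 := ⟨ℓ - 1, by omega⟩
  refine ⟨(∑ j : Fin (n + 2), Polynomial.C (B j.castSucc : ℂ) * Polynomial.X ^ (2 * n + 2 - (j : ℕ))) +
    (∑ j : Fin n, Polynomial.C (B j.succ.succ.castSucc : ℂ) * Polynomial.X ^ (j : ℕ)) +
    Polynomial.C (B (Fin.last (n + 2)) : ℂ) * Polynomial.X ^ n, fun z hz => ?_⟩
  rw [P, mul_div_cancel₀ _ (pow_ne_zero 2 hz)]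
  simp only [Polynomial.eval_add, Polynomial.eval_finsetSum, Polynomial.eval_mul,
    Polynomial.eval_C, Polynomial.eval_pow, Polynomial.eval_X]
  have e1 : ∑ j : Fin (n + 1 + 1), (B j.castSucc : ℂ) * z ^ (2 * (n + 1) + 2 - (j : ℕ)) =
      z ^ 2 * ∑ j : Fin (n + 2), (B j.castSucc : ℂ) * z ^ (2 * n + 2 - (j : ℕ)) := by
    rw [Finset.mul_sum]
    refine Finset.sum_congr rfl fun j _ => ?_
    rw [show 2 * (n + 1) + 2 - (j : ℕ) = 2 + (2 * n + 2 - (j : ℕ)) by have := j.2; omega, pow_add]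
    ring
  have e2 : ∑ j : Fin (n + 1 + 1), (B j.castSucc : ℂ) * z ^ (j : ℕ) = B 0 + B 1 * z +
      z ^ 2 * ∑ j : Fin n, (B j.succ.succ.castSucc : ℂ) * z ^ (j : ℕ) := by
    rw [Fin.sum_univ_succ, Fin.sum_univ_succ, Finset.mul_sum, ← add_assoc]
    congr 1
    · simp
    · refine Finset.sum_congr rfl fun j _ => ?_
      simp only [Fin.val_succ]
      ring
  rw [e1, e2]
  ring

theorem Q_expansion (hℓ : 1 ≤ ℓ) (C : Fin (ℓ + 3) → ℝ) : ∃ r : Polynomial ℂ, ∀ z ≠ 0,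
    z ^ 3 * Q C z = C 0 + C 1 * z + C 2 * z ^ 2 + z ^ 3 * r.eval z := by
  obtain ⟨n, rfl⟩ : ∃ n, ℓ = n + 1 := ⟨ℓ - 1, by omega⟩
  refine ⟨(∑ j : Fin (n + 3), Polynomial.C (C j.castSucc : ℂ) * Polynomial.X ^ (2 * n + 3 - (j : ℕ))) +
    (∑ j : Fin n, Polynomial.C (C j.succ.succ.succ.castSucc : ℂ) * Polynomial.X ^ (j : ℕ)) +
    Polynomial.C (C (Fin.last (n + 3)) : ℂ) * Polynomial.X ^ n, fun z hz => ?_⟩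
  rw [Q, mul_div_cancel₀ _ (pow_ne_zero 3 hz)]
  simp only [Polynomial.eval_add, Polynomial.eval_finsetSum, Polynomial.eval_mul,
    Polynomial.eval_C, Polynomial.eval_pow, Polynomial.eval_X]
  have e1 : ∑ j : Fin (n + 1 + 2), (C j.castSucc : ℂ) * z ^ (2 * (n + 1) + 4 - (j : ℕ)) =
      z ^ 3 * ∑ j : Fin (n + 3), (C j.castSucc : ℂ) * z ^ (2 * n + 3 - (j : ℕ)) := by
    rw [Finset.mul_sum]
    refine Finset.sum_congr rfl fun j _ => ?_
    rw [show 2 * (n + 1) + 4 - (j : ℕ) = 3 + (2 * n + 3 - (j : ℕ)) by have := j.2; omega, pow_add]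
    ring
  have e2 : ∑ j : Fin (n + 1 + 2), (C j.castSucc : ℂ) * z ^ (j : ℕ) = C 0 + C 1 * z + C 2 * z ^ 2 +
      z ^ 3 * ∑ j : Fin n, (C j.succ.succ.succ.castSucc : ℂ) * z ^ (j : ℕ) := by
    rw [Fin.sum_univ_succ, Fin.sum_univ_succ, Fin.sum_univ_succ, Finset.mul_sum, ← add_assoc,
      ← add_assoc]
    congr 1
    · simp
      rfl
    · refine Finset.sum_congr rfl fun j _ => ?_
      simp only [Fin.val_succ]
      ring
  rw [e1, e2]
  ring

end DarkGas
end

/-! ### Normalised differentials, their roots, and unique solvability for the coefficients. -/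

noncomputable section
namespace DarkGas

variable {θ : ℕ → ℝ} {ℓ : ℕ} {φ : ℝ}

theorem sum_ang {M : Type*} [AddCommMonoid M] (hℓ : 1 ≤ ℓ) (F : ℝ → M) :
    ∑ k ∈ Finset.Icc 1 (2 * ℓ), F (ang θ ℓ φ k) =
      (∑ j ∈ Finset.Icc 1 (2 * ℓ - 1), F (θ j)) + F φ := by
  obtain ⟨m, hm⟩ : ∃ m, 2 * ℓ = m + 1 := ⟨2 * ℓ - 1, by omega⟩
  rw [hm, Finset.sum_Icc_succ_top (by omega), Nat.add_sub_cancel, ← hm, ang_two_mul]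
  congr 1
  refine Finset.sum_congr rfl fun j hj => ?_
  rw [Finset.mem_Icc] at hj
  rw [ang_of_lt (by omega)]

theorem sq_R_expansion (θ : ℕ → ℝ) (ℓ : ℕ) (φ : ℝ) : ∃ r : Polynomial ℂ, ∀ z : ℂ,
    R θ ℓ φ z ^ 2 = 1 - (∑ k ∈ Finset.Icc 1 (2 * ℓ), (2 * Real.cos (ang θ ℓ φ k) : ℂ)) * z +
      (2 * ℓ + ((∑ k ∈ Finset.Icc 1 (2 * ℓ), (2 * Real.cos (ang θ ℓ φ k) : ℂ)) ^ 2 -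
        ∑ k ∈ Finset.Icc 1 (2 * ℓ), (2 * Real.cos (ang θ ℓ φ k) : ℂ) ^ 2) / 2) * z ^ 2 +
      z ^ 3 * r.eval z := by
  obtain ⟨r, hr⟩ := prod_quadratic_expansion (Finset.Icc 1 (2 * ℓ))
    fun k => (2 * Real.cos (ang θ ℓ φ k) : ℂ)
  refine ⟨r, fun z => ?_⟩
  rw [sq_R, hr, Nat.card_Icc, Nat.add_sub_cancel]
  push_cast
  rfl

theorem continuousAt_R_zero (H : Admissible θ ℓ φ) : ContinuousAt (R θ ℓ φ) 0 :=
  (differentiableAt_R_of_norm_ne_one H (by simp)).continuousAt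

/-- The prescribed `B 1` is the value that makes `z² P` agree with `R` to first order at `0`, so
that `P/R dz` has a double pole without residue. For `Q` the coefficients `C 1`, `C 2` achieve
agreement to second order. -/
theorem hasPrincipalPart_P (H : Admissible θ ℓ φ) {B : Fin (ℓ + 2) → ℝ}
    (h0 : B 0 = 1)
    (h1 : B 1 = -(∑ j ∈ Finset.Icc 1 (2 * ℓ - 1), Real.cos (θ j)) - Real.cos φ) :
    HasPrincipalPart θ ℓ φ (symPoly (ℓ + 1) B) 1 0 := by
  obtain ⟨r, hr⟩ := P_expansion H.one_le B
  obtain ⟨r', hr'⟩ := sq_R_expansion θ ℓ φ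
  set σ : ℂ := ∑ k ∈ Finset.Icc 1 (2 * ℓ), (2 * Real.cos (ang θ ℓ φ k) : ℂ) with hσ
  set e : ℂ := 2 * ℓ + (σ ^ 2 -
    ∑ k ∈ Finset.Icc 1 (2 * ℓ), (2 * Real.cos (ang θ ℓ φ k) : ℂ) ^ 2) / 2 with he
  have hB1 : 2 * (B 1 : ℂ) = -σ := by
    rw [hσ, sum_ang H.one_le (fun t => (2 * Real.cos t : ℂ)), h1, ← Finset.mul_sum]
    push_cast; ring
  have key := tendsto_div_sub_one (m := 1) (A := fun z => 1 + B 1 * z + z ^ 2 * r.eval z)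
    (R := R θ ℓ φ) (ρ := fun z => 2 * r.eval z + (B 1 + z * r.eval z) ^ 2 - e - z * r'.eval z)
    (by have := r.continuous; fun_prop) (by simp) (continuousAt_R_zero H) (R_zero H)
    (by have := r.continuous; have := r'.continuous; fun_prop) (fun z => by
      rw [hr']
      linear_combination z * hB1)
  refine key.congr' ?_
  filter_upwards [self_mem_nhdsWithin] with z hz
  have hz' : z ≠ 0 := hz
  have := hr z hz'
  rw [h0, Complex.ofReal_one] at this
  rw [← this, ← logCoeff_P B z hz']
  field_simp
  ring

theorem hasPrincipalPart_Q (H : Admissible θ ℓ φ) {C : Fin (ℓ + 3) → ℝ}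
    (h0 : C 0 = 1)
    (h1 : C 1 = -(∑ j ∈ Finset.Icc 1 (2 * ℓ - 1), Real.cos (θ j)) - Real.cos φ)
    (h2 : C 2 = 1 / 8 *
      ((∑ j ∈ Finset.Icc 1 (2 * ℓ - 1), 2 * Real.cos (θ j)) ^ 2
        - 2 * (∑ j ∈ Finset.Icc 1 (2 * ℓ - 1), 2 * Real.cos (2 * θ j)) + 2
        + 2 * (2 * Real.cos φ) * (∑ j ∈ Finset.Icc 1 (2 * ℓ - 1), 2 * Real.cos (θ j))
        - 2 * Real.cos (2 * φ))) :
    HasPrincipalPart θ ℓ φ (symPoly (ℓ + 2) C) 0 1 := by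
  obtain ⟨r, hr⟩ := Q_expansion H.one_le C
  obtain ⟨r', hr'⟩ := sq_R_expansion θ ℓ φ
  set σ : ℂ := ∑ k ∈ Finset.Icc 1 (2 * ℓ), (2 * Real.cos (ang θ ℓ φ k) : ℂ) with hσ
  set e : ℂ := 2 * ℓ + (σ ^ 2 -
    ∑ k ∈ Finset.Icc 1 (2 * ℓ), (2 * Real.cos (ang θ ℓ φ k) : ℂ) ^ 2) / 2 with he
  have hC1 : 2 * (C 1 : ℂ) = -σ := by
    rw [hσ, sum_ang H.one_le (fun t => (2 * Real.cos t : ℂ)), h1, ← Finset.mul_sum]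
    push_cast; ring
  have hC2 : 2 * (C 2 : ℂ) + (C 1 : ℂ) ^ 2 = e := by
    rw [he, hσ, sum_ang H.one_le (fun t => (2 * Real.cos t : ℂ)),
      sum_ang H.one_le (fun t => (2 * Real.cos t : ℂ) ^ 2), h1, h2]
    -- From `2 cos 2θ = (2 cos θ)² - 2`; the `2ℓ - 1` constants account for the cardinality term in
    -- the expansion of `R²`.
    have hcos : ∑ j ∈ Finset.Icc 1 (2 * ℓ - 1), 2 * Real.cos (2 * θ j) =
        (∑ j ∈ Finset.Icc 1 (2 * ℓ - 1), (2 * Real.cos (θ j)) ^ 2) - 2 * (2 * ℓ - 1) := by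
      have hcard : ((Finset.Icc 1 (2 * ℓ - 1)).card : ℝ) = 2 * ℓ - 1 := by
        have := H.one_le
        rw [Nat.card_Icc, Nat.add_sub_cancel, Nat.cast_sub (by omega)]; push_cast; ring
      rw [← hcard, eq_sub_iff_add_eq, mul_comm (2 : ℝ) (Finset.card _ : ℝ), ← nsmul_eq_mul,
        ← Finset.sum_const, ← Finset.sum_add_distrib]
      refine Finset.sum_congr rfl fun j _ => ?_
      rw [Real.cos_two_mul]; ring
    rw [hcos, Real.cos_two_mul]
    simp only [← Finset.mul_sum]
    push_cast
    ring
  have key := tendsto_div_sub_one (m := 2)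
    (A := fun z => 1 + C 1 * z + C 2 * z ^ 2 + z ^ 3 * r.eval z)
    (R := R θ ℓ φ) (ρ := fun z => 2 * r.eval z * (1 + C 1 * z + C 2 * z ^ 2) +
      z ^ 3 * r.eval z ^ 2 + 2 * C 1 * C 2 + C 2 ^ 2 * z - r'.eval z)
    (by have := r.continuous; fun_prop) (by simp) (continuousAt_R_zero H) (R_zero H)
    (by have := r.continuous; have := r'.continuous; fun_prop) (fun z => by
      rw [hr']
      linear_combination z * hC1 + z ^ 2 * hC2)
  refine key.congr' ?_
  filter_upwards [self_mem_nhdsWithin] with z hz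
  have hz' : z ≠ 0 := hz
  have := hr z hz'
  rw [h0, Complex.ofReal_one] at this
  rw [← this, ← logCoeff_Q C z hz']
  field_simp
  ring

theorem IsCoeffP.normalized (H : Admissible θ ℓ φ) {B : Fin (ℓ + 2) → ℝ}
    (h : IsCoeffP θ ℓ φ B) : Normalized θ ℓ φ (symPoly (ℓ + 1) B) 1 0 where
  principal := hasPrincipalPart_P H h.zero h.one
  gaps := (gapIntegralsVanish_iff H (logCoeff_P B)).1 h.gaps

theorem IsCoeffQ.normalized (H : Admissible θ ℓ φ) {C : Fin (ℓ + 3) → ℝ}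
    (h : IsCoeffQ θ ℓ φ C) : Normalized θ ℓ φ (symPoly (ℓ + 2) C) 0 1 where
  principal := hasPrincipalPart_Q H h.zero h.one h.two
  gaps := (gapIntegralsVanish_iff H (logCoeff_Q C)).1 h.gaps

/-- Left ends of the gaps in the upper half circle, including the half gap `[0, θ_1]`. -/
def gapLo (θ : ℕ → ℝ) (ℓ : ℕ) (φ : ℝ) (i : ℕ) : ℝ := if i = 0 then 0 else ang θ ℓ φ (2 * i)

theorem gapLo_lt (H : Admissible θ ℓ φ) {i : ℕ} (hi : i ≤ ℓ) :
    gapLo θ ℓ φ i < ang θ ℓ φ (2 * i + 1) := by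
  rw [gapLo]
  split_ifs with h
  · exact H.ang_pos (by omega) (by omega)
  · exact H.lt (by omega) (by omega) (by omega)

theorem gapLo_nonneg (H : Admissible θ ℓ φ) {i : ℕ} (hi : i ≤ ℓ) : 0 ≤ gapLo θ ℓ φ i := by
  rw [gapLo]
  split_ifs with h
  · exact le_rfl
  · exact (H.ang_pos (by omega) (by omega)).le

theorem gapHi_le_pi (H : Admissible θ ℓ φ) {i : ℕ} (hi : i ≤ ℓ) :
    ang θ ℓ φ (2 * i + 1) ≤ Real.pi :=
  (H.le (by omega) (by omega) le_rfl).trans_eq (ang_last θ ℓ φ)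

theorem gapHi_lt_gapLo (H : Admissible θ ℓ φ) {i j : ℕ} (hij : i < j) (hj : j ≤ ℓ) :
    ang θ ℓ φ (2 * i + 1) < gapLo θ ℓ φ j := by
  rw [gapLo, if_neg (by omega)]
  exact H.lt (by omega) (by omega) (by omega)

theorem Ioo_gapLo_subset (H : Admissible θ ℓ φ) {i : ℕ} (hi : i ≤ ℓ) :
    Set.Ioo (gapLo θ ℓ φ i) (ang θ ℓ φ (2 * i + 1)) ⊆ gapSet θ ℓ φ := by
  rw [gapLo]
  split_ifs with h
  · subst h
    intro u hu
    rw [mul_zero, zero_add, H.ang_one] at hu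
    exact Ioo_central_subset H ⟨by linarith [hu.1, H.theta_pos], hu.2⟩
  · exact Ioo_gap_subset H (by omega) hi

theorem Normalized.integral_gap (H : Admissible θ ℓ φ) {f : Polynomial ℝ} {a b : ℂ}
    (hf : Normalized θ ℓ φ f a b) {i : ℕ} (hi : i ≤ ℓ) :
    ∫ u in gapLo θ ℓ φ i..ang θ ℓ φ (2 * i + 1), (kernel θ ℓ φ f (u * Complex.I)).re = 0 := by
  rw [gapLo]
  split_ifs with h
  · subst h
    rw [mul_zero, zero_add, H.ang_one]
    exact integral_central_eq_zero H hf
  · exact hf.gaps i (Finset.mem_Icc.2 ⟨by omega, hi⟩)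

/-- Choice of one point in each gap gives distinct points of `[0, π]`. -/
theorem gap_points (H : Admissible θ ℓ φ) {u : ℕ → ℝ} {i j : ℕ} (hij : i < j) (hj : j ≤ ℓ)
    (hi' : u i ∈ Set.Ioo (gapLo θ ℓ φ i) (ang θ ℓ φ (2 * i + 1)))
    (hj' : u j ∈ Set.Ioo (gapLo θ ℓ φ j) (ang θ ℓ φ (2 * j + 1))) : u i < u j :=
  (hi'.2.trans (gapHi_lt_gapLo H hij hj)).trans hj'.1

theorem gap_point_mem (H : Admissible θ ℓ φ) {i : ℕ} (hi : i ≤ ℓ) {u : ℝ}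
    (hu : u ∈ Set.Ioo (gapLo θ ℓ φ i) (ang θ ℓ φ (2 * i + 1))) : u ∈ Set.Icc 0 Real.pi :=
  ⟨(gapLo_nonneg H hi).trans hu.1.le, hu.2.le.trans (gapHi_le_pi H hi)⟩

/-- One root comes from each of the `ℓ` imposed conditions and one from the arc `(0, θ₁)`, giving `ℓ
+ 1` in all. For `p` these are all the roots. -/
theorem Normalized.exists_roots (H : Admissible θ ℓ φ) {f : Polynomial ℝ} {a b : ℂ}
    (hf : Normalized θ ℓ φ f a b) : ∃ u : ℕ → ℝ, ∀ i ≤ ℓ,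
      u i ∈ Set.Ioo (gapLo θ ℓ φ i) (ang θ ℓ φ (2 * i + 1)) ∧ f.eval (2 * Real.cos (u i)) = 0 := by
  have h : ∀ i, ∃ u : ℝ, i ≤ ℓ → u ∈ Set.Ioo (gapLo θ ℓ φ i) (ang θ ℓ φ (2 * i + 1)) ∧
      f.eval (2 * Real.cos u) = 0 := by
    intro i
    by_cases hi : i ≤ ℓ
    · obtain ⟨u, hu⟩ := exists_root_of_integral_eq_zero H (gapLo_lt H hi) (Ioo_gapLo_subset H hi)
        (hf.integral_gap H hi)
      exact ⟨u, fun _ => hu⟩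
    · exact ⟨0, fun h => absurd h hi⟩
  choose u hu using h
  exact ⟨u, hu⟩

/-- One root per gap gives `ℓ` distinct roots, too many for degree `< ℓ`. The functional `i` belongs
to the gap `i + 1`; indices `i ≥ ℓ` are filled with `0`. -/
theorem exists_gapFunctional (H : Admissible θ ℓ φ) : ∃ Λ : ℕ → Polynomial ℝ →ₗ[ℝ] ℝ,
    (∀ i < ℓ, ∀ f, Λ i f = ∫ u in ang θ ℓ φ (2 * (i + 1))..ang θ ℓ φ (2 * (i + 1) + 1),
      (kernel θ ℓ φ f (u * Complex.I)).re) ∧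
    ∀ f : Polynomial ℝ, f.degree < (ℓ : ℕ) → (∀ i < ℓ, Λ i f = 0) → f = 0 := by
  have h : ∀ i, ∃ Λ : Polynomial ℝ →ₗ[ℝ] ℝ, i < ℓ → ∀ f, Λ f =
      ∫ u in ang θ ℓ φ (2 * (i + 1))..ang θ ℓ φ (2 * (i + 1) + 1),
        (kernel θ ℓ φ f (u * Complex.I)).re := by
    intro i
    by_cases hi : i < ℓ
    · refine ⟨moment _ _ _ (intervalIntegrable_kernel_one H
        (H.lt (i := 2 * (i + 1)) (j := 2 * (i + 1) + 1) (by omega) (by omega) (by omega))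
        (Ioo_gap_subset H (by omega) (by omega))), fun _ f => ?_⟩
      simp only [kernel_re_eq_mul f]
      rfl
    · exact ⟨0, fun h => absurd h hi⟩
  choose Λ hΛ using h
  refine ⟨Λ, hΛ, fun f hdeg hf => ?_⟩
  have h : ∀ i, ∃ u : ℝ, i < ℓ → u ∈ Set.Ioo (gapLo θ ℓ φ (i + 1)) (ang θ ℓ φ (2 * (i + 1) + 1)) ∧
      f.eval (2 * Real.cos u) = 0 := by
    intro i
    by_cases hi : i < ℓ
    · have h1 := hf i hi
      rw [hΛ i hi f] at h1
      have e : gapLo θ ℓ φ (i + 1) = ang θ ℓ φ (2 * (i + 1)) := by simp [gapLo]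
      rw [← e] at h1
      obtain ⟨u, hu⟩ := exists_root_of_integral_eq_zero H (gapLo_lt H (i := i + 1) (by omega))
        (Ioo_gapLo_subset H (by omega)) h1
      exact ⟨u, fun _ => hu⟩
    · exact ⟨0, fun h => absurd h hi⟩
  choose u hu using h
  refine eq_zero_of_roots hdeg (u := u) (fun i hi => gap_point_mem H (i := i + 1) (by omega)
    (hu i hi).1) (fun i j hij hj => ne_of_lt ?_) fun i hi => (hu i hi).2
  have := gap_points H (u := fun k => u (k - 1)) (i := i + 1) (j := j + 1) (by omega) (by omega)
    (by simpa using (hu i (by omega)).1) (by simpa using (hu j hj).1)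
  simpa using this

theorem existsUnique_isCoeffP (H : Admissible θ ℓ φ) : ∃! B : Fin (ℓ + 2) → ℝ, IsCoeffP θ ℓ φ B := by
  obtain ⟨Λ, hΛ, hinj⟩ := exists_gapFunctional H
  have h := existsUnique_coeff (n := ℓ + 1) (by omega) hinj (fun j => if (j : ℕ) = 0 then 1 else
    -(∑ j ∈ Finset.Icc 1 (2 * ℓ - 1), Real.cos (θ j)) - Real.cos φ)
  have hℓ := H.one_le
  have hiff : ∀ B : Fin (ℓ + 2) → ℝ, IsCoeffP θ ℓ φ B ↔
      ((∀ j : Fin (ℓ + 2), (j : ℕ) + ℓ ≤ ℓ + 1 → B j = (if (j : ℕ) = 0 then 1 else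
        -(∑ j ∈ Finset.Icc 1 (2 * ℓ - 1), Real.cos (θ j)) - Real.cos φ)) ∧
      ∀ i < ℓ, Λ i (symPoly (ℓ + 1) B) = 0) := by
    intro B
    constructor
    · intro hB
      refine ⟨fun j hj => ?_, fun i hi => ?_⟩
      · rcases (by omega : (j : ℕ) = 0 ∨ (j : ℕ) = 1) with h | h
        · rw [if_pos h, show j = 0 from Fin.ext h, hB.zero]
        · rw [if_neg (by omega), show j = 1 from Fin.ext (by simpa using h), hB.one]
      · rw [hΛ i hi]
        exact (hB.normalized H).gaps (i + 1) (Finset.mem_Icc.2 ⟨by omega, by omega⟩)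
    · rintro ⟨h1, h2⟩
      refine ⟨by simpa using h1 0 (by simp), by simpa using h1 1 (by simp [add_comm]), ?_⟩
      refine (gapIntegralsVanish_iff H (logCoeff_P B)).2 fun j hj => ?_
      rw [Finset.mem_Icc] at hj
      have h3 := h2 (j - 1) (by omega)
      rwa [hΛ (j - 1) (by omega), Nat.sub_add_cancel hj.1] at h3
  simpa only [hiff] using h

theorem existsUnique_isCoeffQ (H : Admissible θ ℓ φ) : ∃! C : Fin (ℓ + 3) → ℝ, IsCoeffQ θ ℓ φ C := by
  obtain ⟨Λ, hΛ, hinj⟩ := exists_gapFunctional H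
  set c₁ := -(∑ j ∈ Finset.Icc 1 (2 * ℓ - 1), Real.cos (θ j)) - Real.cos φ with hc₁
  set c₂ := 1 / 8 *
    ((∑ j ∈ Finset.Icc 1 (2 * ℓ - 1), 2 * Real.cos (θ j)) ^ 2
      - 2 * (∑ j ∈ Finset.Icc 1 (2 * ℓ - 1), 2 * Real.cos (2 * θ j)) + 2
      + 2 * (2 * Real.cos φ) * (∑ j ∈ Finset.Icc 1 (2 * ℓ - 1), 2 * Real.cos (θ j))
      - 2 * Real.cos (2 * φ)) with hc₂
  have h := existsUnique_coeff (n := ℓ + 2) (by omega) hinj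
    (fun j => if (j : ℕ) = 0 then 1 else if (j : ℕ) = 1 then c₁ else c₂)
  have hℓ := H.one_le
  have hiff : ∀ C : Fin (ℓ + 3) → ℝ, IsCoeffQ θ ℓ φ C ↔
      ((∀ j : Fin (ℓ + 3), (j : ℕ) + ℓ ≤ ℓ + 2 →
        C j = (if (j : ℕ) = 0 then 1 else if (j : ℕ) = 1 then c₁ else c₂)) ∧
      ∀ i < ℓ, Λ i (symPoly (ℓ + 2) C) = 0) := by
    intro C
    have hv2 : ((2 : Fin (ℓ + 3)) : ℕ) = 2 := rfl
    constructor
    · intro hC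
      refine ⟨fun j hj => ?_, fun i hi => ?_⟩
      · rcases (by omega : (j : ℕ) = 0 ∨ (j : ℕ) = 1 ∨ (j : ℕ) = 2) with h | h | h
        · rw [if_pos h, show j = 0 from Fin.ext h, hC.zero]
        · rw [if_neg (by omega), if_pos h, show j = 1 from Fin.ext (by simpa using h), hC.one]
        · rw [if_neg (by omega), if_neg (by omega), show j = 2 from Fin.ext (by rw [h, hv2]), hC.two]
      · rw [hΛ i hi]
        exact (hC.normalized H).gaps (i + 1) (Finset.mem_Icc.2 ⟨by omega, by omega⟩)
    · rintro ⟨h1, h2⟩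
      refine ⟨by simpa using h1 0 (by simp), by simpa using h1 1 (by simp; omega), ?_, ?_⟩
      · have := h1 2 (by rw [hv2]; omega)
        rwa [hv2, if_neg (by norm_num), if_neg (by norm_num)] at this
      refine (gapIntegralsVanish_iff H (logCoeff_Q C)).2 fun j hj => ?_
      rw [Finset.mem_Icc] at hj
      have h3 := h2 (j - 1) (by omega)
      rwa [hΛ (j - 1) (by omega), Nat.sub_add_cancel hj.1] at h3
  simpa only [hiff] using h

end DarkGas
end

/-! ### The contour integrals as values of the primitive. -/

noncomputable section
namespace DarkGas

variable {θ : ℕ → ℝ} {ℓ : ℕ} {φ : ℝ}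

theorem intervalIntegrable_abs_sub_rpow (c : ℝ) :
    IntervalIntegrable (fun ρ : ℝ => |ρ - 1| ^ (-(1 / 2) : ℝ)) MeasureTheory.volume 1 c := by
  rcases le_total 1 c with h | h
  · have h1 := (intervalIntegral.intervalIntegrable_rpow' (r := (-(1 / 2) : ℝ)) (a := 0) (b := c - 1)
      (by norm_num)).comp_sub_right 1
    rw [zero_add, sub_add_cancel] at h1
    refine h1.congr fun ρ hρ => ?_
    rw [Set.uIoc_of_le h] at hρ
    simp only [abs_of_pos (sub_pos.2 hρ.1)]
  · have h1 := (intervalIntegral.intervalIntegrable_rpow' (r := (-(1 / 2) : ℝ)) (a := 0) (b := 1 - c)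
      (by norm_num)).comp_sub_left 1
    rw [sub_zero, sub_sub_cancel] at h1
    refine h1.congr fun ρ hρ => ?_
    rw [Set.uIoc_of_ge h] at hρ
    simp only [abs_sub_comm ρ 1, abs_of_nonneg (sub_nonneg.2 hρ.2)]

theorem half_abs_sub_le_abs_log {ρ : ℝ} (h1 : 1 / 2 < ρ) (h2 : ρ < 2) :
    |ρ - 1| / 2 ≤ |Real.log ρ| := by
  have hρ : 0 < ρ := by linarith
  rcases le_total 1 ρ with h | h
  · rw [abs_of_nonneg (by linarith), abs_of_nonneg (Real.log_nonneg h)]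
    have h3 := Real.one_sub_inv_le_log_of_pos hρ
    have h4 : (ρ - 1) / 2 ≤ 1 - ρ⁻¹ := by
      rw [show 1 - ρ⁻¹ = (ρ - 1) / ρ by field_simp]
      gcongr
    linarith
  · rw [abs_of_nonpos (by linarith), abs_of_nonpos (Real.log_nonpos hρ.le h)]
    have h3 := Real.log_le_sub_one_of_pos hρ
    linarith

theorem tendsto_log_add_mul_I (a : ℝ) :
    Tendsto (fun ρ : ℝ => (Real.log ρ + a * Complex.I : ℂ)) (𝓝 1) (𝓝 (a * Complex.I)) := by
  have h : ContinuousAt (fun ρ : ℝ => (Real.log ρ + a * Complex.I : ℂ)) 1 := by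
    have := Real.continuousAt_log (one_ne_zero : (1 : ℝ) ≠ 0)
    fun_prop
  simpa using h.tendsto

theorem hasDerivAt_log_add_mul_I (a : ℝ) {ρ : ℝ} (hρ : 0 < ρ) :
    HasDerivAt (fun ρ : ℝ => (Real.log ρ + a * Complex.I : ℂ)) (ρ⁻¹ : ℝ) ρ :=
  ((Real.hasDerivAt_log hρ.ne').ofReal_comp).add_const _

theorem log_add_mem_logDomain (a : ℝ) {ρ : ℝ} (hρ : 0 < ρ) (h1 : ρ ≠ 1) :
    (Real.log ρ + a * Complex.I : ℂ) ∈ logDomain θ := by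
  left
  have : (Real.log ρ + a * Complex.I : ℂ).re = Real.log ρ := by simp
  rw [this]
  exact Real.log_ne_zero_of_pos_of_ne_one hρ h1

theorem continuousAt_radial_kernel (H : Admissible θ ℓ φ) (f : Polynomial ℝ) (a : ℝ) {ρ : ℝ}
    (hρ : 0 < ρ) (h1 : ρ ≠ 1) : ContinuousAt
      (fun ρ : ℝ => kernel θ ℓ φ f (Real.log ρ + a * Complex.I) * (ρ⁻¹ : ℝ)) ρ := by
  refine ContinuousAt.mul ?_ ?_
  · exact ContinuousAt.comp (g := kernel θ ℓ φ f)
      (differentiableAt_kernel H f (log_add_mem_logDomain a hρ h1)).continuousAt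
      (hasDerivAt_log_add_mul_I a hρ).continuousAt
  · exact (Complex.continuous_ofReal.continuousAt).comp (continuousAt_inv₀ hρ.ne')

/-- The radius may start at a branch point; there `kernel_bound` dominates the integrand by a
multiple of `|ρ - 1|^{-1/2}`. -/
theorem intervalIntegrable_radial_kernel (H : Admissible θ ℓ φ) (f : Polynomial ℝ) (a : ℝ) {s : ℝ}
    (hs : 0 < s) (hs1 : s ≠ 1) : IntervalIntegrable
      (fun ρ : ℝ => kernel θ ℓ φ f (Real.log ρ + a * Complex.I) * (ρ⁻¹ : ℝ))
      MeasureTheory.volume 1 s := by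
  obtain ⟨M, hM, hb⟩ := kernel_bound H f a
  obtain ⟨δ, hδ, hball⟩ := Metric.eventually_nhds_iff.1 ((tendsto_log_add_mul_I a).eventually hb)
  -- Within `η` of `1` the kernel bound applies, `|log ρ| ≥ |ρ - 1| / 2` and `ρ⁻¹ ≤ 2`; `η ≤ |s -
  -- 1|` places the splitting point `c` between `1` and `s`. From `c` on the integrand is
  -- continuous.
  set η := min (δ / 2) (min (1 / 4) (|s - 1|)) with hη
  have hs' : 0 < |s - 1| := abs_pos.2 (sub_ne_zero.2 hs1)
  have hη0 : 0 < η := lt_min (by linarith) (lt_min (by norm_num) hs')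
  have hη1 : η ≤ δ / 2 := min_le_left _ _
  have hη2 : η ≤ 1 / 4 := (min_le_right _ _).trans (min_le_left _ _)
  have hη3 : η ≤ |s - 1| := (min_le_right _ _).trans (min_le_right _ _)
  obtain ⟨c, hc1, hcη, hcs⟩ : ∃ c : ℝ, c ≠ 1 ∧ |c - 1| ≤ η ∧
      ((1 < c ∧ c ≤ s) ∨ (s ≤ c ∧ c < 1)) := by
    rcases lt_or_gt_of_ne hs1 with h | h
    · rw [abs_of_neg (by linarith)] at hη3
      exact ⟨1 - η, by linarith, by rw [abs_of_nonpos] <;> linarith,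
        Or.inr ⟨by linarith, by linarith⟩⟩
    · rw [abs_of_pos (by linarith)] at hη3
      exact ⟨1 + η, by linarith, by rw [abs_of_nonneg] <;> linarith,
        Or.inl ⟨by linarith, by linarith⟩⟩
  have hsub : ∀ ρ ∈ Set.uIoc 1 c, |ρ - 1| ≤ η := by
    intro ρ hρ
    rw [abs_le] at hcη ⊢
    rcases hcs with ⟨h, -⟩ | ⟨-, h⟩
    · rw [Set.uIoc_of_le h.le] at hρ
      constructor <;> linarith [hρ.1, hρ.2]
    · rw [Set.uIoc_of_ge h.le] at hρ
      constructor <;> linarith [hρ.1, hρ.2]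
  have hcont : ContinuousOn
      (fun ρ : ℝ => kernel θ ℓ φ f (Real.log ρ + a * Complex.I) * (ρ⁻¹ : ℝ))
      (Set.uIoc 1 c \ {1}) := by
    intro ρ hρ
    have h1 := abs_le.1 (hsub ρ hρ.1)
    exact (continuousAt_radial_kernel H f a (by linarith) hρ.2).continuousWithinAt
  refine IntervalIntegrable.trans (b := c) ?_ ?_
  · refine IntervalIntegrable.mono_fun' ((intervalIntegrable_abs_sub_rpow c).const_mul (4 * M)) ?_ ?_
    · have h1 := hcont.aestronglyMeasurable (μ := MeasureTheory.volume)
        (measurableSet_uIoc.diff (measurableSet_singleton 1))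
      have h2 : MeasureTheory.volume.restrict (Set.uIoc 1 c \ {1}) =
          MeasureTheory.volume.restrict (Set.uIoc 1 c) :=
        MeasureTheory.Measure.restrict_congr_set
          (MeasureTheory.sdiff_null_ae_eq_self Real.volume_singleton)
      rwa [h2] at h1
    · have h0 : ∀ᵐ ρ ∂(MeasureTheory.volume.restrict (Set.uIoc 1 c)), ρ ≠ (1 : ℝ) :=
        MeasureTheory.ae_restrict_of_ae (MeasureTheory.Measure.ae_ne _ 1)
      filter_upwards [MeasureTheory.ae_restrict_mem measurableSet_uIoc, h0] with ρ hρ hρ1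
      have h1 := hsub ρ hρ
      have h2 := abs_le.1 h1
      have hρ0 : 0 < ρ := by linarith
      have h3 := hball (y := ρ) (by rw [Real.dist_eq]; linarith)
      rw [add_sub_cancel_right, Complex.norm_real, Real.norm_eq_abs] at h3
      have h4 := half_abs_sub_le_abs_log (ρ := ρ) (by linarith) (by linarith)
      have h5 : 0 < |ρ - 1| := abs_pos.2 (sub_ne_zero.2 hρ1)
      have h6 : |ρ - 1| ^ (-(1 / 2) : ℝ) = (Real.sqrt |ρ - 1|)⁻¹ := by
        rw [Real.rpow_neg h5.le, Real.sqrt_eq_rpow]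
      rw [h6, norm_mul, Complex.norm_real, Real.norm_eq_abs, abs_inv, abs_of_pos hρ0]
      have h7 : ρ⁻¹ ≤ 2 := by
        rw [inv_le_comm₀ hρ0 two_pos]; linarith
      set κ := ‖kernel θ ℓ φ f (Real.log ρ + a * Complex.I)‖ with hκ
      have h8 : κ ≤ 2 * M * (Real.sqrt |ρ - 1|)⁻¹ := by
        rw [← div_eq_mul_inv, le_div_iff₀ (Real.sqrt_pos.2 h5)]
        refine abs_le_of_sq_le_sq' ?_ (by positivity) |>.2
        rw [mul_pow, Real.sq_sqrt h5.le]
        nlinarith [sq_nonneg κ]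
      calc κ * ρ⁻¹ ≤ (2 * M * (Real.sqrt |ρ - 1|)⁻¹) * 2 := by gcongr
        _ = _ := by ring
  · refine ContinuousOn.intervalIntegrable fun ρ hρ => ContinuousAt.continuousWithinAt ?_
    refine continuousAt_radial_kernel H f a ?_ ?_
    · rcases hcs with ⟨h, h'⟩ | ⟨h', h⟩
      · rw [Set.uIcc_of_le h'] at hρ; linarith [hρ.1]
      · rw [Set.uIcc_of_ge h'] at hρ; linarith [hρ.1]
    · rcases hcs with ⟨h, h'⟩ | ⟨h', h⟩
      · rw [Set.uIcc_of_le h'] at hρ; linarith [hρ.1]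
      · rw [Set.uIcc_of_ge h'] at hρ; linarith [hρ.2]

theorem radialIntegral_eq_kernel {F : ℂ → ℂ} {f : Polynomial ℝ}
    (hF : ∀ z ≠ 0, z * F z = logCoeff θ ℓ φ f z) (a : ℝ) {s : ℝ} (hs : 0 < s) :
    radialIntegral F a 1 s =
      ∫ ρ in (1 : ℝ)..s, kernel θ ℓ φ f (Real.log ρ + a * Complex.I) * (ρ⁻¹ : ℝ) := by
  unfold radialIntegral
  refine intervalIntegral.integral_congr fun ρ hρ => ?_
  have hρ0 : 0 < ρ := lt_of_lt_of_le (lt_min one_pos hs) hρ.1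
  have h : Complex.exp (Real.log ρ + a * Complex.I) = ρ * cis a := by
    rw [Complex.exp_add, ← Complex.ofReal_exp, Real.exp_log hρ0, cis]
  have hρ' : (ρ : ℂ) ≠ 0 := Complex.ofReal_ne_zero.2 hρ0.ne'
  simp only [kernel_eq_logCoeff, h]
  rw [← hF _ (mul_ne_zero hρ' (cis_ne_zero a)), Complex.ofReal_inv]
  field_simp

theorem radialIntegral_outside (H : Admissible θ ℓ φ) {F : ℂ → ℂ} {f : Polynomial ℝ}
    (hF : ∀ z ≠ 0, z * F z = logCoeff θ ℓ φ f z) (a : ℝ) {s : ℝ} (hs : 1 < s) :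
    radialIntegral F a 1 s = prim θ ℓ φ f (Real.log s + a * Complex.I) - bdry θ ℓ φ f a := by
  have hs0 : 0 < s := by linarith
  rw [radialIntegral_eq_kernel hF a hs0]
  refine intervalIntegral.integral_eq_sub_of_hasDerivAt_of_tendsto hs
    (f := fun ρ : ℝ => prim θ ℓ φ f (Real.log ρ + a * Complex.I)) (fun ρ hρ => ?_)
    (intervalIntegrable_radial_kernel H f a hs0 hs.ne') ?_ ?_
  · have hρ0 : 0 < ρ := by linarith [hρ.1]
    exact (hasDerivAt_prim H f (log_add_mem_logDomain a hρ0 hρ.1.ne')).comp ρ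
      (hasDerivAt_log_add_mul_I a hρ0)
  · refine (tendsto_prim_right H f a).comp (tendsto_nhdsWithin_iff.2
      ⟨(tendsto_log_add_mul_I a).mono_left nhdsWithin_le_nhds, ?_⟩)
    filter_upwards [self_mem_nhdsWithin] with ρ hρ
    have : 0 < Real.log ρ := Real.log_pos hρ
    simpa [rightHalf, ← Complex.ofReal_log (zero_le_one.trans hρ.le)] using this
  · have h1 := (hasDerivAt_prim H f (log_add_mem_logDomain (θ := θ) a hs0 hs.ne')).comp s
      (hasDerivAt_log_add_mul_I a hs0)
    exact h1.continuousAt.tendsto.mono_left nhdsWithin_le_nhds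

theorem tendsto_prim_left (H : Admissible θ ℓ φ) (f : Polynomial ℝ) (t : ℝ) :
    Tendsto (prim θ ℓ φ f) (𝓝[leftHalf] (t * Complex.I : ℂ))
      (𝓝 (-(starRingEnd ℂ) (bdry θ ℓ φ f t))) :=
  tendsto_of_isBigO_rpow (by norm_num) nhdsWithin_le_nhds
    (isBigO_left_of_right H f (isBigO_prim_right H f (-t)))

theorem radialIntegral_inside (H : Admissible θ ℓ φ) {F : ℂ → ℂ} {f : Polynomial ℝ}
    (hF : ∀ z ≠ 0, z * F z = logCoeff θ ℓ φ f z) (a : ℝ) {s : ℝ} (hs0 : 0 < s) (hs : s < 1) :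
    radialIntegral F a 1 s =
      prim θ ℓ φ f (Real.log s + a * Complex.I) + (starRingEnd ℂ) (bdry θ ℓ φ f a) := by
  rw [radialIntegral_eq_kernel hF a hs0, intervalIntegral.integral_symm]
  have := intervalIntegral.integral_eq_sub_of_hasDerivAt_of_tendsto hs
    (f := fun ρ : ℝ => prim θ ℓ φ f (Real.log ρ + a * Complex.I))
    (f' := fun ρ : ℝ => kernel θ ℓ φ f (Real.log ρ + a * Complex.I) * (ρ⁻¹ : ℝ))
    (fa := prim θ ℓ φ f (Real.log s + a * Complex.I))
    (fb := -(starRingEnd ℂ) (bdry θ ℓ φ f a)) (fun ρ hρ => ?_)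
    (intervalIntegrable_radial_kernel H f a hs0 hs.ne).symm ?_ ?_
  · rw [this]; ring
  · have hρ0 : 0 < ρ := by linarith [hρ.1]
    exact (hasDerivAt_prim H f (log_add_mem_logDomain a hρ0 hρ.2.ne)).comp ρ
      (hasDerivAt_log_add_mul_I a hρ0)
  · have h1 := (hasDerivAt_prim H f (log_add_mem_logDomain (θ := θ) a hs0 hs.ne)).comp s
      (hasDerivAt_log_add_mul_I a hs0)
    exact h1.continuousAt.tendsto.mono_left nhdsWithin_le_nhds
  · refine (tendsto_prim_left H f a).comp (tendsto_nhdsWithin_iff.2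
      ⟨(tendsto_log_add_mul_I a).mono_left nhdsWithin_le_nhds, ?_⟩)
    filter_upwards [Ioo_mem_nhdsLT zero_lt_one] with ρ hρ
    have : Real.log ρ < 0 := Real.log_neg hρ.1 hρ.2
    simpa [leftHalf, ← Complex.ofReal_log hρ.1.le] using this

theorem arcIntegral_eq_prim (H : Admissible θ ℓ φ) {F : ℂ → ℂ} {f : Polynomial ℝ}
    (hF : ∀ z ≠ 0, z * F z = logCoeff θ ℓ φ f z) {r : ℝ} (hr : 0 < r) (hr1 : r ≠ 1) (a b : ℝ) :
    arcIntegral F r a b = prim θ ℓ φ f (Real.log r + b * Complex.I) -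
      prim θ ℓ φ f (Real.log r + a * Complex.I) := by
  rw [arcIntegral_eq_kernel hF hr]
  exact (prim_sub_eq_integral H f (Real.log_ne_zero_of_pos_of_ne_one hr hr1) a b).2

/-- The values of `prim` on the circle of radius `2` cancel, and `b(θ₁) = 0` removes the start of
the path. -/
theorem outerPeriod_eq (H : Admissible θ ℓ φ) {F : ℂ → ℂ} {f : Polynomial ℝ} {a b : ℂ}
    (hF : ∀ z ≠ 0, z * F z = logCoeff θ ℓ φ f z) (hf : Normalized θ ℓ φ f a b) (k : ℕ) :
    outerPeriod θ ℓ φ F k = 2 * bdry θ ℓ φ f (ang θ ℓ φ (2 * k)) := by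
  have h : radialIntegral F (ang θ ℓ φ (2 * k)) 2 1 = -radialIntegral F (ang θ ℓ φ (2 * k)) 1 2 :=
    intervalIntegral.integral_symm _ _
  rw [outerPeriod, h, radialIntegral_outside H hF _ one_lt_two,
    radialIntegral_outside H hF _ one_lt_two, arcIntegral_eq_prim H hF two_pos (by norm_num),
    bdry_theta_one H hf]
  ring

theorem abs_arg_lt_of_mem_slitDomain (H : Admissible θ ℓ φ) {z : ℂ} (hz : z ∈ slitDomain θ)
    (h1 : ‖z‖ = 1) : |z.arg| < θ 1 := by
  have hc : z = cis z.arg := by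
    have := Complex.norm_mul_exp_arg_mul_I z
    rw [h1, Complex.ofReal_one, one_mul] at this
    exact this.symm
  have h2 := Complex.neg_pi_lt_arg z
  have h3 := Complex.arg_le_pi z
  have h4 := H.theta_lt_pi
  have h5 := H.theta_pos
  by_contra hcon
  rw [not_lt, le_abs] at hcon
  apply hz.2
  rcases hcon with h | h
  · exact ⟨z.arg, ⟨h, by linarith⟩, hc.symm⟩
  · refine ⟨z.arg + 2 * Real.pi, ⟨by linarith, by linarith⟩, ?_⟩
    rw [cis]
    push_cast
    rw [add_mul, Complex.exp_periodic]
    exact hc.symm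

theorem log_mem_logDomain (H : Admissible θ ℓ φ) {z : ℂ} (hz : z ∈ slitDomain θ) :
    Complex.log z ∈ logDomain θ := by
  by_cases h1 : ‖z‖ = 1
  · right
    rw [Complex.log_im]
    exact abs_arg_lt_of_mem_slitDomain H hz h1
  · left
    rw [Complex.log_re]
    exact Real.log_ne_zero_of_pos_of_ne_one (norm_pos_iff.2 hz.1) h1

/-- Off the circle the two legs telescope and leave only a boundary term at `θ₁`, which is zero. On
the circle the radial leg is trivial, and the arc from `θ₁` stays in the central gap, where `prim`
is given by its boundary values and is purely imaginary. -/
theorem abelIntegral_eq (H : Admissible θ ℓ φ) {F : ℂ → ℂ} {f : Polynomial ℝ} {a b : ℂ}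
    (hF : ∀ z ≠ 0, z * F z = logCoeff θ ℓ φ f z) (hf : Normalized θ ℓ φ f a b) {z : ℂ}
    (hz : z ∈ slitDomain θ) : abelIntegral θ F z = prim θ ℓ φ f (Complex.log z) := by
  have hz0 : 0 < ‖z‖ := norm_pos_iff.2 hz.1
  have hlog : (Real.log ‖z‖ + z.arg * Complex.I : ℂ) = Complex.log z := rfl
  rw [abelIntegral]
  rcases lt_trichotomy ‖z‖ 1 with h | h | h
  · rw [radialIntegral_inside H hF _ hz0 h, arcIntegral_eq_prim H hF hz0 h.ne, hlog,
      bdry_theta_one H hf]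
    simp
  · have h1 := abs_arg_lt_of_mem_slitDomain H hz h
    have h2 := abs_lt.1 h1
    have hsub : Set.Ioo z.arg (θ 1) ⊆ gapSet θ ℓ φ := fun u hu =>
      Ioo_central_subset H ⟨by linarith [hu.1], hu.2⟩
    rw [← hlog, h, Real.log_one, Complex.ofReal_zero, zero_add, ← bdry_eq_prim H f h1,
      arcIntegral_eq_kernel hF one_pos, intervalIntegral.integral_symm,
      intervalIntegral.integral_mul_const]
    simp only [Real.log_one, Complex.ofReal_zero, zero_add]
    rw [integral_kernel_ofReal H f h2.2 hsub, integral_kernel_eq H f h2.2 hsub,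
      bdry_theta_one H hf, radialIntegral, intervalIntegral.integral_same]
    refine Complex.ext ?_ ?_
    · simp [bdry_central_re H f ⟨h2.1.le, h2.2.le⟩]
    · simp
  · rw [radialIntegral_outside H hF _ h, arcIntegral_eq_prim H hF hz0 h.ne', hlog,
      bdry_theta_one H hf]
    ring

end DarkGas
end

/-! ### Transport from the logarithmic coordinate to the `z`-plane. -/

noncomputable section
namespace DarkGas

variable {θ : ℕ → ℝ} {ℓ : ℕ} {φ : ℝ}

/-- The branch of the logarithm near `e^{it}` with the value `it` there. -/
def branchLog (t : ℝ) (z : ℂ) : ℂ := Complex.log (z * cis (-t)) + t * Complex.I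

theorem exp_branchLog (t : ℝ) {z : ℂ} (hz : z ≠ 0) : Complex.exp (branchLog t z) = z := by
  rw [branchLog, Complex.exp_add, Complex.exp_log (mul_ne_zero hz (cis_ne_zero _)), exp_I_mul,
    mul_assoc, ← cis_inv, inv_mul_cancel₀ (cis_ne_zero t), mul_one]

theorem branchLog_re (t : ℝ) (z : ℂ) : (branchLog t z).re = Real.log ‖z‖ := by
  simp [branchLog, Complex.log_re, norm_cis]

theorem branchLog_cis (t : ℝ) : branchLog t (cis t) = t * Complex.I := by
  rw [branchLog, ← cis_inv, mul_inv_cancel₀ (cis_ne_zero t), Complex.log_one, zero_add]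

theorem differentiableAt_branchLog (t : ℝ) : DifferentiableAt ℂ (branchLog t) (cis t) := by
  unfold branchLog
  refine DifferentiableAt.add_const _ (DifferentiableAt.clog (by fun_prop) ?_)
  rw [← cis_inv, mul_inv_cancel₀ (cis_ne_zero t)]
  exact Complex.one_mem_slitPlane

theorem tendsto_branchLog (t : ℝ) : Tendsto (branchLog t) (𝓝 (cis t)) (𝓝 (t * Complex.I)) := by
  have := (differentiableAt_branchLog t).continuousAt.tendsto
  rwa [branchLog_cis] at this

theorem tendsto_branchLog_outside (t : ℝ) :
    Tendsto (branchLog t) (𝓝[outside] (cis t)) (𝓝[rightHalf] (t * Complex.I)) := by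
  refine tendsto_nhdsWithin_iff.2 ⟨(tendsto_branchLog t).mono_left nhdsWithin_le_nhds, ?_⟩
  filter_upwards [self_mem_nhdsWithin] with z hz
  have h : 0 < (branchLog t z).re := by
    rw [branchLog_re]
    exact Real.log_pos hz
  exact h

theorem tendsto_branchLog_inside (t : ℝ) :
    Tendsto (branchLog t) (𝓝[inside] (cis t)) (𝓝[leftHalf] (t * Complex.I)) := by
  refine tendsto_nhdsWithin_iff.2 ⟨(tendsto_branchLog t).mono_left nhdsWithin_le_nhds, ?_⟩
  filter_upwards [self_mem_nhdsWithin,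
    mem_nhdsWithin_of_mem_nhds (isOpen_ne.mem_nhds (cis_ne_zero t))] with z hz hz0
  have h : (branchLog t z).re < 0 := by
    rw [branchLog_re]
    exact Real.log_neg (norm_pos_iff.2 hz0) hz
  exact h

theorem isBigO_branchLog_rpow (t : ℝ) {p : ℝ} (hp : 0 ≤ p) :
    (fun z => ‖branchLog t z - t * Complex.I‖ ^ p) =O[𝓝 (cis t)] fun z => ‖z - cis t‖ ^ p := by
  have h := (differentiableAt_branchLog t).isBigO_sub
  rw [branchLog_cis] at h
  exact h.norm_norm.rpow hp (Eventually.of_forall fun z => norm_nonneg _)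

/-- The primitive `prim` as a function of `z = e^w`. -/
def primLog (θ : ℕ → ℝ) (ℓ : ℕ) (φ : ℝ) (f : Polynomial ℝ) (z : ℂ) : ℂ :=
  prim θ ℓ φ f (Complex.log z)

/-- Periodicity makes the choice of logarithm immaterial off the circle, so the cut of the principal
logarithm leaves no trace and each boundary point may use the branch adapted to it. -/
theorem primLog_eq_branch (H : Admissible θ ℓ φ) {f : Polynomial ℝ} {a b : ℂ}
    (hf : Normalized θ ℓ φ f a b) (t : ℝ) {z : ℂ} (hz : z ≠ 0) (h1 : ‖z‖ ≠ 1) :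
    primLog θ ℓ φ f z = prim θ ℓ φ f (branchLog t z) := by
  refine prim_eq_of_exp_eq H hf.principal ?_ (by rw [Complex.exp_log hz, exp_branchLog t hz])
  rw [branchLog_re]
  exact Real.log_ne_zero_of_pos_of_ne_one (norm_pos_iff.2 hz) h1

theorem isBigO_primLog_outside (H : Admissible θ ℓ φ) {f : Polynomial ℝ} {a b : ℂ}
    (hf : Normalized θ ℓ φ f a b) {t p : ℝ} (hp : 0 ≤ p) {L : ℂ}
    (h : (fun w => prim θ ℓ φ f w - L) =O[𝓝[rightHalf] (t * Complex.I : ℂ)]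
      fun w => ‖w - t * Complex.I‖ ^ p) :
    (fun z => primLog θ ℓ φ f z - L) =O[𝓝[outside] (cis t)] fun z => ‖z - cis t‖ ^ p := by
  refine ((h.comp_tendsto (tendsto_branchLog_outside t)).trans
    ((isBigO_branchLog_rpow t hp).mono nhdsWithin_le_nhds)).congr' ?_ EventuallyEq.rfl
  filter_upwards [self_mem_nhdsWithin] with z hz
  have hz' : 1 < ‖z‖ := hz
  simp only [Function.comp]
  rw [primLog_eq_branch H hf t (norm_pos_iff.1 (by linarith)) hz'.ne']

theorem isBigO_primLog_inside (H : Admissible θ ℓ φ) {f : Polynomial ℝ} {a b : ℂ}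
    (hf : Normalized θ ℓ φ f a b) {t p : ℝ} (hp : 0 ≤ p) {L : ℂ}
    (h : (fun w => prim θ ℓ φ f w - L) =O[𝓝[leftHalf] (t * Complex.I : ℂ)]
      fun w => ‖w - t * Complex.I‖ ^ p) :
    (fun z => primLog θ ℓ φ f z - L) =O[𝓝[inside] (cis t)] fun z => ‖z - cis t‖ ^ p := by
  refine ((h.comp_tendsto (tendsto_branchLog_inside t)).trans
    ((isBigO_branchLog_rpow t hp).mono nhdsWithin_le_nhds)).congr' ?_ EventuallyEq.rfl
  filter_upwards [self_mem_nhdsWithin,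
    mem_nhdsWithin_of_mem_nhds (isOpen_ne.mem_nhds (cis_ne_zero t))] with z hz hz0
  have hz' : ‖z‖ < 1 := hz
  simp only [Function.comp]
  rw [primLog_eq_branch H hf t hz0 hz'.ne]

theorem tendsto_primLog_outside (H : Admissible θ ℓ φ) {f : Polynomial ℝ} {a b : ℂ}
    (hf : Normalized θ ℓ φ f a b) (t : ℝ) :
    Tendsto (primLog θ ℓ φ f) (𝓝[outside] (cis t)) (𝓝 (bdry θ ℓ φ f t)) :=
  tendsto_of_isBigO_rpow (by norm_num) nhdsWithin_le_nhds
    (isBigO_primLog_outside H hf (by norm_num) (isBigO_prim_right H f t))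

theorem tendsto_primLog_inside (H : Admissible θ ℓ φ) {f : Polynomial ℝ} {a b : ℂ}
    (hf : Normalized θ ℓ φ f a b) (t : ℝ) :
    Tendsto (primLog θ ℓ φ f) (𝓝[inside] (cis t)) (𝓝 (-(starRingEnd ℂ) (bdry θ ℓ φ f t))) :=
  tendsto_of_isBigO_rpow (by norm_num) nhdsWithin_le_nhds
    (isBigO_primLog_inside H hf (by norm_num)
      (isBigO_left_of_right H f (isBigO_prim_right H f (-t))))

theorem continuous_cis : Continuous cis := by unfold cis; fun_prop

theorem isClosed_cut (θ : ℕ → ℝ) : IsClosed (cut θ) :=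
  (isCompact_Icc.image continuous_cis).isClosed

theorem isOpen_slitDomain (θ : ℕ → ℝ) : IsOpen (slitDomain θ) :=
  isOpen_ne.inter (isClosed_cut θ).isOpen_compl

theorem norm_eq_one_of_mem_cut {z : ℂ} (hz : z ∈ cut θ) : ‖z‖ = 1 := by
  obtain ⟨t, -, rfl⟩ := hz
  exact norm_cis t

theorem mem_slitPlane_of_mem_slitDomain (H : Admissible θ ℓ φ) {z : ℂ} (hz : z ∈ slitDomain θ)
    (h1 : ‖z‖ = 1) : z ∈ Complex.slitPlane := by
  rw [Complex.mem_slitPlane_iff_arg]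
  refine ⟨fun h => ?_, hz.1⟩
  have h2 := abs_arg_lt_of_mem_slitDomain H hz h1
  rw [h, abs_of_pos Real.pi_pos] at h2
  exact absurd h2 (not_lt.2 H.theta_lt_pi.le)

/-- On the circle the slit domain stays away from `-1`, so the principal logarithm is analytic
there. Off the circle the branch centred at `arg z` is used, for which `z` is not on the cut. -/
theorem hasDerivAt_primLog (H : Admissible θ ℓ φ) {f : Polynomial ℝ} {a b : ℂ}
    (hf : Normalized θ ℓ φ f a b) {z : ℂ} (hz : z ∈ slitDomain θ) :
    HasDerivAt (primLog θ ℓ φ f) (logCoeff θ ℓ φ f z / z) z := by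
  by_cases h1 : ‖z‖ = 1
  · have h2 := (hasDerivAt_prim H f (log_mem_logDomain H hz)).comp z
      (Complex.hasDerivAt_log (mem_slitPlane_of_mem_slitDomain H hz h1))
    rw [kernel_eq_logCoeff, Complex.exp_log hz.1] at h2
    exact h2
  · have hz0 : 0 < ‖z‖ := norm_pos_iff.2 hz.1
    have hcis : z * cis (-z.arg) = ‖z‖ := by
      have e := Complex.norm_mul_exp_arg_mul_I z
      rw [exp_I_mul] at e
      rw [← cis_inv, mul_inv_eq_iff_eq_mul₀ (cis_ne_zero _), e]
    have h2 : HasDerivAt (branchLog z.arg) (cis (-z.arg) / (z * cis (-z.arg))) z := by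
      have h3 : HasDerivAt (fun v : ℂ => v * cis (-z.arg)) (1 * cis (-z.arg)) z :=
        (hasDerivAt_id z).mul_const _
      rw [one_mul] at h3
      exact (h3.clog (by rw [hcis]; exact Or.inl (by simpa using hz0))).add_const _
    have h4 : branchLog z.arg z ∈ logDomain θ := by
      left
      rw [branchLog_re]
      exact Real.log_ne_zero_of_pos_of_ne_one hz0 h1
    have h5 := (hasDerivAt_prim H f h4).comp z h2
    rw [kernel_eq_logCoeff, exp_branchLog _ hz.1] at h5
    have h6 : cis (-z.arg) / (z * cis (-z.arg)) = z⁻¹ := by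
      rw [mul_comm z, div_mul_eq_div_div, div_self (cis_ne_zero _), one_div]
    rw [h6] at h5
    refine h5.congr_of_eventuallyEq ?_
    filter_upwards [isOpen_ne.mem_nhds hz.1,
      (isOpen_ne_fun continuous_norm continuous_const).mem_nhds h1] with v hv hv1
    exact primLog_eq_branch H hf z.arg hv hv1

theorem isBigO_primLog_slit (H : Admissible θ ℓ φ) {f : Polynomial ℝ} {a b : ℂ}
    (hf : Normalized θ ℓ φ f a b) : (primLog θ ℓ φ f) =O[𝓝[slitDomain θ] (cis (θ 1))]
      fun z => ‖z - cis (θ 1)‖ ^ (1 / 2 : ℝ) := by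
  have h := isBigO_prim_slit H f
  rw [bdry_theta_one H hf] at h
  have hlog : Complex.log (cis (θ 1)) = θ 1 * Complex.I := by
    rw [cis, Complex.log_exp]
    · simpa using by linarith [H.theta_pos, Real.pi_pos]
    · simpa using H.theta_lt_pi.le
  have hslit : cis (θ 1) ∈ Complex.slitPlane := by
    rw [Complex.mem_slitPlane_iff_arg, ← Complex.log_im, hlog]
    refine ⟨by simpa using H.theta_lt_pi.ne, cis_ne_zero _⟩
  have hd : DifferentiableAt ℂ Complex.log (cis (θ 1)) := Complex.differentiableAt_log hslit
  have ht : Tendsto Complex.log (𝓝[slitDomain θ] (cis (θ 1))) (𝓝[logDomain θ] (θ 1 * Complex.I)) := by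
    refine tendsto_nhdsWithin_iff.2 ⟨?_, ?_⟩
    · rw [← hlog]
      exact hd.continuousAt.tendsto.mono_left nhdsWithin_le_nhds
    · filter_upwards [self_mem_nhdsWithin] with z hz using log_mem_logDomain H hz
  have hO : (fun z => ‖Complex.log z - θ 1 * Complex.I‖ ^ (1 / 2 : ℝ)) =O[𝓝 (cis (θ 1))]
      fun z => ‖z - cis (θ 1)‖ ^ (1 / 2 : ℝ) := by
    have h := hd.isBigO_sub
    rw [hlog] at h
    exact h.norm_norm.rpow (by norm_num) (Eventually.of_forall fun z => norm_nonneg _)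
  refine ((h.comp_tendsto ht).trans (hO.mono nhdsWithin_le_nhds)).congr_left fun z => ?_
  simp [primLog]

theorem primLog_inv (H : Admissible θ ℓ φ) {f : Polynomial ℝ} {a b : ℂ}
    (hf : Normalized θ ℓ φ f a b) {z : ℂ} (hz : z ∈ slitDomain θ) :
    primLog θ ℓ φ f z⁻¹ = -primLog θ ℓ φ f z := by
  rw [primLog, primLog, ← prim_neg H f (log_mem_logDomain H hz)]
  by_cases h1 : ‖z‖ = 1
  · rw [Complex.log_inv]
    exact (Complex.mem_slitPlane_iff_arg.1 (mem_slitPlane_of_mem_slitDomain H hz h1)).1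
  · refine prim_eq_of_exp_eq H hf.principal ?_ ?_
    · rw [Complex.neg_re, Complex.log_re, neg_ne_zero]
      exact Real.log_ne_zero_of_pos_of_ne_one (norm_pos_iff.2 hz.1) h1
    · rw [Complex.exp_log (inv_ne_zero hz.1), Complex.exp_neg, Complex.exp_log hz.1]

theorem inv_mem_slitDomain {z : ℂ} (hz : z ∈ slitDomain θ) : z⁻¹ ∈ slitDomain θ := by
  refine ⟨inv_ne_zero hz.1, ?_⟩
  rintro ⟨t, ht, h⟩
  apply hz.2
  refine ⟨2 * Real.pi - t, ⟨by linarith [ht.2], by linarith [ht.1]⟩, ?_⟩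
  rw [← inv_inv z, ← h, cis_inv]
  rw [cis, cis, Complex.exp_eq_exp_iff_exists_int]
  exact ⟨1, by push_cast; ring⟩

theorem isBigO_primLog_slit_inv (H : Admissible θ ℓ φ) {f : Polynomial ℝ} {a b : ℂ}
    (hf : Normalized θ ℓ φ f a b) : (primLog θ ℓ φ f) =O[𝓝[slitDomain θ] (cis (θ 1))⁻¹]
      fun z => ‖z - (cis (θ 1))⁻¹‖ ^ (1 / 2 : ℝ) := by
  have hne : (cis (θ 1))⁻¹ ≠ 0 := inv_ne_zero (cis_ne_zero _)
  have hd : DifferentiableAt ℂ (fun z : ℂ => z⁻¹) (cis (θ 1))⁻¹ := differentiableAt_inv hne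
  have ht : Tendsto (fun z : ℂ => z⁻¹) (𝓝[slitDomain θ] (cis (θ 1))⁻¹)
      (𝓝[slitDomain θ] (cis (θ 1))) := by
    refine tendsto_nhdsWithin_iff.2 ⟨?_, ?_⟩
    · have := hd.continuousAt.tendsto.mono_left (nhdsWithin_le_nhds (s := slitDomain θ))
      rwa [inv_inv] at this
    · filter_upwards [self_mem_nhdsWithin] with z hz using inv_mem_slitDomain hz
  have hO : (fun z : ℂ => ‖z⁻¹ - cis (θ 1)‖ ^ (1 / 2 : ℝ)) =O[𝓝 (cis (θ 1))⁻¹]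
      fun z => ‖z - (cis (θ 1))⁻¹‖ ^ (1 / 2 : ℝ) := by
    have h := hd.isBigO_sub
    rw [inv_inv] at h
    exact h.norm_norm.rpow (by norm_num) (Eventually.of_forall fun z => norm_nonneg _)
  refine (((isBigO_primLog_slit H hf).comp_tendsto ht).trans
    (hO.mono nhdsWithin_le_nhds)).neg_left.congr' ?_ EventuallyEq.rfl
  filter_upwards [self_mem_nhdsWithin] with z hz
  simp only [Function.comp]
  rw [primLog_inv H hf hz, neg_neg]

theorem primLog_comb (H : Admissible θ ℓ φ) (f g : Polynomial ℝ) (c : ℝ) {z : ℂ}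
    (hz : z ∈ slitDomain θ) : primLog θ ℓ φ (Polynomial.C c * f - g) z =
      c * primLog θ ℓ φ f z - primLog θ ℓ φ g z :=
  prim_comb H f g c (log_mem_logDomain H hz)

theorem bdry_comb (H : Admissible θ ℓ φ) (f g : Polynomial ℝ) (c t : ℝ) :
    bdry θ ℓ φ (Polynomial.C c * f - g) t = c * bdry θ ℓ φ f t - bdry θ ℓ φ g t := by
  apply bdry_eq_of_tendsto
  refine (((tendsto_prim_right H f t).const_mul (c : ℂ)).sub (tendsto_prim_right H g t)).congr' ?_
  filter_upwards [self_mem_nhdsWithin] with w hw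
  rw [prim_comb H f g c (rightHalf_subset hw)]

theorem integralsWellDefined (H : Admissible θ ℓ φ) {B : Fin (ℓ + 2) → ℝ} {C : Fin (ℓ + 3) → ℝ}
    (hB : IsCoeffP θ ℓ φ B) (hC : IsCoeffQ θ ℓ φ C) : IntegralsWellDefined θ ℓ φ B C := by
  have key : ∀ {F : ℂ → ℂ} {f : Polynomial ℝ} {a b : ℂ}
      (_ : ∀ z ≠ 0, z * F z = logCoeff θ ℓ φ f z) (_ : Normalized θ ℓ φ f a b),
      (∀ z ∈ slitDomain θ, HasDerivAt (abelIntegral θ F) (F z) z) ∧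
      Tendsto (abelIntegral θ F) (𝓝[slitDomain θ] cis (θ 1)) (𝓝 0) := by
    intro F f a b hF hf
    refine ⟨fun z hz => ?_, ?_⟩
    · have h := hasDerivAt_primLog H hf hz
      rw [← hF z hz.1, mul_div_cancel_left₀ _ hz.1] at h
      refine h.congr_of_eventuallyEq ?_
      filter_upwards [(isOpen_slitDomain θ).mem_nhds hz] with v hv
      exact abelIntegral_eq H hF hf hv
    · have h : Tendsto (primLog θ ℓ φ f) (𝓝[slitDomain θ] cis (θ 1)) (𝓝 0) :=
        tendsto_of_isBigO_rpow (p := 1 / 2) (by norm_num) nhdsWithin_le_nhds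
          (by simpa using isBigO_primLog_slit H hf)
      refine h.congr' ?_
      filter_upwards [self_mem_nhdsWithin] with v hv
      exact (abelIntegral_eq H hF hf hv).symm
  have hP := key (logCoeff_P B) (hB.normalized H)
  have hQ := key (logCoeff_Q C) (hC.normalized H)
  exact ⟨hP.1, hQ.1, hP.2, hQ.2⟩

end DarkGas
end

/-! ### Properties of the `g`-function. -/

noncomputable section
namespace DarkGas

variable {θ : ℕ → ℝ} {ℓ : ℕ} {φ : ℝ}

theorem outside_subset_slitDomain : outside ⊆ slitDomain θ := fun z hz => by
  have h1 : 1 < ‖z‖ := hz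
  exact ⟨norm_pos_iff.1 (by linarith), fun hc => h1.ne' (norm_eq_one_of_mem_cut hc)⟩

theorem mem_slitDomain_of_norm_lt {z : ℂ} (h0 : z ≠ 0) (h1 : ‖z‖ < 1) : z ∈ slitDomain θ :=
  ⟨h0, fun hc => h1.ne (norm_eq_one_of_mem_cut hc)⟩

theorem eventually_mem_slitDomain_inside (t : ℝ) :
    ∀ᶠ z in 𝓝[inside] (cis t), z ∈ slitDomain θ := by
  filter_upwards [self_mem_nhdsWithin,
    mem_nhdsWithin_of_mem_nhds (isOpen_ne.mem_nhds (cis_ne_zero t))] with z hz hz0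
  exact mem_slitDomain_of_norm_lt hz0 hz

theorem hasDerivAt_phase (ξ : ℝ) {z : ℂ} (hz : z ≠ 0) :
    HasDerivAt (Phase ξ 1) (ξ * (1 + (z ^ 2)⁻¹) - (2 * z + 2 * (z ^ 3)⁻¹)) z := by
  have h1 : HasDerivAt (fun z : ℂ => z - z⁻¹) (1 - -(z ^ 2)⁻¹) z :=
    (hasDerivAt_id z).sub (hasDerivAt_inv hz)
  have h2 : HasDerivAt (fun z : ℂ => z ^ 2 - (z ^ 2)⁻¹)
      (2 * z - -(2 * z) / (z ^ 2) ^ 2) z := by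
    have h3 : HasDerivAt (fun z : ℂ => z ^ 2) (2 * z) z := by simpa using hasDerivAt_pow 2 z
    exact h3.sub (h3.inv (pow_ne_zero 2 hz))
  have h := (h1.const_mul (ξ : ℂ)).sub (h2.const_mul ((1 : ℝ) : ℂ))
  refine h.congr_deriv ?_
  push_cast
  field_simp
  ring

theorem phase_inv (ξ t : ℝ) (z : ℂ) : Phase ξ t z⁻¹ = -Phase ξ t z := by
  simp only [Phase, inv_inv, inv_pow]
  ring

/-- Data of a function of the form `prim ∘ log - Φ / 2` in the slit domain, with its constants. -/
structure IsGFunction (θ : ℕ → ℝ) (ℓ : ℕ) (φ ξ : ℝ) (h : Polynomial ℝ) (Ω : ℕ → ℂ)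
    (G : ℂ → ℂ) : Prop where
  normalized : Normalized θ ℓ φ h (ξ / 2) (-1)
  root : h.eval (2 * Real.cos φ) = 0
  eq : ∀ z ∈ slitDomain θ, G z = primLog θ ℓ φ h z - Phase ξ 1 z / 2
  const_zero : Ω 0 = 0
  const : ∀ k, 1 ≤ k → Ω k = 2 * bdry θ ℓ φ h (ang θ ℓ φ (2 * k))

namespace IsGFunction

variable {ξ : ℝ} {h : Polynomial ℝ} {Ω : ℕ → ℂ} {G : ℂ → ℂ}

theorem hasDerivAt (H : Admissible θ ℓ φ) (hG : IsGFunction θ ℓ φ ξ h Ω G) {z : ℂ}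
    (hz : z ∈ slitDomain θ) : HasDerivAt G (logCoeff θ ℓ φ h z / z -
      (ξ * (1 + (z ^ 2)⁻¹) - (2 * z + 2 * (z ^ 3)⁻¹)) / 2) z := by
  refine ((hasDerivAt_primLog H hG.normalized hz).sub
    ((hasDerivAt_phase ξ hz.1).div_const 2)).congr_of_eventuallyEq ?_
  filter_upwards [(isOpen_slitDomain θ).mem_nhds hz] with v hv using hG.eq v hv

theorem symmetry (H : Admissible θ ℓ φ) (hG : IsGFunction θ ℓ φ ξ h Ω G) {z : ℂ}
    (hz : z ∈ slitDomain θ) : G z + G z⁻¹ = 0 := by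
  rw [hG.eq z hz, hG.eq _ (inv_mem_slitDomain hz), primLog_inv H hG.normalized hz, phase_inv]
  ring

theorem punctured_ball_eq : Metric.ball (0 : ℂ) 1 \ {0} = Complex.exp '' leftHalf := by
  ext z
  constructor
  · rintro ⟨h1, h0⟩
    have h0' : z ≠ 0 := h0
    refine ⟨Complex.log z, ?_, Complex.exp_log h0'⟩
    have : (Complex.log z).re < 0 := by
      rw [Complex.log_re]
      exact Real.log_neg (norm_pos_iff.2 h0') (by simpa using h1)
    exact this
  · rintro ⟨w, hw, rfl⟩
    have hw' : w.re < 0 := hw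
    exact ⟨by simpa [Complex.norm_exp] using hw', Complex.exp_ne_zero w⟩

theorem isPreconnected_punctured_ball : IsPreconnected (Metric.ball (0 : ℂ) 1 \ {0}) := by
  rw [punctured_ball_eq]
  exact (convex_halfSpace_re_lt 0).isPreconnected.image _ Complex.continuous_exp.continuousOn

/-- The principal part of the differential at `0` is that of `dΦ/2`, so `z G'(z) → 0` and the
singularity of `G'` is removable. A primitive of the extended derivative differs from `G` by a
constant, because the punctured disc is connected. -/
theorem exists_extension (H : Admissible θ ℓ φ) (hG : IsGFunction θ ℓ φ ξ h Ω G) :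
    ∃ e : ℂ → ℂ, DifferentiableOn ℂ e (Metric.ball 0 1) ∧
      ∀ z ∈ Metric.ball (0 : ℂ) 1 \ {0}, G z = e z := by
  set D : ℂ → ℂ := fun z => logCoeff θ ℓ φ h z / z -
      (ξ * (1 + (z ^ 2)⁻¹) - (2 * z + 2 * (z ^ 3)⁻¹)) / 2 with hD
  have hopen : IsOpen (Metric.ball (0 : ℂ) 1 \ {0}) :=
    Metric.isOpen_ball.sdiff isClosed_singleton
  have hslit : ∀ z ∈ Metric.ball (0 : ℂ) 1 \ {0}, z ∈ slitDomain θ := fun z hz =>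
    mem_slitDomain_of_norm_lt hz.2 (by simpa using hz.1)
  have hGd : DifferentiableOn ℂ G (Metric.ball (0 : ℂ) 1 \ {0}) := fun z hz =>
    (hG.hasDerivAt H (hslit z hz)).differentiableAt.differentiableWithinAt
  have hDd : DifferentiableOn ℂ D (Metric.ball (0 : ℂ) 1 \ {0}) :=
    (hGd.deriv hopen).congr fun z hz => ((hG.hasDerivAt H (hslit z hz)).deriv).symm
  -- `D 0` is the default value that division by zero assigns and carries no meaning; the removable
  -- singularity criterion subtracts it, and the factor `z` makes it harmless.
  have hlim : Tendsto (fun z => z * (D z - D 0)) (𝓝[≠] 0) (𝓝 0) := by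
    have hcont : Tendsto (fun z : ℂ => -(ξ * z / 2) + z ^ 2 - z * D 0) (𝓝[≠] 0) (𝓝 0) := by
      have : Continuous fun z : ℂ => -(ξ * z / 2) + z ^ 2 - z * D 0 := by fun_prop
      simpa using (this.tendsto 0).mono_left (nhdsWithin_le_nhds (s := {0}ᶜ))
    have h1 := hG.normalized.principal.add hcont
    rw [add_zero] at h1
    refine h1.congr' ?_
    filter_upwards [self_mem_nhdsWithin] with z hz
    have hz' : z ≠ 0 := hz
    generalize D 0 = d
    simp only [hD]
    field_simp
    ring
  have ho : (fun z => D z - D 0) =o[𝓝[≠] 0] fun z => (z - 0)⁻¹ := by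
    rw [isLittleO_iff_tendsto']
    · refine hlim.congr fun z => ?_
      rw [sub_zero, div_inv_eq_mul, mul_comm]
    · filter_upwards [self_mem_nhdsWithin] with z hz h0
      exact absurd (inv_eq_zero.1 h0) (by simpa using hz)
  have hupd := Complex.differentiableOn_update_limUnder_of_isLittleO
    (Metric.ball_mem_nhds (0 : ℂ) one_pos) hDd ho
  obtain ⟨E, hE⟩ := hupd.isExactOn_ball
  have hEG : ∀ z ∈ Metric.ball (0 : ℂ) 1 \ {0}, HasDerivAt (fun z => G z - E z) 0 z := by
    intro z hz
    have h2 := (hG.hasDerivAt H (hslit z hz)).sub (hE z hz.1)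
    rw [Function.update_of_ne hz.2] at h2
    exact h2.congr_deriv (sub_self _)
  obtain ⟨c, hc⟩ := hopen.exists_is_const_of_deriv_eq_zero isPreconnected_punctured_ball
    (fun z hz => (hEG z hz).differentiableAt.differentiableWithinAt)
    (fun z hz => (hEG z hz).deriv)
  refine ⟨fun z => E z + c, fun z hz =>
    ((hE z hz).differentiableAt.add_const c).differentiableWithinAt, fun z hz => ?_⟩
  have := hc z hz
  simp only [← this]
  ring

theorem analytic_asymptotics (H : Admissible θ ℓ φ) (hG : IsGFunction θ ℓ φ ξ h Ω G) :
    ∃ ginf g1 : ℂ, AnalyticOnNhd ℂ (Function.update G 0 (-ginf)) (cut θ)ᶜ ∧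
      ((fun z => G z - (ginf + g1 / z)) =O[Bornology.cobounded ℂ] fun z => (z ^ 2)⁻¹) ∧
      ((fun z => G z - -ginf) =O[𝓝[≠] 0] fun z => z) := by
  obtain ⟨e, he, heq⟩ := hG.exists_extension H
  have hball : Metric.ball (0 : ℂ) 1 ∈ 𝓝 0 := Metric.ball_mem_nhds 0 one_pos
  have he0 : DifferentiableAt ℂ e 0 := he.differentiableAt hball
  -- Outside the unit disc `G(z) = -e(1/z)` by the symmetry, so the Taylor coefficients of `e` at
  -- `0`, with a minus sign, are the constants at infinity.
  refine ⟨-e 0, -deriv e 0, ?_, ?_, ?_⟩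
  · rw [neg_neg]
    refine DifferentiableOn.analyticOnNhd (fun z hz => ?_) (isClosed_cut θ).isOpen_compl
    refine DifferentiableAt.differentiableWithinAt ?_
    by_cases h0 : z = 0
    · subst h0
      refine he0.congr_of_eventuallyEq ?_
      filter_upwards [hball] with v hv
      by_cases hv0 : v = 0
      · subst hv0; simp
      · rw [Function.update_of_ne hv0, heq v ⟨hv, hv0⟩]
    · refine (hG.hasDerivAt H ⟨h0, hz⟩).differentiableAt.congr_of_eventuallyEq ?_
      filter_upwards [isOpen_ne.mem_nhds h0] with v hv
      rw [Function.update_of_ne hv]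
  · have h1 : DifferentiableAt ℂ (dslope e 0) 0 :=
      ((Complex.differentiableOn_dslope hball).2 he).differentiableAt hball
    have h2 : (fun w => e w - (e 0 + w * deriv e 0)) =O[𝓝 0] fun w => w ^ 2 := by
      have h3 := (isBigO_refl (fun w : ℂ => w) (𝓝 0)).mul h1.isBigO_sub
      refine h3.congr (fun w => ?_) fun w => by ring
      have h4 := sub_smul_dslope e 0 w
      rw [smul_eq_mul, sub_zero] at h4
      rw [mul_sub, h4, dslope_same]
      ring
    have h5 := (h2.comp_tendsto tendsto_inv₀_cobounded).neg_left
    refine h5.congr' ?_ ?_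
    · filter_upwards [tendsto_norm_cobounded_atTop.eventually_gt_atTop 1] with z hz1
      have hz0 : z ≠ 0 := norm_pos_iff.1 (by linarith)
      have h6 := hG.symmetry H (outside_subset_slitDomain (θ := θ) hz1)
      have h7 : z⁻¹ ∈ Metric.ball (0 : ℂ) 1 \ {0} :=
        ⟨by simpa using inv_lt_one_of_one_lt₀ hz1, inv_ne_zero hz0⟩
      rw [heq _ h7] at h6
      simp only [Function.comp]
      rw [eq_neg_of_add_eq_zero_left h6]
      ring
    · filter_upwards with z
      simp
  · refine (he0.isBigO_sub.mono nhdsWithin_le_nhds).congr' ?_ ?_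
    · filter_upwards [self_mem_nhdsWithin, mem_nhdsWithin_of_mem_nhds hball] with z hz hz1
      rw [heq z ⟨hz1, hz⟩, neg_neg]
    · filter_upwards with z
      simp

theorem boundaryValues (H : Admissible θ ℓ φ) (hG : IsGFunction θ ℓ φ ξ h Ω G) (t : ℝ) :
    BoundaryValues G (cis t) (bdry θ ℓ φ h t - Phase ξ 1 (cis t) / 2)
      (-(starRingEnd ℂ) (bdry θ ℓ φ h t) - Phase ξ 1 (cis t) / 2) := by
  have hph : Tendsto (fun z => Phase ξ 1 z / 2) (𝓝 (cis t)) (𝓝 (Phase ξ 1 (cis t) / 2)) :=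
    ((hasDerivAt_phase ξ (cis_ne_zero t)).div_const 2).continuousAt.tendsto
  constructor
  · refine ((tendsto_primLog_outside H hG.normalized t).sub
      (hph.mono_left nhdsWithin_le_nhds)).congr' ?_
    filter_upwards [self_mem_nhdsWithin] with z hz
    exact (hG.eq z (outside_subset_slitDomain hz)).symm
  · refine ((tendsto_primLog_inside H hG.normalized t).sub
      (hph.mono_left nhdsWithin_le_nhds)).congr' ?_
    filter_upwards [eventually_mem_slitDomain_inside t] with z hz
    exact (hG.eq z hz).symm

theorem bdry_im_band (H : Admissible θ ℓ φ) (hG : IsGFunction θ ℓ φ ξ h Ω G) {j : ℕ}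
    (hj : 1 ≤ j) (hj' : j ≤ ℓ) {t : ℝ}
    (ht : t ∈ Set.Ioo (ang θ ℓ φ (2 * j - 1)) (ang θ ℓ φ (2 * j))) :
    (bdry θ ℓ φ h t).im = 0 := by
  have hlt : ang θ ℓ φ (2 * j - 1) < ang θ ℓ φ (2 * j) := H.lt (by omega) (by omega) (by omega)
  rw [bdry_im_eq_of_band H h hlt (Ioo_band_subset hj hj') ⟨ht.1.le, ht.2.le⟩
    (Set.right_mem_Icc.2 hlt.le)]
  exact bdry_ang_im H hG.normalized (by omega) (by omega)

theorem bdry_re_gap (H : Admissible θ ℓ φ) (hG : IsGFunction θ ℓ φ ξ h Ω G) {j : ℕ}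
    (hj : 1 ≤ j) (hj' : j ≤ ℓ) {t : ℝ}
    (ht : t ∈ Set.Icc (ang θ ℓ φ (2 * j)) (ang θ ℓ φ (2 * j + 1))) :
    ((2 * (bdry θ ℓ φ h t).re : ℝ) : ℂ) = Ω j := by
  have hlt : ang θ ℓ φ (2 * j) < ang θ ℓ φ (2 * j + 1) := H.lt (by omega) (by omega) (by omega)
  rw [bdry_re_eq_of_gap H h hlt (Ioo_gap_subset H hj hj') ht (Set.left_mem_Icc.2 hlt.le),
    hG.const j hj]
  have him := bdry_ang_im H hG.normalized (k := 2 * j) (by omega) (by omega)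
  apply Complex.ext
  · simp
  · simp [him]

theorem jump_band (H : Admissible θ ℓ φ) (hG : IsGFunction θ ℓ φ ξ h Ω G) {j : ℕ}
    (hj : 1 ≤ j) (hj' : j ≤ ℓ) {z : ℂ} (hz : z ∈ band θ ℓ φ j ∪ bandConj θ ℓ φ j) :
    ∃ hp hm : ℂ, BoundaryValues G z hp hm ∧ hp + hm = -(Phase ξ 1 z) := by
  have key : ∃ t, cis t = z ∧ (bdry θ ℓ φ h t).im = 0 := by
    rcases hz with ⟨t, ht, rfl⟩ | ⟨t, ht, rfl⟩
    · exact ⟨t, rfl, hG.bdry_im_band H hj hj' ht⟩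
    · refine ⟨t, rfl, ?_⟩
      have h1 := hG.bdry_im_band H hj hj' (t := -t) ⟨by linarith [ht.2], by linarith [ht.1]⟩
      rw [bdry_neg H] at h1
      simpa using h1
  obtain ⟨t, rfl, him⟩ := key
  refine ⟨_, _, hG.boundaryValues H t, ?_⟩
  rw [Complex.conj_eq_iff_im.2 him]
  ring

theorem jump_gap (H : Admissible θ ℓ φ) (hG : IsGFunction θ ℓ φ ξ h Ω G) {j : ℕ}
    (hj : 1 ≤ j) (hj' : j ≤ ℓ) {z : ℂ} (hz : z ∈ gap θ ℓ φ j ∪ gapConj θ ℓ φ j) :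
    ∃ hp hm : ℂ, BoundaryValues G z hp hm ∧ hp - hm = Ω j := by
  have key : ∃ t, cis t = z ∧ ((2 * (bdry θ ℓ φ h t).re : ℝ) : ℂ) = Ω j := by
    rcases hz with ⟨t, ht, rfl⟩ | ⟨t, ht, rfl⟩
    · exact ⟨t, rfl, hG.bdry_re_gap H hj hj' ht⟩
    · refine ⟨t, rfl, ?_⟩
      have h1 := hG.bdry_re_gap H hj hj' (t := -t) ⟨by linarith [ht.2], by linarith [ht.1]⟩
      rw [bdry_neg H, Complex.conj_re] at h1
      exact h1
  obtain ⟨t, rfl, hre⟩ := key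
  refine ⟨_, _, hG.boundaryValues H t, ?_⟩
  rw [← hre, ← Complex.add_conj]
  ring

/-- The estimate is required at all `s` with the same cosine, since `w` may be `e^{it}` or its
inverse and the interior estimate at `s` comes from the exterior one at `-s`. Reality of `b(t)`
makes the constants inside and outside opposite. -/
theorem localBehaviour (H : Admissible θ ℓ φ) (hG : IsGFunction θ ℓ φ ξ h Ω G) {t p : ℝ}
    (hp : 0 ≤ p) {c : ℂ} (hc : c = 2 * bdry θ ℓ φ h t) (him : (bdry θ ℓ φ h t).im = 0)
    (hO : ∀ s : ℝ, Real.cos s = Real.cos t →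
      (fun w => prim θ ℓ φ h w - bdry θ ℓ φ h s) =O[𝓝[rightHalf] (s * Complex.I : ℂ)]
        fun w => ‖w - s * Complex.I‖ ^ p) {w : ℂ} (hw : w = cis t ∨ w = (cis t)⁻¹) :
    LocalBehaviour G ξ c w p := by
  have key : ∃ s, w = cis s ∧ Real.cos s = Real.cos t ∧ bdry θ ℓ φ h s = bdry θ ℓ φ h t := by
    rcases hw with rfl | rfl
    · exact ⟨t, rfl, rfl, rfl⟩
    · refine ⟨-t, cis_inv t, Real.cos_neg t, ?_⟩
      rw [bdry_neg H, Complex.conj_eq_iff_im.2 him]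
  obtain ⟨s, rfl, hcos, hs⟩ := key
  have hc2 : c / 2 = bdry θ ℓ φ h s := by rw [hc, hs]; ring
  have hout := isBigO_primLog_outside H hG.normalized hp (hO s hcos)
  have hin := isBigO_primLog_inside H hG.normalized hp
    (isBigO_left_of_right H h (hO (-s) (by rw [Real.cos_neg, hcos])))
  rw [hs, Complex.conj_eq_iff_im.2 him, ← hs, ← hc2] at hin
  rw [← hc2] at hout
  constructor
  · refine hout.congr' ?_ EventuallyEq.rfl
    filter_upwards [self_mem_nhdsWithin] with z hz
    rw [hG.eq z (outside_subset_slitDomain hz)]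
    ring
  · refine hin.congr' ?_ EventuallyEq.rfl
    filter_upwards [eventually_mem_slitDomain_inside s] with z hz
    rw [hG.eq z hz]
    ring

/-- Both ends of a gap share one constant because `Re b` is constant on the gap and `Im b` vanishes
at its ends. For `j = 1` both sides are zero. -/
theorem const_half (H : Admissible θ ℓ φ) (hG : IsGFunction θ ℓ φ ξ h Ω G) {j : ℕ}
    (hj : 1 ≤ j) (hj' : j < 2 * ℓ) : Ω (j / 2) = 2 * bdry θ ℓ φ h (ang θ ℓ φ j) := by
  obtain ⟨k, rfl | rfl⟩ := Nat.even_or_odd' j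
  · rw [Nat.mul_div_cancel_left k two_pos, hG.const k (by omega)]
  · rw [show (2 * k + 1) / 2 = k by omega]
    rcases Nat.eq_zero_or_pos k with rfl | hk
    · rw [hG.const_zero, mul_zero, zero_add, H.ang_one, bdry_theta_one H hG.normalized, mul_zero]
    · have hlt : ang θ ℓ φ (2 * k) < ang θ ℓ φ (2 * k + 1) :=
        H.lt (by omega) (by omega) (by omega)
      rw [← hG.bdry_re_gap H hk (by omega) (Set.right_mem_Icc.2 hlt.le)]
      have him := bdry_ang_im H hG.normalized (k := 2 * k + 1) (by omega) (by omega)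
      apply Complex.ext
      · simp
      · simp [him]

theorem local_first (H : Admissible θ ℓ φ) (hG : IsGFunction θ ℓ φ ξ h Ω G) {w : ℂ}
    (hw : w = cis (θ 1) ∨ w = (cis (θ 1))⁻¹) :
    (fun z => G z - -(Phase ξ 1 z) / 2) =O[𝓝[slitDomain θ] w]
      fun z => ‖z - w‖ ^ (1 / 2 : ℝ) := by
  have key : (primLog θ ℓ φ h) =O[𝓝[slitDomain θ] w] fun z => ‖z - w‖ ^ (1 / 2 : ℝ) := by
    rcases hw with rfl | rfl
    · exact isBigO_primLog_slit H hG.normalized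
    · exact isBigO_primLog_slit_inv H hG.normalized
  refine key.congr' ?_ EventuallyEq.rfl
  filter_upwards [self_mem_nhdsWithin] with z hz
  rw [hG.eq z hz]
  ring

theorem gProperties (H : Admissible θ ℓ φ) (hG : IsGFunction θ ℓ φ ξ h Ω G) :
    GProperties θ ℓ φ ξ Ω G where
  analytic_asymptotics := hG.analytic_asymptotics H
  jump_band j hj _ hz := by
    rw [Finset.mem_Icc] at hj
    exact hG.jump_band H hj.1 hj.2 hz
  jump_gap j hj _ hz := by
    rw [Finset.mem_Icc] at hj
    exact hG.jump_gap H hj.1 hj.2 hz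
  local_first _ hw := hG.local_first H hw
  local_eta j hj w hw := by
    rw [Finset.mem_Icc] at hj
    have hl := H.one_le
    have hlt : j < 2 * ℓ := by omega
    rw [← ang_of_lt (θ := θ) (φ := φ) hlt] at hw
    exact hG.localBehaviour H (by norm_num) (hG.const_half H hj.1 hlt)
      (bdry_ang_im H hG.normalized hj.1 (by omega)) (fun s _ => isBigO_prim_right H h s) hw
  local_alpha w hw := by
    have hl := H.one_le
    have h1 := hG.const ℓ hl
    have h2 := bdry_ang_im H hG.normalized (k := 2 * ℓ) (by omega) (by omega)
    rw [ang_two_mul] at h1 h2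
    refine hG.localBehaviour H (by norm_num) h1 h2 (fun s hs => ?_) hw
    exact isBigO_prim_right_of_root H h (by rw [hs]; exact hG.root)
  symmetry _ hz := hG.symmetry H hz

end IsGFunction

theorem isGFunction_g (H : Admissible θ ℓ φ) {B : Fin (ℓ + 2) → ℝ} {C : Fin (ℓ + 3) → ℝ}
    (hB : IsCoeffP θ ℓ φ B) (hC : IsCoeffQ θ ℓ φ C) {ξ : ℝ}
    (hroot : (Polynomial.C (ξ / 2) * symPoly (ℓ + 1) B - symPoly (ℓ + 2) C).eval
      (2 * Real.cos φ) = 0) :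
    IsGFunction θ ℓ φ ξ (Polynomial.C (ξ / 2) * symPoly (ℓ + 1) B - symPoly (ℓ + 2) C)
      (Om θ ℓ φ B C ξ) (g θ ℓ φ B C ξ) where
  normalized := by
    have h := Normalized.comb H (hB.normalized H) (hC.normalized H) (ξ / 2)
    simpa using h
  root := hroot
  eq z hz := by
    rw [primLog_comb H _ _ _ hz, g, phi1, phi2, abelIntegral_eq H (logCoeff_P B)
      (hB.normalized H) hz, abelIntegral_eq H (logCoeff_Q C) (hC.normalized H) hz, primLog, primLog]
    push_cast
    ring
  const_zero := by simp [Om]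
  const k hk := by
    rw [Om, if_neg (by omega), outerPeriod_eq H (logCoeff_P B) (hB.normalized H),
      outerPeriod_eq H (logCoeff_Q C) (hC.normalized H), bdry_comb H]
    push_cast
    ring

end DarkGas
end

/-! ### Gap functionals as functions of the moving endpoint. -/

noncomputable section
namespace DarkGas

variable {θ : ℕ → ℝ} {ℓ : ℕ} {φ : ℝ}

/-- `f ↦ ∫ f(2 cos u) k(u) (2 cos u - 2 cos φ)^r du` as a linear functional, `0` unless the weight
is integrable. -/
def shiftMoment (k : ℝ → ℝ) (s t r φ : ℝ) : Polynomial ℝ →ₗ[ℝ] ℝ :=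
  open Classical in
  if h : IntervalIntegrable (fun u => k u * (2 * Real.cos u - 2 * Real.cos φ) ^ r)
    MeasureTheory.volume s t then moment _ s t h else 0

theorem cos_sub_cos_pos {s t u φ : ℝ} (hs : 0 ≤ s) (hφ : φ < Real.pi) (ht : t < φ)
    (hu : u ∈ Set.Icc s t) : 0 < 2 * Real.cos u - 2 * Real.cos φ := by
  have := Real.cos_lt_cos_of_nonneg_of_le_pi (hs.trans hu.1) hφ.le (hu.2.trans_lt ht)
  linarith

theorem continuousOn_shift_rpow {s t φ : ℝ} (hs : 0 ≤ s) (hφ : φ < Real.pi) (ht : t < φ) (r : ℝ) :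
    ContinuousOn (fun u => (2 * Real.cos u - 2 * Real.cos φ) ^ r) (Set.Icc s t) := by
  refine ContinuousOn.rpow_const (by fun_prop) fun u hu => Or.inl ?_
  exact (cos_sub_cos_pos hs hφ ht hu).ne'

theorem intervalIntegrable_shift {k : ℝ → ℝ} {s t φ : ℝ} (hs : 0 ≤ s) (hst : s ≤ t)
    (hφ : φ < Real.pi) (ht : t < φ) (hk : IntervalIntegrable k MeasureTheory.volume s t) (r : ℝ) :
    IntervalIntegrable (fun u => k u * (2 * Real.cos u - 2 * Real.cos φ) ^ r)
      MeasureTheory.volume s t :=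
  hk.mul_continuousOn (by
    rw [Set.uIcc_of_le hst]
    exact continuousOn_shift_rpow hs hφ ht r)

theorem shiftMoment_apply {k : ℝ → ℝ} {s t φ : ℝ} (hs : 0 ≤ s) (hst : s ≤ t)
    (hφ : φ < Real.pi) (ht : t < φ) (hk : IntervalIntegrable k MeasureTheory.volume s t) (r : ℝ)
    (f : Polynomial ℝ) : shiftMoment k s t r φ f = ∫ u in s..t,
      f.eval (2 * Real.cos u) * (k u * (2 * Real.cos u - 2 * Real.cos φ) ^ r) := by
  rw [shiftMoment, dif_pos (intervalIntegrable_shift hs hst hφ ht hk r)]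
  rfl

theorem intervalIntegrable_eval_shift {k : ℝ → ℝ} {s t φ : ℝ} (hs : 0 ≤ s) (hst : s ≤ t)
    (hφ : φ < Real.pi) (ht : t < φ) (hk : IntervalIntegrable k MeasureTheory.volume s t) (r : ℝ)
    (f : Polynomial ℝ) : IntervalIntegrable (fun u =>
      f.eval (2 * Real.cos u) * (k u * (2 * Real.cos u - 2 * Real.cos φ) ^ r))
      MeasureTheory.volume s t :=
  (intervalIntegrable_shift hs hst hφ ht hk r).continuousOn_mul
    (f.continuous.comp (continuous_const.mul Real.continuous_cos)).continuousOn

theorem hasDerivAt_shift_rpow {u φ : ℝ} (h : 0 < 2 * Real.cos u - 2 * Real.cos φ) (r : ℝ) :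
    HasDerivAt (fun φ => (2 * Real.cos u - 2 * Real.cos φ) ^ r)
      (2 * r * Real.sin φ * (2 * Real.cos u - 2 * Real.cos φ) ^ (r - 1)) φ := by
  have h1 : HasDerivAt (fun φ => 2 * Real.cos u - 2 * Real.cos φ) (2 * Real.sin φ) φ := by
    have := ((Real.hasDerivAt_cos φ).const_mul 2).const_sub (2 * Real.cos u)
    exact this.congr_deriv (by ring)
  exact (h1.rpow_const (Or.inl h.ne')).congr_deriv (by ring)

theorem hasDerivAt_shiftMoment {k : ℝ → ℝ} {s t φ : ℝ} (hs : 0 ≤ s) (hst : s ≤ t)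
    (hφ : φ < Real.pi) (ht : t < φ) (hk : IntervalIntegrable k MeasureTheory.volume s t) (r : ℝ)
    (hr : r ≤ 1) (f : Polynomial ℝ) :
    HasDerivAt (fun φ => shiftMoment k s t r φ f)
      (2 * r * Real.sin φ * shiftMoment k s t (r - 1) φ f) φ := by
  obtain ⟨m, hm1, hm2⟩ := exists_between ht
  have hnhds : Set.Ioo m Real.pi ∈ 𝓝 φ := Ioo_mem_nhds hm2 hφ
  have hmpi : m < Real.pi := hm2.trans hφ
  -- A uniform positive lower bound for the base while the endpoint ranges over `(m, π)`; as `r ≤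
  -- 1`, it bounds the power `r - 1` from above and provides the dominating function.
  set δ := 2 * Real.cos t - 2 * Real.cos m with hδ
  have hδ0 : 0 < δ := cos_sub_cos_pos hs hmpi hm1 (Set.right_mem_Icc.2 hst)
  have hlow : ∀ u ∈ Set.Icc s t, ∀ x ∈ Set.Ioo m Real.pi,
      δ ≤ 2 * Real.cos u - 2 * Real.cos x := by
    intro u hu x hx
    have h1 : Real.cos t ≤ Real.cos u :=
      Real.cos_le_cos_of_nonneg_of_le_pi (hs.trans hu.1) (hm1.trans hmpi).le hu.2
    have h2 : Real.cos x < Real.cos m :=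
      Real.cos_lt_cos_of_nonneg_of_le_pi (by linarith [hs, hst]) hx.2.le hx.1
    rw [hδ]; linarith
  have key := intervalIntegral.hasDerivAt_integral_of_dominated_loc_of_deriv_le
    (μ := MeasureTheory.volume) (a := s) (b := t)
    (F := fun x u => f.eval (2 * Real.cos u) * (k u * (2 * Real.cos u - 2 * Real.cos x) ^ r))
    (F' := fun x u => f.eval (2 * Real.cos u) *
      (k u * (2 * r * Real.sin x * (2 * Real.cos u - 2 * Real.cos x) ^ (r - 1))))
    (bound := fun u => ‖f.eval (2 * Real.cos u) * k u‖ * (2 * |r| * δ ^ (r - 1)))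
    hnhds ?_ (intervalIntegrable_eval_shift hs hst hφ ht hk r f) ?_ ?_ ?_ ?_
  · refine (key.2.congr_of_eventuallyEq ?_).congr_deriv ?_
    · filter_upwards [hnhds] with x hx
      exact shiftMoment_apply hs hst hx.2 (hm1.trans hx.1) hk r f
    · rw [shiftMoment_apply hs hst hφ ht hk, ← intervalIntegral.integral_const_mul]
      exact intervalIntegral.integral_congr fun u _ => by ring
  · filter_upwards [hnhds] with x hx
    have h1 := intervalIntegrable_eval_shift hs hst hx.2 (hm1.trans hx.1) hk r f
    exact (intervalIntegrable_iff.1 h1).aestronglyMeasurable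
  · have h1 := (intervalIntegrable_eval_shift hs hst hφ ht hk (r - 1) f).const_mul
      (2 * r * Real.sin φ)
    refine ((intervalIntegrable_iff.1 h1).aestronglyMeasurable).congr ?_
    exact Eventually.of_forall fun u => by ring
  · refine Eventually.of_forall fun u hu x hx => ?_
    rw [Set.uIoc_of_le hst] at hu
    have hu' : u ∈ Set.Icc s t := ⟨hu.1.le, hu.2⟩
    have hl := hlow u hu' x hx
    have h1 : (2 * Real.cos u - 2 * Real.cos x) ^ (r - 1) ≤ δ ^ (r - 1) :=
      Real.rpow_le_rpow_of_nonpos hδ0 hl (by linarith)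
    have h2 : 0 ≤ (2 * Real.cos u - 2 * Real.cos x) ^ (r - 1) :=
      Real.rpow_nonneg (hδ0.le.trans hl) _
    rw [← mul_assoc, norm_mul]
    refine mul_le_mul_of_nonneg_left ?_ (norm_nonneg _)
    rw [Real.norm_eq_abs, abs_mul, abs_mul, abs_mul, abs_two, abs_of_nonneg h2]
    refine mul_le_mul ?_ h1 h2 (by positivity)
    exact mul_le_of_le_one_right (by positivity) (Real.abs_sin_le_one x)
  · exact ((hk.continuousOn_mul (f.continuous.comp
      (continuous_const.mul Real.continuous_cos)).continuousOn).norm).mul_const _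
  · refine Eventually.of_forall fun u hu x hx => ?_
    rw [Set.uIoc_of_le hst] at hu
    have hl := hlow u ⟨hu.1.le, hu.2⟩ x hx
    exact ((hasDerivAt_shift_rpow (hδ0.trans_le hl) r).const_mul (k u)).const_mul _

theorem shiftMoment_mul {k : ℝ → ℝ} {s t φ : ℝ} (hs : 0 ≤ s) (hst : s ≤ t)
    (hφ : φ < Real.pi) (ht : t < φ) (hk : IntervalIntegrable k MeasureTheory.volume s t) (r : ℝ)
    (f : Polynomial ℝ) :
    shiftMoment k s t r φ ((Polynomial.X - Polynomial.C (2 * Real.cos φ)) * f) =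
      shiftMoment k s t (r + 1) φ f := by
  rw [shiftMoment_apply hs hst hφ ht hk, shiftMoment_apply hs hst hφ ht hk]
  refine intervalIntegral.integral_congr fun u hu => ?_
  rw [Set.uIcc_of_le hst] at hu
  simp only [Polynomial.eval_mul, Polynomial.eval_sub, Polynomial.eval_X, Polynomial.eval_C]
  rw [Real.rpow_add_one (cos_sub_cos_pos hs hφ ht hu).ne']
  ring

/-- The part of `realProd` that does not depend on the moving endpoint. -/
def fixedProd (θ : ℕ → ℝ) (ℓ : ℕ) (u : ℝ) : ℝ :=
  ∏ k ∈ Finset.Icc 1 (2 * ℓ - 1), (2 * Real.cos u - 2 * Real.cos (θ k))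

theorem realProd_eq_fixedProd (hℓ : 1 ≤ ℓ) (u : ℝ) :
    realProd θ ℓ φ u = fixedProd θ ℓ u * (2 * Real.cos u - 2 * Real.cos φ) := by
  obtain ⟨m, hm⟩ : ∃ m, 2 * ℓ = m + 1 := ⟨2 * ℓ - 1, by omega⟩
  rw [realProd, fixedProd, hm, Finset.prod_Icc_succ_top (by omega), Nat.add_sub_cancel, ← hm,
    ang_two_mul]
  congr 1
  refine Finset.prod_congr rfl fun j hj => ?_
  rw [Finset.mem_Icc] at hj
  rw [ang_of_lt (by omega)]

/-- Left ends of the gaps that do not depend on the moving endpoint. -/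
def fixedLo (θ : ℕ → ℝ) (i : ℕ) : ℝ := if i = 0 then 0 else θ (2 * i)

theorem gapLo_eq_fixedLo {i : ℕ} (hi : i < ℓ) : gapLo θ ℓ φ i = fixedLo θ i := by
  rw [gapLo, fixedLo, ang_of_lt (by omega)]

theorem fixedLo_lt (H : Admissible θ ℓ φ) {i : ℕ} (hi : i < ℓ) : fixedLo θ i < θ (2 * i + 1) := by
  have := gapLo_lt H hi.le
  rwa [gapLo_eq_fixedLo hi, ang_of_lt (by omega)] at this

theorem fixedLo_nonneg (H : Admissible θ ℓ φ) {i : ℕ} (hi : i < ℓ) : 0 ≤ fixedLo θ i := by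
  have := gapLo_nonneg H hi.le
  rwa [gapLo_eq_fixedLo hi] at this

theorem fixedHi_lt (H : Admissible θ ℓ φ) {i : ℕ} (hi : i < ℓ) : θ (2 * i + 1) < φ := by
  have := H.lt (i := 2 * i + 1) (j := 2 * ℓ) (by omega) (by omega) (by omega)
  rwa [ang_two_mul, ang_of_lt (by omega)] at this

theorem Admissible.lt_pi (H : Admissible θ ℓ φ) : φ < Real.pi := by
  have hl := H.one_le
  have := H.ang_lt_pi (k := 2 * ℓ) (by omega) le_rfl
  rwa [ang_two_mul] at this

theorem Ioo_fixed_subset (H : Admissible θ ℓ φ) {i : ℕ} (hi : i < ℓ) :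
    Set.Ioo (fixedLo θ i) (θ (2 * i + 1)) ⊆ gapSet θ ℓ φ := by
  have := Ioo_gapLo_subset H hi.le
  rwa [gapLo_eq_fixedLo hi, ang_of_lt (by omega)] at this

/-- Separates the only factor that depends on `φ`. The sign of `1/ρ` on a gap is constant but never
computed; the absolute value suffices, since vanishing conditions do not see a sign. -/
theorem abs_kernel_one (H : Admissible θ ℓ φ) {i : ℕ} (hi : i < ℓ) {u : ℝ}
    (hu : u ∈ Set.Ioo (fixedLo θ i) (θ (2 * i + 1))) :
    |(kernel θ ℓ φ 1 (u * Complex.I)).re| =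
      (Real.sqrt (fixedProd θ ℓ u))⁻¹ * (2 * Real.cos u - 2 * Real.cos φ) ^ (-(1 / 2) : ℝ) := by
  have hmem := Ioo_fixed_subset H hi hu
  have hD : 0 < 2 * Real.cos u - 2 * Real.cos φ :=
    cos_sub_cos_pos (fixedLo_nonneg H hi) H.lt_pi (fixedHi_lt H hi) ⟨hu.1.le, hu.2.le⟩
  have hR := realProd_pos H hmem
  rw [realProd_eq_fixedProd H.one_le] at hR
  have hW : 0 < fixedProd θ ℓ u := pos_of_mul_pos_left hR hD.le
  have hsq := kernel_sq_mul_I (θ := θ) (ℓ := ℓ) (φ := φ) 1 u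
  have him := kernel_im_eq_zero H 1 hmem
  have hre : (kernel θ ℓ φ 1 (u * Complex.I)).re ^ 2 =
      (fixedProd θ ℓ u * (2 * Real.cos u - 2 * Real.cos φ))⁻¹ := by
    have := congrArg Complex.re hsq
    rw [Complex.ofReal_re, sq, Complex.mul_re, him, realProd_eq_fixedProd H.one_le] at this
    simpa [sq] using this
  rw [← Real.sqrt_sq_eq_abs, hre, Real.sqrt_inv, Real.sqrt_mul hW.le, mul_inv,
    Real.rpow_neg hD.le, ← Real.sqrt_eq_rpow]

/-- The weight of the gap functionals without the factor of the moving endpoint. -/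
def fixedWeight (θ : ℕ → ℝ) (ℓ : ℕ) (u : ℝ) : ℝ := (Real.sqrt (fixedProd θ ℓ u))⁻¹

theorem intervalIntegrable_fixedWeight (H : Admissible θ ℓ φ) {i : ℕ} (hi : i < ℓ) :
    IntervalIntegrable (fixedWeight θ ℓ) MeasureTheory.volume (fixedLo θ i) (θ (2 * i + 1)) := by
  have hlt := fixedLo_lt H hi
  have h := (intervalIntegrable_kernel_one H hlt (Ioo_fixed_subset H hi)).abs.mul_continuousOn
    (g := fun u => (2 * Real.cos u - 2 * Real.cos φ) ^ (1 / 2 : ℝ)) (by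
      rw [Set.uIcc_of_le hlt.le]
      exact continuousOn_shift_rpow (fixedLo_nonneg H hi) H.lt_pi (fixedHi_lt H hi) _)
  rw [intervalIntegrable_iff_integrableOn_Ioo_of_le hlt.le] at h ⊢
  refine h.congr_fun (fun u hu => ?_) measurableSet_Ioo
  have hD : 0 < 2 * Real.cos u - 2 * Real.cos φ :=
    cos_sub_cos_pos (fixedLo_nonneg H hi) H.lt_pi (fixedHi_lt H hi) ⟨hu.1.le, hu.2.le⟩
  simp only [abs_kernel_one H hi hu]
  rw [mul_assoc, ← Real.rpow_add hD, neg_add_cancel, Real.rpow_zero, mul_one, fixedWeight]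

/-- The functional of the `i`-th fixed gap with exponent `r` at the moving endpoint. -/
def gapMoment (θ : ℕ → ℝ) (ℓ : ℕ) (r φ : ℝ) (i : ℕ) : Polynomial ℝ →ₗ[ℝ] ℝ :=
  shiftMoment (fixedWeight θ ℓ) (fixedLo θ i) (θ (2 * i + 1)) r φ

theorem exists_integral_kernel_eq_gapMoment (H : Admissible θ ℓ φ) {i : ℕ} (hi : i < ℓ) :
    ∃ ε : ℝ, ε ≠ 0 ∧ ∀ f : Polynomial ℝ, gapMoment θ ℓ (-(1 / 2)) φ i f =
      ε * ∫ u in fixedLo θ i..θ (2 * i + 1), (kernel θ ℓ φ f (u * Complex.I)).re := by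
  have hlt := fixedLo_lt H hi
  obtain ⟨ε, hε, hsgn⟩ : ∃ ε : ℝ, ε ≠ 0 ∧ ∀ u ∈ Set.Ioo (fixedLo θ i) (θ (2 * i + 1)),
      |(kernel θ ℓ φ 1 (u * Complex.I)).re| = ε * (kernel θ ℓ φ 1 (u * Complex.I)).re := by
    rcases kernel_re_sign H (f := 1) (Ioo_fixed_subset H hi) (by simp) with h | h
    · exact ⟨1, one_ne_zero, fun u hu => by rw [abs_of_pos (h u hu), one_mul]⟩
    · exact ⟨-1, by norm_num, fun u hu => by rw [abs_of_neg (h u hu), neg_one_mul]⟩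
  refine ⟨ε, hε, fun f => ?_⟩
  rw [gapMoment, shiftMoment_apply (fixedLo_nonneg H hi) hlt.le H.lt_pi (fixedHi_lt H hi)
    (intervalIntegrable_fixedWeight H hi), ← intervalIntegral.integral_const_mul,
    intervalIntegral.integral_of_le hlt.le, intervalIntegral.integral_of_le hlt.le,
    MeasureTheory.integral_Ioc_eq_integral_Ioo, MeasureTheory.integral_Ioc_eq_integral_Ioo]
  refine MeasureTheory.setIntegral_congr_fun measurableSet_Ioo fun u hu => ?_
  simp only [kernel_re_eq_mul f]
  rw [fixedWeight, ← abs_kernel_one H hi hu, hsgn u hu]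
  ring

theorem Normalized.gapMoment_eq_zero (H : Admissible θ ℓ φ) {f : Polynomial ℝ} {a b : ℂ}
    (hf : Normalized θ ℓ φ f a b) {i : ℕ} (hi : i < ℓ) : gapMoment θ ℓ (-(1 / 2)) φ i f = 0 := by
  obtain ⟨ε, -, h⟩ := exists_integral_kernel_eq_gapMoment H hi
  have h1 := hf.integral_gap H hi.le
  rw [gapLo_eq_fixedLo hi, ang_of_lt (by omega)] at h1
  rw [h f, h1, mul_zero]

/-- The gap from `α` to `-1`, whose end moves, is traded for the arc `(0, θ₁)`. There are still `ℓ`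
intervals, all fixed, and therefore `ℓ` roots. -/
theorem eq_zero_of_gapMoment (H : Admissible θ ℓ φ) {f : Polynomial ℝ}
    (hdeg : f.degree < (ℓ : ℕ)) (hf : ∀ i < ℓ, gapMoment θ ℓ (-(1 / 2)) φ i f = 0) : f = 0 := by
  have h : ∀ i, ∃ u : ℝ, i < ℓ → u ∈ Set.Ioo (gapLo θ ℓ φ i) (ang θ ℓ φ (2 * i + 1)) ∧
      f.eval (2 * Real.cos u) = 0 := by
    intro i
    by_cases hi : i < ℓ
    · obtain ⟨ε, hε, h1⟩ := exists_integral_kernel_eq_gapMoment H hi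
      have h2 := hf i hi
      rw [h1 f] at h2
      have h3 := (mul_eq_zero.1 h2).resolve_left hε
      rw [← gapLo_eq_fixedLo (φ := φ) hi, ← ang_of_lt (θ := θ) (ℓ := ℓ) (φ := φ)
        (show 2 * i + 1 < 2 * ℓ by omega)] at h3
      obtain ⟨u, hu⟩ := exists_root_of_integral_eq_zero H (gapLo_lt H hi.le)
        (Ioo_gapLo_subset H hi.le) h3
      exact ⟨u, fun _ => hu⟩
    · exact ⟨0, fun h => absurd h hi⟩
  choose u hu using h
  exact eq_zero_of_roots hdeg (u := u) (fun i hi => gap_point_mem H hi.le (hu i hi).1)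
    (fun i j hij hj => (gap_points H hij hj.le (hu i (hij.trans hj)).1 (hu j hj).1).ne)
    fun i hi => (hu i hi).2

theorem hasDerivAt_gapMoment (H : Admissible θ ℓ φ) {i : ℕ} (hi : i < ℓ) (f : Polynomial ℝ) :
    HasDerivAt (fun φ => gapMoment θ ℓ (-(1 / 2)) φ i f)
      (-(Real.sin φ * gapMoment θ ℓ (-(3 / 2)) φ i f)) φ := by
  have h := hasDerivAt_shiftMoment (fixedLo_nonneg H hi) (fixedLo_lt H hi).le H.lt_pi
    (fixedHi_lt H hi) (intervalIntegrable_fixedWeight H hi) (-(1 / 2)) (by norm_num) f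
  rw [show (-(1 / 2) - 1 : ℝ) = -(3 / 2) by norm_num] at h
  exact h.congr_deriv (by rw [gapMoment]; ring)

theorem gapMoment_mul (H : Admissible θ ℓ φ) {i : ℕ} (hi : i < ℓ) (f : Polynomial ℝ) :
    gapMoment θ ℓ (-(3 / 2)) φ i ((Polynomial.X - Polynomial.C (2 * Real.cos φ)) * f) =
      gapMoment θ ℓ (-(1 / 2)) φ i f := by
  have h := shiftMoment_mul (fixedLo_nonneg H hi) (fixedLo_lt H hi).le H.lt_pi
    (fixedHi_lt H hi) (intervalIntegrable_fixedWeight H hi) (-(3 / 2)) f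
  rwa [show (-(3 / 2) + 1 : ℝ) = -(1 / 2) by norm_num] at h

end DarkGas
end

/-! ### Differentiable dependence of the coefficients, degree counts, and signs at the moving
endpoint. -/

noncomputable section
namespace DarkGas

variable {θ : ℕ → ℝ} {ℓ : ℕ} {φ : ℝ}

theorem differentiableAt_det {n : ℕ} {M : ℝ → Matrix (Fin n) (Fin n) ℝ} {x : ℝ}
    (h : ∀ i j, DifferentiableAt ℝ (fun t => M t i j) x) :
    DifferentiableAt ℝ (fun t => (M t).det) x := by
  simp only [Matrix.det_apply']
  refine DifferentiableAt.fun_sum fun σ _ => DifferentiableAt.const_mul ?_ _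
  exact DifferentiableAt.fun_finsetProd fun i _ => h _ _

/-- Cramer's rule: the solution is the adjugate applied to the right-hand side, divided by the
determinant, which stays nonzero nearby. -/
theorem differentiableAt_of_mulVec_eq {n : ℕ} {M : ℝ → Matrix (Fin n) (Fin n) ℝ}
    {c d : ℝ → Fin n → ℝ} {x : ℝ} (hM : ∀ i j, DifferentiableAt ℝ (fun t => M t i j) x)
    (hd : ∀ j, DifferentiableAt ℝ (fun t => d t j) x) (hdet : (M x).det ≠ 0)
    (heq : ∀ᶠ t in 𝓝 x, Matrix.mulVec (M t) (c t) = d t) (j : Fin n) :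
    DifferentiableAt ℝ (fun t => c t j) x := by
  have hdiff := differentiableAt_det hM
  have hadj : ∀ i k, DifferentiableAt ℝ (fun t => (M t).adjugate i k) x := by
    intro i k
    simp only [Matrix.adjugate_apply]
    refine differentiableAt_det fun a b => ?_
    by_cases ha : a = k
    · subst ha
      simp only [Matrix.updateRow_self]
      exact differentiableAt_const _
    · simp only [Matrix.updateRow_ne ha]
      exact hM a b
  have hsum : DifferentiableAt ℝ
      (fun t => (∑ k, (M t).adjugate j k * d t k) / (M t).det) x :=
    (DifferentiableAt.fun_sum fun k _ => (hadj j k).mul (hd k)).div hdiff hdet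
  refine hsum.congr_of_eventuallyEq ?_
  filter_upwards [heq, hdiff.continuousAt.eventually_ne hdet] with t ht hdt
  have h1 : Matrix.mulVec (M t).adjugate (d t) = (M t).det • c t := by
    rw [← ht, Matrix.mulVec_mulVec, Matrix.adjugate_mul, Matrix.smul_mulVec, Matrix.one_mulVec]
  have h2 := congrFun h1 j
  rw [Pi.smul_apply, smul_eq_mul] at h2
  rw [eq_div_iff hdt, mul_comm, ← h2]
  rfl

/-- The same coefficients also solve the system with the fixed intervals; its matrix is
differentiable in `φ` and invertible by `eq_zero_of_gapMoment`. -/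
theorem differentiableAt_coeff (hadm : ∀ᶠ t in 𝓝 φ, Admissible θ ℓ t) {n : ℕ} (hn : ℓ ≤ n)
    {c : ℝ → Fin (n + 1) → ℝ}
    (hc : ∀ j : Fin (n + 1), (j : ℕ) + ℓ ≤ n → DifferentiableAt ℝ (fun t => c t j) φ)
    (hgap : ∀ᶠ t in 𝓝 φ, ∀ i < ℓ, gapMoment θ ℓ (-(1 / 2)) t i (symPoly n (c t)) = 0)
    (j : Fin (n + 1)) : DifferentiableAt ℝ (fun t => c t j) φ := by
  have H := hadm.self_of_nhds
  refine differentiableAt_of_mulVec_eq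
    (M := fun t => LinearMap.toMatrix' (coeffSystem n ℓ (gapMoment θ ℓ (-(1 / 2)) t)))
    (d := fun t j => if (j : ℕ) + ℓ ≤ n then c t j else 0) (fun i k => ?_) (fun k => ?_) ?_ ?_ j
  · simp only [LinearMap.toMatrix'_apply]
    by_cases hi : (i : ℕ) + ℓ ≤ n
    · simp only [coeffSystem_apply_of_le _ hi]
      exact differentiableAt_const _
    · have hi2 := i.2
      simp only [coeffSystem_apply_of_lt _ (not_le.1 hi)]
      exact (hasDerivAt_gapMoment H (by omega) _).differentiableAt
  · by_cases hk : (k : ℕ) + ℓ ≤ n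
    · simpa [hk] using hc k hk
    · simp [hk]
  · have hinj := coeffSystem_injective hn fun f hf h => eq_zero_of_gapMoment H hf h
    intro h0
    obtain ⟨v, hv, hv0⟩ := Matrix.exists_mulVec_eq_zero_iff.2 h0
    rw [LinearMap.toMatrix'_mulVec] at hv0
    exact hv (hinj (hv0.trans (map_zero _).symm))
  · filter_upwards [hgap] with t ht
    rw [LinearMap.toMatrix'_mulVec]
    funext k
    by_cases hk : (k : ℕ) + ℓ ≤ n
    · rw [coeffSystem_apply_of_le _ hk, if_pos hk]
    · have hk2 := k.2
      rw [coeffSystem_apply_of_lt _ (not_le.1 hk), if_neg hk, ht _ (by omega)]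

theorem gapMoment_deriv (H : Admissible θ ℓ φ) {n : ℕ} {c : ℝ → Fin (n + 1) → ℝ}
    {c' : Fin (n + 1) → ℝ} (hc : ∀ j, HasDerivAt (fun t => c t j) (c' j) φ) {i : ℕ} (hi : i < ℓ)
    (hgap : ∀ᶠ t in 𝓝 φ, gapMoment θ ℓ (-(1 / 2)) t i (symPoly n (c t)) = 0) :
    gapMoment θ ℓ (-(1 / 2)) φ i (symPoly n c') =
      Real.sin φ * gapMoment θ ℓ (-(3 / 2)) φ i (symPoly n (c φ)) := by
  have hexp : ∀ r t (d : Fin (n + 1) → ℝ), gapMoment θ ℓ r t i (symPoly n d) =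
      ∑ j : Fin (n + 1), d j * gapMoment θ ℓ r t i (symBasis (n - j)) := by
    intro r t d
    rw [symPoly_apply, map_sum]
    simp only [map_smul, smul_eq_mul]
  have h1 : HasDerivAt (fun t => gapMoment θ ℓ (-(1 / 2)) t i (symPoly n (c t)))
      (∑ j : Fin (n + 1), (c' j * gapMoment θ ℓ (-(1 / 2)) φ i (symBasis (n - j)) +
        c φ j * -(Real.sin φ * gapMoment θ ℓ (-(3 / 2)) φ i (symBasis (n - j))))) φ := by
    simp only [hexp]
    exact HasDerivAt.fun_sum fun j _ => (hc j).mul (hasDerivAt_gapMoment H hi _)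
  have h2 : HasDerivAt (fun t => gapMoment θ ℓ (-(1 / 2)) t i (symPoly n (c t))) 0 φ :=
    (hasDerivAt_const φ (0 : ℝ)).congr_of_eventuallyEq hgap
  have h3 := h1.unique h2
  rw [hexp, hexp, Finset.mul_sum, ← sub_eq_zero, ← Finset.sum_sub_distrib, ← h3]
  exact Finset.sum_congr rfl fun j _ => by ring

theorem hasDerivAt_eval_symPoly {n : ℕ} {c : ℝ → Fin (n + 1) → ℝ} {c' : Fin (n + 1) → ℝ}
    (hc : ∀ j, HasDerivAt (fun t => c t j) (c' j) φ) :
    HasDerivAt (fun t => (symPoly n (c t)).eval (2 * Real.cos t))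
      ((symPoly n c').eval (2 * Real.cos φ) +
        (symPoly n (c φ)).derivative.eval (2 * Real.cos φ) * -(2 * Real.sin φ)) φ := by
  have hcos : HasDerivAt (fun t => 2 * Real.cos t) (-(2 * Real.sin φ)) φ :=
    ((Real.hasDerivAt_cos φ).const_mul 2).congr_deriv (by ring)
  simp only [symPoly_apply, Polynomial.eval_finsetSum, Polynomial.eval_smul, smul_eq_mul,
    Polynomial.derivative_sum, Polynomial.derivative_smul]
  rw [Finset.sum_mul, ← Finset.sum_add_distrib]
  refine HasDerivAt.fun_sum fun j _ => ?_
  exact ((hc j).mul (((symBasis (n - j)).hasDerivAt _).comp φ hcos)).congr_deriv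
    (by simp only [Function.comp]; ring)

/-- The tail of `symPoly` beyond its first two terms has low degree. -/
theorem degree_symPoly_sub_two (n : ℕ) (c : Fin (n + 2) → ℝ) :
    (symPoly (n + 1) c - (c 0 • symBasis (n + 1) + c 1 • symBasis n)).degree < (n : ℕ) := by
  rw [← Polynomial.mem_degreeLT, symPoly_apply, Fin.sum_univ_succ, Fin.sum_univ_succ]
  simp only [Fin.val_zero, Nat.sub_zero, Fin.succ_zero_eq_one, Fin.val_one, Nat.add_sub_cancel,
    ← add_assoc, add_sub_cancel_left]
  refine Submodule.sum_mem _ fun j _ => Submodule.smul_mem _ _ ?_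
  rw [Polynomial.mem_degreeLT, degree_symBasis]
  have := j.2
  have h2 : ((j.succ.succ : Fin (n + 2)) : ℕ) = j + 2 := rfl
  exact_mod_cast (by rw [h2]; omega : n + 1 - ((j.succ.succ : Fin (n + 2)) : ℕ) < n)

/-- The tail of `symPoly` beyond its first three terms has low degree. -/
theorem degree_symPoly_sub_three (n : ℕ) (c : Fin (n + 3) → ℝ) :
    (symPoly (n + 2) c - (c 0 • symBasis (n + 2) + c 1 • symBasis (n + 1) +
      c 2 • symBasis n)).degree < (n : ℕ) := by
  rw [← Polynomial.mem_degreeLT, symPoly_apply, Fin.sum_univ_succ, Fin.sum_univ_succ,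
    Fin.sum_univ_succ]
  have e1 : n + 2 - ((Fin.succ 0 : Fin (n + 3)) : ℕ) = n + 1 := rfl
  have e2 : n + 2 - ((Fin.succ (Fin.succ 0) : Fin (n + 3)) : ℕ) = n := rfl
  have e3 : (Fin.succ (Fin.succ 0) : Fin (n + 3)) = 2 := rfl
  rw [e1, e2, e3]
  simp only [Fin.val_zero, Nat.sub_zero, Fin.succ_zero_eq_one, ← add_assoc, add_sub_cancel_left]
  refine Submodule.sum_mem _ fun j _ => Submodule.smul_mem _ _ ?_
  rw [Polynomial.mem_degreeLT, degree_symBasis]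
  have := j.2
  have h2 : ((j.succ.succ.succ : Fin (n + 3)) : ℕ) = j + 3 := rfl
  exact_mod_cast (by rw [h2]; omega : n + 2 - ((j.succ.succ.succ : Fin (n + 3)) : ℕ) < n)

theorem symBasis_mem_degreeLT {m n : ℕ} (h : m < n) : symBasis m ∈ Polynomial.degreeLT ℝ n := by
  rw [Polynomial.mem_degreeLT, degree_symBasis]
  exact_mod_cast h

theorem X_mul_symBasis_sub_mem (m : ℕ) : Polynomial.X * symBasis (m + 1) - symBasis (m + 2) ∈
    Polynomial.degreeLT ℝ (m + 1) := by
  rw [Polynomial.mem_degreeLT]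
  refine (degree_X_mul_symBasis_sub m).trans_lt ?_
  exact_mod_cast Nat.lt_succ_self m

/-- The leading terms cancel because `X b_m` equals `b_{m+1}` up to lower degree. Working after
multiplication by `X - a` avoids expanding the quotient of `h` by `X - a`. -/
theorem degree_combination_lt (hℓ : 1 ≤ ℓ) {s a β : ℝ} {f h : Polynomial ℝ}
    (hf : f - (-s • symBasis (ℓ + 1) + (s * (β - a)) • symBasis ℓ) ∈ Polynomial.degreeLT ℝ ℓ)
    (hh : h - (-symBasis (ℓ + 2) + β • symBasis (ℓ + 1)) ∈ Polynomial.degreeLT ℝ (ℓ + 1)) :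
    (Polynomial.X - Polynomial.C a) * f - Polynomial.C s * h ∈
      Polynomial.degreeLT ℝ (ℓ + 1) := by
  obtain ⟨m, rfl⟩ : ∃ m, ℓ = m + 1 := ⟨ℓ - 1, by omega⟩
  set r₁ := f - (-s • symBasis (m + 1 + 1) + (s * (β - a)) • symBasis (m + 1)) with hr₁
  set r₂ := h - (-symBasis (m + 1 + 2) + β • symBasis (m + 1 + 1)) with hr₂
  have hmono : Polynomial.degreeLT ℝ (m + 1) ≤ Polynomial.degreeLT ℝ (m + 1 + 1) :=
    Polynomial.degreeLT_mono (by omega)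
  have hX : Polynomial.X * r₁ ∈ Polynomial.degreeLT ℝ (m + 1 + 1) := by
    rw [Polynomial.mem_degreeLT] at hf ⊢
    by_cases h0 : r₁ = 0
    · rw [h0, mul_zero, Polynomial.degree_zero]
      exact WithBot.bot_lt_coe _
    rw [Polynomial.degree_mul, Polynomial.degree_X, Polynomial.degree_eq_natDegree h0]
    rw [Polynomial.degree_eq_natDegree h0] at hf
    have h1 : r₁.natDegree < m + 1 := by exact_mod_cast hf
    exact_mod_cast (by omega : 1 + r₁.natDegree < m + 1 + 1)
  have key : (Polynomial.X - Polynomial.C a) * f - Polynomial.C s * h =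
      -s • (Polynomial.X * symBasis (m + 1 + 1) - symBasis (m + 1 + 2)) +
      (s * (β - a)) • (Polynomial.X * symBasis (m + 1) - symBasis (m + 2)) +
      (-a * (s * (β - a))) • symBasis (m + 1) + Polynomial.X * r₁ - a • r₁ - s • r₂ := by
    simp only [hr₁, hr₂, Polynomial.smul_eq_C_mul, Polynomial.C_mul, Polynomial.C_neg,
      Polynomial.C_sub]
    ring
  rw [key]
  refine Submodule.sub_mem _ (Submodule.sub_mem _ (Submodule.add_mem _ (Submodule.add_mem _
    (Submodule.add_mem _ (Submodule.smul_mem _ _ (X_mul_symBasis_sub_mem (m + 1)))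
    (Submodule.smul_mem _ _ (hmono (X_mul_symBasis_sub_mem m))))
    (Submodule.smul_mem _ _ (symBasis_mem_degreeLT (by omega)))) hX)
    (Submodule.smul_mem _ _ (hmono hf))) (Submodule.smul_mem _ _ hh)

theorem degree_lt_of_X_sub_C_mul {f : Polynomial ℝ} {a : ℝ} {n : ℕ}
    (h : (Polynomial.X - Polynomial.C a) * f ∈ Polynomial.degreeLT ℝ (n + 1)) :
    f.degree < (n : ℕ) := by
  by_cases h0 : f = 0
  · simp [h0]
  rw [Polynomial.mem_degreeLT, Polynomial.degree_mul, Polynomial.degree_X_sub_C,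
    Polynomial.degree_eq_natDegree h0] at h
  rw [Polynomial.degree_eq_natDegree h0]
  have h1 : 1 + f.natDegree < n + 1 := by exact_mod_cast h
  exact_mod_cast (by omega : f.natDegree < n)

/-- A monic polynomial with one root in each gap is the product of its linear factors. -/
theorem eval_eq_prod_of_roots (H : Admissible θ ℓ φ) {f : Polynomial ℝ} (hf : f.Monic)
    (hdeg : f.degree = (ℓ + 1 : ℕ)) {u : ℕ → ℝ} (hu : ∀ i ≤ ℓ,
      u i ∈ Set.Ioo (gapLo θ ℓ φ i) (ang θ ℓ φ (2 * i + 1)) ∧ f.eval (2 * Real.cos (u i)) = 0)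
    (x : ℝ) : f.eval x = ∏ i ∈ Finset.range (ℓ + 1), (x - 2 * Real.cos (u i)) := by
  set g : Polynomial ℝ :=
    ∏ i ∈ Finset.range (ℓ + 1), (Polynomial.X - Polynomial.C (2 * Real.cos (u i))) with hg
  have hgm : g.Monic := Polynomial.monic_prod_of_monic _ _ fun i _ => Polynomial.monic_X_sub_C _
  have hgd : g.degree = (ℓ + 1 : ℕ) := by
    rw [hg, Polynomial.degree_prod]
    simp only [Polynomial.degree_X_sub_C]
    simp
  have hlt : (f - g).degree < (ℓ + 1 : ℕ) := by
    rw [← hdeg]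
    exact Polynomial.degree_sub_lt_left (hdeg.trans hgd.symm) hf.ne_zero
      (hf.leadingCoeff.trans hgm.leadingCoeff.symm)
  have h0 : f - g = 0 := by
    refine eq_zero_of_roots hlt (u := u)
      (fun i hi => gap_point_mem H (by omega) (hu i (by omega)).1)
      (fun i j hij hj => (gap_points H hij (by omega) (hu i (by omega)).1
        (hu j (by omega)).1).ne) fun i hi => ?_
    rw [Polynomial.eval_sub, (hu i (by omega)).2, hg, Polynomial.eval_prod, zero_sub, neg_eq_zero]
    exact Finset.prod_eq_zero (Finset.mem_range.2 hi) (by simp)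
  rw [sub_eq_zero.1 h0, hg, Polynomial.eval_prod]
  simp

/-- The factor `2 cos φ - 2 cos u_i` is negative for each of the first `ℓ` intervals, which lie
before `φ`, and positive for the last, which lies after it. The sign of the product thus does not
depend on where in the gaps the roots are. -/
theorem eval_mul_eval_pos (H : Admissible θ ℓ φ) {f g : Polynomial ℝ} (hf : f.Monic)
    (hfd : f.degree = (ℓ + 1 : ℕ)) (hg : g.Monic) (hgd : g.degree = (ℓ + 1 : ℕ)) {u v : ℕ → ℝ}
    (hu : ∀ i ≤ ℓ, u i ∈ Set.Ioo (gapLo θ ℓ φ i) (ang θ ℓ φ (2 * i + 1)) ∧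
      f.eval (2 * Real.cos (u i)) = 0)
    (hv : ∀ i ≤ ℓ, v i ∈ Set.Ioo (gapLo θ ℓ φ i) (ang θ ℓ φ (2 * i + 1)) ∧
      g.eval (2 * Real.cos (v i)) = 0) :
    0 < f.eval (2 * Real.cos φ) * g.eval (2 * Real.cos φ) := by
  have hℓ := H.one_le
  have hφ0 : 0 < φ := by
    have := H.ang_pos (k := 2 * ℓ) (by omega) (by omega)
    rwa [ang_two_mul] at this
  rw [eval_eq_prod_of_roots H hf hfd hu, eval_eq_prod_of_roots H hg hgd hv,
    ← Finset.prod_mul_distrib]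
  refine Finset.prod_pos fun i hi => ?_
  have hi' : i ≤ ℓ := by have := Finset.mem_range.1 hi; omega
  rcases hi'.lt_or_eq with h | rfl
  · have key : ∀ w ∈ Set.Ioo (gapLo θ ℓ φ i) (ang θ ℓ φ (2 * i + 1)),
        2 * Real.cos φ - 2 * Real.cos w < 0 := by
      intro w hw
      rw [gapLo_eq_fixedLo h, ang_of_lt (by omega)] at hw
      have := cos_sub_cos_pos (fixedLo_nonneg H h) H.lt_pi (fixedHi_lt H h) ⟨hw.1.le, hw.2.le⟩
      linarith
    exact mul_pos_of_neg_of_neg (key _ (hu i hi').1) (key _ (hv i hi').1)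
  · have key : ∀ w ∈ Set.Ioo (gapLo θ i φ i) (ang θ i φ (2 * i + 1)),
        0 < 2 * Real.cos φ - 2 * Real.cos w := by
      intro w hw
      rw [gapLo, if_neg (by omega), ang_two_mul, ang_last] at hw
      have := Real.cos_lt_cos_of_nonneg_of_le_pi hφ0.le hw.2.le hw.1
      linarith
    exact mul_pos (key _ (hu i hi').1) (key _ (hv i hi').1)

theorem IsCoeffP.eval_ne_zero (H : Admissible θ ℓ φ) {B : Fin (ℓ + 2) → ℝ}
    (hB : IsCoeffP θ ℓ φ B) : (symPoly (ℓ + 1) B).eval (2 * Real.cos φ) ≠ 0 := by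
  obtain ⟨u, hu⟩ := (hB.normalized H).exists_roots H
  obtain ⟨hm, hd⟩ := symPoly_monic hB.zero
  exact (mul_self_pos.1 (eval_mul_eval_pos H hm hd hm hd hu hu))

theorem cis_add_inv_eq (t : ℝ) : cis t + (cis t)⁻¹ = ((2 * Real.cos t : ℝ) : ℂ) := by
  rw [cis_add_inv]
  push_cast
  ring

theorem aeval_cis (f : Polynomial ℝ) (t : ℝ) :
    Polynomial.aeval (cis t + (cis t)⁻¹) f = ((f.eval (2 * Real.cos t) : ℝ) : ℂ) := by
  rw [cis_add_inv_eq]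
  have h := Polynomial.aeval_algebraMap_apply ℂ (2 * Real.cos t) f
  rwa [Polynomial.coe_aeval_eq_eval] at h

theorem Q_div_P (B : Fin (ℓ + 2) → ℝ) (C : Fin (ℓ + 3) → ℝ) (t : ℝ)
    (hp : (symPoly (ℓ + 1) B).eval (2 * Real.cos t) ≠ 0) :
    P B (cis t) ≠ 0 ∧ 2 * Q C (cis t) / P B (cis t) =
      ((2 * (symPoly (ℓ + 2) C).eval (2 * Real.cos t) /
        (symPoly (ℓ + 1) B).eval (2 * Real.cos t) : ℝ) : ℂ) := by
  have hz := cis_ne_zero t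
  have hP := P_eq (B := B) hz
  have hQ := Q_eq (C := C) hz
  rw [aeval_cis] at hP hQ
  have hp' := Complex.ofReal_ne_zero.2 hp
  have hP0 : P B (cis t) ≠ 0 := by
    intro h0
    rw [h0, mul_zero] at hP
    exact mul_ne_zero (pow_ne_zero ℓ hz) hp' hP.symm
  refine ⟨hP0, ?_⟩
  push_cast
  rw [div_eq_div_iff hP0 hp']
  apply mul_left_cancel₀ hz
  linear_combination 2 * (((symPoly (ℓ + 1) B).eval (2 * Real.cos t) : ℝ) : ℂ) * hQ -
    2 * (((symPoly (ℓ + 2) C).eval (2 * Real.cos t) : ℝ) : ℂ) * hP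

theorem xi_eq {B : ℝ → Fin (ℓ + 2) → ℝ} (C : ℝ → Fin (ℓ + 3) → ℝ)
    (hp : (symPoly (ℓ + 1) (B φ)).eval (2 * Real.cos φ) ≠ 0) :
    xi B C φ = 2 * (symPoly (ℓ + 2) (C φ)).eval (2 * Real.cos φ) /
      (symPoly (ℓ + 1) (B φ)).eval (2 * Real.cos φ) := by
  rw [xi, (Q_div_P (B φ) (C φ) φ hp).2, Complex.ofReal_re]

end DarkGas
end

/-! ### The derivative of `ξ` and its sign. -/

noncomputable section
namespace DarkGas

variable {θ : ℕ → ℝ} {ℓ : ℕ} {φ : ℝ}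

theorem admissible_of_mem {N : ℕ} (hθ : ∀ j ∈ Finset.Icc 1 (2 * N), θ j ∈ Set.Ioo 0 Real.pi)
    (hmono : StrictMonoOn θ (Set.Icc 1 (2 * N))) (hℓ : ℓ ∈ Finset.Icc 1 N)
    (hφ : φ ∈ Set.Ioo (θ (2 * ℓ - 1)) Real.pi) : Admissible θ ℓ φ := by
  rw [Finset.mem_Icc] at hℓ
  have hlt : ∀ i, 1 ≤ i → i < 2 * ℓ → θ i < φ := fun i h1 h2 =>
    (hmono.monotoneOn ⟨h1, by omega⟩ ⟨by omega, by omega⟩ (by omega : i ≤ 2 * ℓ - 1)).trans_lt hφ.1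
  refine ⟨hℓ.1, ?_, ?_⟩
  · rw [ang_of_lt (by omega)]
    exact (hθ 1 (Finset.mem_Icc.2 ⟨le_rfl, by omega⟩)).1
  · intro i hi j hj hij
    have hi1 := hi.1
    have hj2 := hj.2
    rw [ang, ang]
    split_ifs with h1 h2 h3 h4 h5 h6
    · exact hmono ⟨hi1, by omega⟩ ⟨by omega, by omega⟩ hij
    · exact hlt i hi1 h1
    · exact (hlt i hi1 h1).trans hφ.2
    · omega
    · omega
    · exact hφ.2
    · omega
    · omega
    · omega

/-- If `p` and `q` solve the normalization conditions for all positions of the moving endpoint, then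
the derivative of `ξ₀ p / 2 - q` with respect to the position is `sin φ` times the quotient of this
polynomial by `X - 2 cos φ`. -/
theorem deriv_eq_of_root (H : Admissible θ ℓ φ) {B : ℝ → Fin (ℓ + 2) → ℝ}
    {C : ℝ → Fin (ℓ + 3) → ℝ} {B' : Fin (ℓ + 2) → ℝ} {C' : Fin (ℓ + 3) → ℝ}
    (hBd : ∀ j, HasDerivAt (fun t => B t j) (B' j) φ)
    (hCd : ∀ j, HasDerivAt (fun t => C t j) (C' j) φ)
    (hBg : ∀ i < ℓ, ∀ᶠ t in 𝓝 φ, gapMoment θ ℓ (-(1 / 2)) t i (symPoly (ℓ + 1) (B t)) = 0)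
    (hCg : ∀ i < ℓ, ∀ᶠ t in 𝓝 φ, gapMoment θ ℓ (-(1 / 2)) t i (symPoly (ℓ + 2) (C t)) = 0)
    (hB0 : B φ 0 = 1) (hC0 : C φ 0 = 1) (hB0' : B' 0 = 0) (hB1' : B' 1 = Real.sin φ)
    (hC0' : C' 0 = 0) (hC1' : C' 1 = Real.sin φ)
    (hC2' : C' 2 = Real.sin φ * (C φ 1 + 2 * Real.cos φ)) {c : ℝ} {h₁ : Polynomial ℝ}
    (hh₁ : (Polynomial.X - Polynomial.C (2 * Real.cos φ)) * h₁ =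
      Polynomial.C c * symPoly (ℓ + 1) (B φ) - symPoly (ℓ + 2) (C φ)) :
    Polynomial.C c * symPoly (ℓ + 1) B' - symPoly (ℓ + 2) C' =
      Polynomial.C (Real.sin φ) * h₁ := by
  set s := Real.sin φ with hs
  set a := 2 * Real.cos φ with ha
  rw [← sub_eq_zero]
  -- Uniqueness for the homogeneous problem: the difference of the two sides has degree `< ℓ` and
  -- all its fixed-gap functionals vanish.
  refine eq_zero_of_gapMoment H (degree_lt_of_X_sub_C_mul (a := a) ?_) fun i hi => ?_
  · have e1 : (Polynomial.X - Polynomial.C a) *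
        (Polynomial.C c * symPoly (ℓ + 1) B' - symPoly (ℓ + 2) C' - Polynomial.C s * h₁) =
        (Polynomial.X - Polynomial.C a) *
          (Polynomial.C c * symPoly (ℓ + 1) B' - symPoly (ℓ + 2) C') -
        Polynomial.C s * ((Polynomial.X - Polynomial.C a) * h₁) := by ring
    rw [e1, hh₁]
    have hmono : Polynomial.degreeLT ℝ ℓ ≤ Polynomial.degreeLT ℝ (ℓ + 1) :=
      Polynomial.degreeLT_mono (by omega)
    -- `β` is the coefficient of `b_{ℓ+1}` in `c p - q`. The derivative `C' 2` has just the value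
    -- for which the next coefficient of `ḣ` is `sin φ (β - a)`.
    refine degree_combination_lt (β := c - C φ 1) H.one_le ?_ ?_
    · have h1 := Polynomial.mem_degreeLT.2 (degree_symPoly_sub_two ℓ B')
      have h2 := Polynomial.mem_degreeLT.2 (degree_symPoly_sub_three ℓ C')
      have h3 := Submodule.sub_mem _ (Submodule.smul_mem _ c h1) h2
      rw [hB0', hB1', hC0', hC1', hC2'] at h3
      convert h3 using 1
      simp only [Polynomial.smul_eq_C_mul, Polynomial.C_mul, Polynomial.C_neg, Polynomial.C_sub,
        Polynomial.C_add, Polynomial.C_0]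
      ring
    · have h1 := hmono (Polynomial.mem_degreeLT.2 (degree_symPoly_sub_two ℓ (B φ)))
      have h2 := hmono (Polynomial.mem_degreeLT.2 (degree_symPoly_sub_three ℓ (C φ)))
      have hb := symBasis_mem_degreeLT (Nat.lt_succ_self ℓ)
      have h3 := Submodule.add_mem _ (Submodule.sub_mem _ (Submodule.smul_mem _ c h1) h2)
        (Submodule.smul_mem _ (c * B φ 1 - C φ 2) hb)
      rw [hB0, hC0] at h3
      convert h3 using 1
      simp only [Polynomial.smul_eq_C_mul, Polynomial.C_mul, Polynomial.C_sub, Polynomial.C_1]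
      ring
  -- Differentiating the conditions lowers the exponent to `-3/2`; the factor `X - a` of `c p - q`
  -- raises it back to `-1/2`.
  · have h1 := gapMoment_deriv H hBd hi (hBg i hi)
    have h2 := gapMoment_deriv H hCd hi (hCg i hi)
    have h3 := gapMoment_mul H hi h₁
    rw [← ha, hh₁] at h3
    simp only [← Polynomial.smul_eq_C_mul, map_sub, map_smul, smul_eq_mul] at h3 ⊢
    rw [h1, h2, ← h3]
    ring

theorem eventually_mem {P : ℝ → Prop} {s t : ℝ} (hφ : φ ∈ Set.Ioo s t)
    (h : ∀ x ∈ Set.Ioo s t, P x) : ∀ᶠ x in 𝓝 φ, P x := by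
  filter_upwards [Ioo_mem_nhds hφ.1 hφ.2] with x hx using h x hx

theorem hasDerivAt_coeff_one (c : ℝ) :
    HasDerivAt (fun t => -c - Real.cos t) (Real.sin φ) φ :=
  ((Real.hasDerivAt_cos φ).const_sub (-c)).congr_deriv (by ring)

theorem hasDerivAt_coeff_two (S T : ℝ) :
    HasDerivAt (fun t => 1 / 8 * (S ^ 2 - 2 * T + 2 + 2 * (2 * Real.cos t) * S
      - 2 * Real.cos (2 * t))) (Real.sin φ * (-(S / 2) + Real.cos φ)) φ := by
  have h1 : HasDerivAt (fun t => 2 * (2 * Real.cos t) * S) (2 * (2 * -Real.sin φ) * S) φ :=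
    (((Real.hasDerivAt_cos φ).const_mul 2).const_mul 2).mul_const S
  have h2 : HasDerivAt (fun t => 2 * Real.cos (2 * t)) (2 * (-Real.sin (2 * φ) * 2)) φ := by
    have h3 : HasDerivAt (fun t : ℝ => 2 * t) 2 φ := by
      simpa using (hasDerivAt_id φ).const_mul 2
    exact (h3.cos).const_mul 2
  have h4 := (((h1.const_add (S ^ 2 - 2 * T + 2)).sub h2).const_mul (1 / 8))
  refine h4.congr_deriv ?_
  rw [Real.sin_two_mul]
  ring

/-- The position of the moving endpoint decreases `ξ`. -/
theorem exists_hasDerivAt_xi {B : ℝ → Fin (ℓ + 2) → ℝ} {C : ℝ → Fin (ℓ + 3) → ℝ}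
    (hadm : ∀ t ∈ Set.Ioo (θ (2 * ℓ - 1)) Real.pi, Admissible θ ℓ t)
    (hB : ∀ t ∈ Set.Ioo (θ (2 * ℓ - 1)) Real.pi, IsCoeffP θ ℓ t (B t))
    (hC : ∀ t ∈ Set.Ioo (θ (2 * ℓ - 1)) Real.pi, IsCoeffQ θ ℓ t (C t))
    (hφ : φ ∈ Set.Ioo (θ (2 * ℓ - 1)) Real.pi) :
    ∃ ξ' : ℝ, HasDerivAt (xi B C) ξ' φ ∧ ξ' < 0 := by
  have H := hadm φ hφ
  have hℓ := H.one_le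
  have hBg : ∀ᶠ t in 𝓝 φ, ∀ i < ℓ, gapMoment θ ℓ (-(1 / 2)) t i (symPoly (ℓ + 1) (B t)) = 0 :=
    eventually_mem hφ fun t ht i hi =>
      ((hB t ht).normalized (hadm t ht)).gapMoment_eq_zero (hadm t ht) hi
  have hCg : ∀ᶠ t in 𝓝 φ, ∀ i < ℓ, gapMoment θ ℓ (-(1 / 2)) t i (symPoly (ℓ + 2) (C t)) = 0 :=
    eventually_mem hφ fun t ht i hi =>
      ((hC t ht).normalized (hadm t ht)).gapMoment_eq_zero (hadm t ht) hi
  have hB0 : HasDerivAt (fun t => B t 0) 0 φ :=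
    (hasDerivAt_const φ (1 : ℝ)).congr_of_eventuallyEq
      (eventually_mem hφ fun t ht => (hB t ht).zero)
  have hB1 : HasDerivAt (fun t => B t 1) (Real.sin φ) φ :=
    (hasDerivAt_coeff_one _).congr_of_eventuallyEq (eventually_mem hφ fun t ht => (hB t ht).one)
  have hC0 : HasDerivAt (fun t => C t 0) 0 φ :=
    (hasDerivAt_const φ (1 : ℝ)).congr_of_eventuallyEq
      (eventually_mem hφ fun t ht => (hC t ht).zero)
  have hC1 : HasDerivAt (fun t => C t 1) (Real.sin φ) φ :=
    (hasDerivAt_coeff_one _).congr_of_eventuallyEq (eventually_mem hφ fun t ht => (hC t ht).one)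
  have hC2 : HasDerivAt (fun t => C t 2) (Real.sin φ * (C φ 1 + 2 * Real.cos φ)) φ := by
    have h := ((hasDerivAt_coeff_two (φ := φ)
      (∑ j ∈ Finset.Icc 1 (2 * ℓ - 1), 2 * Real.cos (θ j))
      (∑ j ∈ Finset.Icc 1 (2 * ℓ - 1), 2 * Real.cos (2 * θ j))).congr_of_eventuallyEq
      (eventually_mem hφ fun t ht => (hC t ht).two))
    refine h.congr_deriv ?_
    rw [(hC φ hφ).one, ← Finset.mul_sum]
    ring
  have hBd : ∀ j, DifferentiableAt ℝ (fun t => B t j) φ :=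
    differentiableAt_coeff (eventually_mem hφ hadm) (by omega) (fun j hj => by
      rcases (by omega : (j : ℕ) = 0 ∨ (j : ℕ) = 1) with h | h
      · rw [show j = 0 from Fin.ext h]; exact hB0.differentiableAt
      · rw [show j = 1 from Fin.ext (by simpa using h)]; exact hB1.differentiableAt) hBg
  have hCd : ∀ j, DifferentiableAt ℝ (fun t => C t j) φ :=
    differentiableAt_coeff (eventually_mem hφ hadm) (by omega) (fun j hj => by
      rcases (by omega : (j : ℕ) = 0 ∨ (j : ℕ) = 1 ∨ (j : ℕ) = 2) with h | h | h
      · rw [show j = 0 from Fin.ext h]; exact hC0.differentiableAt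
      · rw [show j = 1 from Fin.ext (by simpa using h)]; exact hC1.differentiableAt
      · rw [show j = 2 from Fin.ext (h.trans rfl)]; exact hC2.differentiableAt) hCg
  set p := symPoly (ℓ + 1) (B φ) with hp
  set q := symPoly (ℓ + 2) (C φ) with hq
  set a := 2 * Real.cos φ with ha
  set ξ₀ := 2 * q.eval a / p.eval a with hξ₀
  have hpa : p.eval a ≠ 0 := (hB φ hφ).eval_ne_zero H
  have hqa : q.eval a = ξ₀ / 2 * p.eval a := by rw [hξ₀]; field_simp
  set h := Polynomial.C (ξ₀ / 2) * p - q with hh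
  have hroot : h.IsRoot a := by
    rw [Polynomial.IsRoot, hh, Polynomial.eval_sub, Polynomial.eval_mul, Polynomial.eval_C, hqa,
      sub_self]
  set h₁ := h /ₘ (Polynomial.X - Polynomial.C a) with hh₁
  have hfac : (Polynomial.X - Polynomial.C a) * h₁ = h :=
    Polynomial.mul_divByMonic_eq_iff_isRoot.2 hroot
  have hder := deriv_eq_of_root H (fun j => (hBd j).hasDerivAt) (fun j => (hCd j).hasDerivAt)
    (fun i hi => hBg.mono fun t ht => ht i hi) (fun i hi => hCg.mono fun t ht => ht i hi)
    (hB φ hφ).zero (hC φ hφ).zero hB0.deriv hB1.deriv hC0.deriv hC1.deriv hC2.deriv hfac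
  have hev := congrArg (Polynomial.eval a) hder
  rw [Polynomial.eval_sub, Polynomial.eval_mul, Polynomial.eval_mul, Polynomial.eval_C,
    Polynomial.eval_C] at hev
  have hderiv : h.derivative.eval a = h₁.eval a := by
    rw [← hfac]
    simp
  have hderiv' : ξ₀ / 2 * p.derivative.eval a - q.derivative.eval a = h₁.eval a := by
    rw [← hderiv, hh]
    simp
  have hPd := hasDerivAt_eval_symPoly fun j => (hBd j).hasDerivAt
  have hQd := hasDerivAt_eval_symPoly fun j => (hCd j).hasDerivAt
  -- Differentiate `h(2 cos φ) = 0`: the coefficients of `p` and `q` contribute `sin φ · h₁(a)`, the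
  -- moving argument `-2 sin φ · h₁(a)`, and `ξ` itself `ξ' p(a) / 2`.
  refine ⟨2 * Real.sin φ * (h₁.eval a / p.eval a), ?_, ?_⟩
  · have hquot := (hQd.const_mul 2).div hPd hpa
    refine (hquot.congr_of_eventuallyEq (eventually_mem hφ fun t ht =>
      xi_eq C ((hB t ht).eval_ne_zero (hadm t ht)))).congr_deriv ?_
    rw [← hp, ← hq, ← ha, hqa, ← mul_div_assoc, div_eq_div_iff (pow_ne_zero 2 hpa) hpa]
    linear_combination (-(2 * (p.eval a) ^ 2)) * hev +
      (4 * Real.sin φ * (p.eval a) ^ 2) * hderiv'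
  · have hφ0 : 0 < φ := by
      have := H.ang_pos (k := 2 * ℓ) (by omega) (by omega)
      rwa [ang_two_mul] at this
    have hsin : 0 < Real.sin φ := Real.sin_pos_of_pos_of_lt_pi hφ0 hφ.2
    obtain ⟨hpm, hpd⟩ := symPoly_monic (hB φ hφ).zero
    obtain ⟨hqm, hqd⟩ := symPoly_monic (hC φ hφ).zero
    obtain ⟨u, hu⟩ := ((hB φ hφ).normalized H).exists_roots H
    obtain ⟨v, hv⟩ := (Normalized.comb H ((hB φ hφ).normalized H) ((hC φ hφ).normalized H)
      (ξ₀ / 2)).exists_roots H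
    -- `q` dominates and enters `h` with a minus sign, so the monic polynomial to compare with `p`
    -- is `-h₁`.
    have hlow : (-(Polynomial.C (ξ₀ / 2) * p)).degree < q.degree := by
      rw [Polynomial.degree_neg, hqd, ← Polynomial.smul_eq_C_mul]
      refine (Polynomial.degree_smul_le _ _).trans_lt ?_
      rw [hpd]
      exact_mod_cast (by omega : ℓ + 1 < ℓ + 2)
    have hneg : (Polynomial.X - Polynomial.C a) * -h₁ = q + -(Polynomial.C (ξ₀ / 2) * p) := by
      rw [mul_neg, hfac, hh]
      ring
    have hm : ((Polynomial.X - Polynomial.C a) * -h₁).Monic := by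
      rw [hneg]
      exact hqm.add_of_left hlow
    have hm₁ : (-h₁).Monic := (Polynomial.monic_X_sub_C a).of_mul_monic_left hm
    have hd₁ : (-h₁).degree = (ℓ + 1 : ℕ) := by
      have h1 : ((Polynomial.X - Polynomial.C a) * -h₁).degree = ((ℓ + 2 : ℕ) : WithBot ℕ) := by
        rw [hneg, Polynomial.degree_add_eq_left_of_degree_lt hlow, hqd]
      rw [Polynomial.degree_mul, Polynomial.degree_X_sub_C,
        Polynomial.degree_eq_natDegree hm₁.ne_zero] at h1
      rw [Polynomial.degree_eq_natDegree hm₁.ne_zero]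
      have h2 : 1 + (-h₁).natDegree = ℓ + 2 := by exact_mod_cast h1
      exact_mod_cast (by omega : (-h₁).natDegree = ℓ + 1)
    have hpos := eval_mul_eval_pos H hpm hpd hm₁ hd₁ hu (v := v) fun i hi => by
      refine ⟨(hv i hi).1, ?_⟩
      have h1 := (hv i hi).2
      rw [← hp, ← hq, ← hh, ← hfac, Polynomial.eval_mul] at h1
      -- The root `v i` of `h` is distinct from the root removed with `X - a`, since `φ` is not
      -- interior to any gap; hence it is a root of `h₁`.
      rcases mul_eq_zero.1 h1 with h2 | h2
      · exfalso
        rw [Polynomial.eval_sub, Polynomial.eval_X, Polynomial.eval_C, sub_eq_zero, ha] at h2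
        have hvi := gap_point_mem H hi (hv i hi).1
        have h3 : v i = φ := Real.injOn_cos hvi ⟨hφ0.le, hφ.2.le⟩ (by linarith)
        have h4 := (hv i hi).1
        rw [h3] at h4
        rcases hi.lt_or_eq with h5 | rfl
        · have := fixedHi_lt H h5
          rw [ang_of_lt (by omega)] at h4
          exact lt_asymm this h4.2
        · rw [gapLo, if_neg (by omega), ang_two_mul] at h4
          exact lt_irrefl _ h4.1
      · rw [Polynomial.eval_neg, h2, neg_zero]
    rw [← hp, ← ha, Polynomial.eval_neg] at hpos
    have hneg' : h₁.eval a / p.eval a < 0 := by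
      rcases lt_or_gt_of_ne hpa with h3 | h3
      · exact div_neg_of_pos_of_neg (by nlinarith) h3
      · exact div_neg_of_neg_of_pos (by nlinarith) h3
    exact mul_neg_of_pos_of_neg (by linarith) hneg'

end DarkGas
end

/-! ### The theorem. -/

theorem mainTheorem5 (N : ℕ) (θ : ℕ → ℝ)
    (hθ : ∀ j ∈ Finset.Icc 1 (2 * N), θ j ∈ Set.Ioo 0 Real.pi)
    (hmono : StrictMonoOn θ (Set.Icc 1 (2 * N)))
    (ℓ : ℕ) (hℓ : ℓ ∈ Finset.Icc 1 N) :
    -- the coefficients of `P_ℓ` and `Q_ℓ` are well defined for every position of `α_ℓ`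
    (∀ φ ∈ Set.Ioo (θ (2 * ℓ - 1)) Real.pi,
      (∃! B : Fin (ℓ + 2) → ℝ, DarkGas.IsCoeffP θ ℓ φ B) ∧
      (∃! C : Fin (ℓ + 3) → ℝ, DarkGas.IsCoeffQ θ ℓ φ C)) ∧
    ∀ (B : ℝ → Fin (ℓ + 2) → ℝ) (C : ℝ → Fin (ℓ + 3) → ℝ),
      (∀ φ ∈ Set.Ioo (θ (2 * ℓ - 1)) Real.pi,
        DarkGas.IsCoeffP θ ℓ φ (B φ) ∧ DarkGas.IsCoeffQ θ ℓ φ (C φ)) →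
      -- `ξ` is well defined and real, with the same value at `α_ℓ` and `α_ℓ⁻¹`
      (∀ φ ∈ Set.Ioo (θ (2 * ℓ - 1)) Real.pi,
        DarkGas.P (B φ) (DarkGas.cis φ) ≠ 0 ∧ DarkGas.P (B φ) (DarkGas.cis φ)⁻¹ ≠ 0 ∧
        (DarkGas.xi B C φ : ℂ) =
          2 * DarkGas.Q (C φ) (DarkGas.cis φ) / DarkGas.P (B φ) (DarkGas.cis φ) ∧
        (DarkGas.xi B C φ : ℂ) =
          2 * DarkGas.Q (C φ) (DarkGas.cis φ)⁻¹ / DarkGas.P (B φ) (DarkGas.cis φ)⁻¹) ∧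
      -- `∂ξ/∂(arg α_ℓ) < 0`
      (∀ φ ∈ Set.Ioo (θ (2 * ℓ - 1)) Real.pi,
        ∃ ξ' : ℝ, HasDerivAt (DarkGas.xi B C) ξ' φ ∧ ξ' < 0) ∧
      -- `Re α_ℓ` is an increasing function of `ξ`
      (∃ a : ℝ → ℝ,
        StrictMonoOn a (DarkGas.xi B C '' Set.Ioo (θ (2 * ℓ - 1)) Real.pi) ∧
        ∀ φ ∈ Set.Ioo (θ (2 * ℓ - 1)) Real.pi,
          a (DarkGas.xi B C φ) = (DarkGas.cis φ).re) ∧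
      -- the function `g_ℓ`
      (∀ φ ∈ Set.Ioo (θ (2 * ℓ - 1)) Real.pi,
        DarkGas.IntegralsWellDefined θ ℓ φ (B φ) (C φ) ∧
        DarkGas.GProperties θ ℓ φ (DarkGas.xi B C φ)
          (DarkGas.Om θ ℓ φ (B φ) (C φ) (DarkGas.xi B C φ))
          (DarkGas.g θ ℓ φ (B φ) (C φ) (DarkGas.xi B C φ))) := by
  have hadm : ∀ φ ∈ Set.Ioo (θ (2 * ℓ - 1)) Real.pi, DarkGas.Admissible θ ℓ φ := fun φ hφ =>
    DarkGas.admissible_of_mem hθ hmono hℓ hφ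
  refine ⟨fun φ hφ => ⟨DarkGas.existsUnique_isCoeffP (hadm φ hφ),
    DarkGas.existsUnique_isCoeffQ (hadm φ hφ)⟩, fun B C hBC => ?_⟩
  have hpa : ∀ φ ∈ Set.Ioo (θ (2 * ℓ - 1)) Real.pi,
      (DarkGas.symPoly (ℓ + 1) (B φ)).eval (2 * Real.cos φ) ≠ 0 := fun φ hφ =>
    (hBC φ hφ).1.eval_ne_zero (hadm φ hφ)
  have hder : ∀ φ ∈ Set.Ioo (θ (2 * ℓ - 1)) Real.pi,
      ∃ ξ' : ℝ, HasDerivAt (DarkGas.xi B C) ξ' φ ∧ ξ' < 0 := fun φ hφ =>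
    DarkGas.exists_hasDerivAt_xi hadm (fun t ht => (hBC t ht).1) (fun t ht => (hBC t ht).2) hφ
  refine ⟨fun φ hφ => ?_, hder, ?_, fun φ hφ => ⟨?_, ?_⟩⟩
  · have h1 := DarkGas.Q_div_P (B φ) (C φ) φ (hpa φ hφ)
    -- `α⁻¹ = e^{-iφ}`, and the real expression for the quotient depends only on the cosine, so both
    -- endpoints give the same `ξ`.
    have h2 := DarkGas.Q_div_P (B φ) (C φ) (-φ) (by rw [Real.cos_neg]; exact hpa φ hφ)
    rw [Real.cos_neg, ← DarkGas.cis_inv] at h2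
    rw [h1.2, h2.2, DarkGas.xi_eq C (hpa φ hφ)]
    exact ⟨h1.1, h2.1, rfl, rfl⟩
  · have hanti : StrictAntiOn (DarkGas.xi B C) (Set.Ioo (θ (2 * ℓ - 1)) Real.pi) := by
      refine strictAntiOn_of_deriv_neg (convex_Ioo _ _) (fun φ hφ => ?_) fun φ hφ => ?_
      · obtain ⟨ξ', h, -⟩ := hder φ hφ
        exact h.continuousAt.continuousWithinAt
      · rw [interior_Ioo] at hφ
        obtain ⟨ξ', h, hneg⟩ := hder φ hφ
        rwa [h.deriv]
    have hinv : ∀ φ ∈ Set.Ioo (θ (2 * ℓ - 1)) Real.pi, Function.invFunOn (DarkGas.xi B C)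
        (Set.Ioo (θ (2 * ℓ - 1)) Real.pi) (DarkGas.xi B C φ) = φ := fun φ hφ =>
      hanti.injOn.leftInvOn_invFunOn hφ
    have hre : ∀ φ, (DarkGas.cis φ).re = Real.cos φ := fun φ => by
      rw [DarkGas.cis, Complex.exp_ofReal_mul_I_re]
    -- `Re α` as a function of `ξ` is the cosine, decreasing on `(0, π)`, of the inverse of `ξ`,
    -- also decreasing.
    refine ⟨fun x => Real.cos (Function.invFunOn (DarkGas.xi B C)
      (Set.Ioo (θ (2 * ℓ - 1)) Real.pi) x), ?_, fun φ hφ => by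
        simp only [hinv φ hφ, hre]⟩
    rintro _ ⟨φ, hφ, rfl⟩ _ ⟨ψ, hψ, rfl⟩ hlt
    simp only [hinv φ hφ, hinv ψ hψ]
    have hψφ : ψ < φ := (hanti.lt_iff_gt hφ hψ).1 hlt
    rw [Finset.mem_Icc] at hℓ
    have h0 : 0 < θ (2 * ℓ - 1) := (hθ _ (Finset.mem_Icc.2 ⟨by omega, by omega⟩)).1
    exact Real.cos_lt_cos_of_nonneg_of_le_pi (h0.trans hψ.1).le hφ.2.le hψφ
  · exact DarkGas.integralsWellDefined (hadm φ hφ) (hBC φ hφ).1 (hBC φ hφ).2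
  · refine (DarkGas.isGFunction_g (hadm φ hφ) (hBC φ hφ).1 (hBC φ hφ).2 ?_).gProperties (hadm φ hφ)
    have h1 := hpa φ hφ
    rw [DarkGas.xi_eq C h1, Polynomial.eval_sub, Polynomial.eval_mul, Polynomial.eval_C]
    field_simp
    ring
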